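/- Let $0\le T<\infty$ and let $(\Omega,\mathcal F,(\mathcal F_t)_{0\le t\le T},\mathbb P)$ be a filtered probability space satisfying the usual conditions. A simple integrand is a process $$H_t=\sum_{j=1}^n f_j\,\mathbf 1_{\{\tau_{j-1}<t\le\tau_j\}},\qquad 0\le t\le T,$$ where $n$ is a finite number, $0=\tau_0\le\tau_1\le\dots\le\tau_n=T$ are stopping times and $f_j\in L^\infty(\Omega,\mathcal F_{\tau_{j-1}},\mathbb P)$. For a process $S=(S_t)_{0\le t\le T}$ put $$(H\cdot S)_t=\sum_{j=1}^n f_j\,(S_{\tau_j\wedge t}-S_{\tau_{j-1}\wedge t}),\qquad 0\le t\le T,$$ and for a process $G=(G_t)_{0\le t\le T}$ put $\|G\|_\infty=\sup_{0\le t\le T}\|G_t\|_{L^\infty(\mathbb P)}\in[0,\infty]$. Write $x^+=\max(x,0)$ and $x^-=\max(-x,0)$. A property holds locally for a process $X$ if there are stopping times $\tau_1\le\tau_2\le\cdots$ (a.s.) with values in $[0,T]\cup\{\infty\}$ such that almost surely $\tau_n=\infty$ for all large $n$, and such that for every $n$ the stopped process $(X_{t\wedge\tau_n}\mathbf 1_{\{\tau_n>0\}})_{0\le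 t\le T}$ has the property. Thus $X$ is locally bounded if the property is uniform boundedness, and a local martingale is a càdlàg adapted process which is locally a martingale. Theorem. Let $S=(S_t)_{0\le t\le T}$ be a locally bounded, real-valued, càdlàg, adapted process. The following are equivalent. 1. $S$ admits no free lunch with vanishing risk and little investment: for every sequence $(H^n)_{n\ge1}$ of simple integrands with $\lim_n\|(H^n\cdot S)^-\|_\infty=0$ and $\lim_n\|H^n\|_\infty=0$, one has $(H^n\cdot S)_T^+\to0$ in probability. 2. $S$ is a semimartingale: $S=M+A$ with $M=(M_t)_{0\le t\le T}$ a local martingale and $A=(A_t)_{0\le t\le T}$ an adapted process whose paths almost surely have finite total variation on $[0,T]$. -/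

import Mathlib

open MeasureTheory ProbabilityTheory Filter Topology
open scoped NNReal ENNReal

namespace StochProc

/-- The time interval `[0,T]`. Its bottom element is `0` and its top element is `T`. -/
abbrev Time (T : ℝ≥0) : Type := Set.Iic T

/-- The usual conditions: the filtration is right-continuous, and already the σ-algebra at time `0`
contains every `P`-null set (as `P` is an outer measure on arbitrary sets, this includes all
subsets of null events, so the underlying probability space is complete). -/
structure UsualConditions {T : ℝ≥0} {Ω : Type*} {mΩ : MeasurableSpace Ω}
    (𝓕 : Filtration (Time T) mΩ) (P : Measure Ω) : Prop where
  rightCont : 𝓕.IsRightContinuous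
  complete : ∀ s : Set Ω, P s = 0 → MeasurableSet[𝓕 ⊥] s

/-- A path is càdlàg: right-continuous with (finite) left limits. -/
def IsCadlagPath {T : ℝ≥0} (x : Time T → ℝ) : Prop :=
  ∀ t, ContinuousWithinAt x (Set.Ici t) t ∧ ∃ l : ℝ, Tendsto x (𝓝[<] t) (𝓝 l)

/-- Almost all paths of the process are càdlàg. -/
def IsCadlag {T : ℝ≥0} {Ω : Type*} {mΩ : MeasurableSpace Ω}
    (P : Measure Ω) (X : Time T → Ω → ℝ) : Prop :=
  ∀ᵐ ω ∂P, IsCadlagPath (fun t => X t ω)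

/-- The process is uniformly bounded (up to a null set). -/
def IsUniformlyBounded {T : ℝ≥0} {Ω : Type*} {mΩ : MeasurableSpace Ω}
    (P : Measure Ω) (X : Time T → Ω → ℝ) : Prop :=
  ∃ C : ℝ, ∀ᵐ ω ∂P, ∀ t, |X t ω| ≤ C

/-- Local boundedness: there are stopping times `τ n`, almost surely non-decreasing in `n`, such
that each `X^{τ n} 1_{τ n > 0}` is uniformly bounded and almost surely `τ n = ⊤` for large `n`.
(`⊤ : WithTop [0,T]`, the stopping time "never", is isolated, since `[0,T]` has a largest element;
so convergence of `τ n` to `⊤` means precisely that it is eventually equal to `⊤`.) -/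
def IsLocallyBounded {T : ℝ≥0} {Ω : Type*} {mΩ : MeasurableSpace Ω}
    (𝓕 : Filtration (Time T) mΩ) (P : Measure Ω) (X : Time T → Ω → ℝ) : Prop :=
  Locally (IsUniformlyBounded P) 𝓕 X P

/-- A (càdlàg, adapted) local martingale on `[0,T]`. -/
structure IsLocalMartingale {T : ℝ≥0} {Ω : Type*} {mΩ : MeasurableSpace Ω}
    (𝓕 : Filtration (Time T) mΩ) (P : Measure Ω) (M : Time T → Ω → ℝ) : Prop where
  adapted : StronglyAdapted 𝓕 M
  cadlag : IsCadlag P M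
  locally_martingale : Locally (fun X => Martingale X 𝓕 P) 𝓕 M P

/-- An adapted process almost all of whose paths have finite total variation on `[0,T]`. -/
structure IsFiniteVariation {T : ℝ≥0} {Ω : Type*} {mΩ : MeasurableSpace Ω}
    (𝓕 : Filtration (Time T) mΩ) (P : Measure Ω) (A : Time T → Ω → ℝ) : Prop where
  adapted : StronglyAdapted 𝓕 A
  boundedVariation : ∀ᵐ ω ∂P, BoundedVariationOn (fun t => A t ω) Set.univ

/-- `S` is a semimartingale: `S = M + A` with `M` a local martingale and `A` an adapted process of
finite variation. (If `S` is càdlàg, then `A = S - M` is automatically càdlàg.) -/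
def IsSemimartingale {T : ℝ≥0} {Ω : Type*} {mΩ : MeasurableSpace Ω}
    (𝓕 : Filtration (Time T) mΩ) (P : Measure Ω) (S : Time T → Ω → ℝ) : Prop :=
  ∃ M A : Time T → Ω → ℝ,
    IsLocalMartingale 𝓕 P M ∧ IsFiniteVariation 𝓕 P A ∧ ∀ t ω, S t ω = M t ω + A t ω

/-- A simple integrand `∑_{j=1}^n f_j 1_{⟧τ_{j-1}, τ_j⟧}`: stopping times
`0 = τ_0 ≤ τ_1 ≤ ⋯ ≤ τ_n = T` and `f_j ∈ L^∞(Ω, 𝓕_{τ_{j-1}}, P)`. The coefficient `f_{j+1}` is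
stored as `f j` with `j : Fin n`; it belongs to the interval from `τ j.castSucc` to `τ j.succ`. -/
structure SimpleIntegrand {T : ℝ≥0} {Ω : Type*} {mΩ : MeasurableSpace Ω}
    (𝓕 : Filtration (Time T) mΩ) (P : Measure Ω) where
  n : ℕ
  τ : Fin (n + 1) → Ω → Time T
  isStoppingTime : ∀ j, IsStoppingTime 𝓕 (fun ω => (τ j ω : WithTop (Time T)))
  mono : ∀ ω, Monotone (fun j => τ j ω)
  τ_zero : ∀ ω, τ 0 ω = ⊥
  τ_last : ∀ ω, τ (Fin.last n) ω = ⊤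
  f : Fin n → Ω → ℝ
  measurable_f : ∀ j, Measurable[(isStoppingTime j.castSucc).measurableSpace] (f j)
  memLp_f : ∀ j, MemLp (f j) ∞ P

namespace SimpleIntegrand

open Classical in
/-- The simple integrand as a process, `H_t = ∑_j f_j 1_{τ_{j-1} < t ≤ τ_j}`. -/
noncomputable def process {T : ℝ≥0} {Ω : Type*} {mΩ : MeasurableSpace Ω}
    {𝓕 : Filtration (Time T) mΩ} {P : Measure Ω}
    (H : SimpleIntegrand 𝓕 P) (t : Time T) (ω : Ω) : ℝ :=
  ∑ j : Fin H.n, if H.τ j.castSucc ω < t ∧ t ≤ H.τ j.succ ω then H.f j ω else 0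

/-- The elementary integral `(H·S)_t = ∑_j f_j (S_{τ_j ∧ t} - S_{τ_{j-1} ∧ t})`. -/
noncomputable def integral {T : ℝ≥0} {Ω : Type*} {mΩ : MeasurableSpace Ω}
    {𝓕 : Filtration (Time T) mΩ} {P : Measure Ω}
    (H : SimpleIntegrand 𝓕 P) (S : Time T → Ω → ℝ) (t : Time T) (ω : Ω) : ℝ :=
  ∑ j : Fin H.n,
    H.f j ω * (S (min (H.τ j.succ ω) t) ω - S (min (H.τ j.castSucc ω) t) ω)

end SimpleIntegrand

/-- `‖G‖_∞ = sup_{0 ≤ t ≤ T} ‖G_t‖_{L^∞(P)}`, with values in `[0,∞]`. -/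
noncomputable def supNorm {T : ℝ≥0} {Ω : Type*} {mΩ : MeasurableSpace Ω}
    (P : Measure Ω) (G : Time T → Ω → ℝ) : ℝ≥0∞ :=
  ⨆ t, eLpNorm (G t) ∞ P

/-- No free lunch with vanishing risk and little investment: for simple integrands `H k` with
`‖(H k·S)⁻‖_∞ → 0` and `‖H k‖_∞ → 0`, one has `(H k·S)_T⁺ → 0` in probability. -/
def NoFreeLunchVanishingRiskLittleInvestment {T : ℝ≥0} {Ω : Type*} {mΩ : MeasurableSpace Ω}
    (𝓕 : Filtration (Time T) mΩ) (P : Measure Ω) (S : Time T → Ω → ℝ) : Prop :=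
  ∀ H : ℕ → SimpleIntegrand 𝓕 P,
    Tendsto (fun k => supNorm P (fun t ω => max (-(H k).integral S t ω) 0)) atTop (𝓝 0) →
    Tendsto (fun k => supNorm P (H k).process) atTop (𝓝 0) →
    TendstoInMeasure P (fun k ω => max ((H k).integral S ⊤ ω) 0) atTop (fun _ => 0)

end StochProc

namespace StochProc

/-! ### Dyadic grids and variation along them. -/

section Grid

variable {T : ℝ≥0}

/-- The `j`-th point of the `n`-th dyadic grid of `[0,T]`; it is `T` from `j = 2 ^ n` on. -/
noncomputable def gridPt (n j : ℕ) : Time T :=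
  ⟨T * min ((j : ℝ≥0) / 2 ^ n) 1, by
    simpa using mul_le_mul_right (min_le_right ((j : ℝ≥0) / 2 ^ n) 1) T⟩

/-- The index of the first point of the `n`-th grid that is not before `t`. -/
noncomputable def gridIdx (n : ℕ) (t : Time T) : ℕ := ⌈(t : ℝ≥0) / T * 2 ^ n⌉₊

/-- The first point of the `n`-th grid that is not before `t`. -/
noncomputable def gridCeil (n : ℕ) (t : Time T) : Time T := gridPt n (gridIdx n t)

/-- A point of the `n`-th grid that is after `t` (unless `t = T`). -/
noncomputable def gridSucc (n : ℕ) (t : Time T) : Time T := gridPt n (gridIdx n t + 1)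

lemma coe_gridPt (n j : ℕ) : ((gridPt n j : Time T) : ℝ≥0) = T * min ((j : ℝ≥0) / 2 ^ n) 1 := rfl

lemma gridPt_mono (n : ℕ) : Monotone (gridPt n : ℕ → Time T) := by
  intro i j hij
  rw [← Subtype.coe_le_coe, coe_gridPt, coe_gridPt]
  gcongr

lemma gridPt_zero (n : ℕ) : (gridPt n 0 : Time T) = ⊥ := by
  ext; simp [coe_gridPt]

lemma gridPt_eq_top {n j : ℕ} (h : 2 ^ n ≤ j) : (gridPt n j : Time T) = ⊤ := by
  ext
  have : (1 : ℝ≥0) ≤ (j : ℝ≥0) / 2 ^ n := by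
    rw [le_div_iff₀ (by positivity), one_mul]; exact_mod_cast h
  rw [coe_gridPt, min_eq_right this]; simp

lemma gridPt_refine {n k : ℕ} (h : n ≤ k) (j : ℕ) :
    (gridPt n j : Time T) = gridPt k (j * 2 ^ (k - n)) := by
  ext
  obtain ⟨d, rfl⟩ := Nat.exists_eq_add_of_le h
  rw [coe_gridPt, coe_gridPt, Nat.add_sub_cancel_left, pow_add]
  push_cast
  rw [mul_div_mul_right _ _ (by positivity)]

lemma gridIdx_mono (n : ℕ) : Monotone (gridIdx n : Time T → ℕ) := by
  intro s t hst
  apply Nat.ceil_mono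
  have : (s : ℝ≥0) ≤ t := hst
  gcongr

lemma gridIdx_le (n : ℕ) (t : Time T) : gridIdx n t ≤ 2 ^ n := by
  apply Nat.ceil_le.mpr
  push_cast
  exact mul_le_of_le_one_left (by positivity) (div_le_one_of_le₀ t.2 (by positivity))

lemma gridIdx_le_of_le {n j : ℕ} {t : Time T} (h : t ≤ gridPt n j) : gridIdx n t ≤ j := by
  apply Nat.ceil_le.mpr
  have h' : (t : ℝ≥0) ≤ T * (j / 2 ^ n) :=
    (show (t : ℝ≥0) ≤ (gridPt n j : Time T) from h).trans
      (by rw [coe_gridPt]; gcongr; exact min_le_left _ _)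
  rcases eq_or_ne T 0 with hT | hT
  · simp [hT]
  · rw [div_mul_eq_mul_div, div_le_iff₀ (by positivity)]
    calc (t : ℝ≥0) * 2 ^ n ≤ T * (j / 2 ^ n) * 2 ^ n := by gcongr
      _ = j * T := by field_simp

lemma le_gridCeil (n : ℕ) (t : Time T) : t ≤ gridCeil n t := by
  show (t : ℝ≥0) ≤ (gridPt n (gridIdx n t) : Time T)
  rw [coe_gridPt]
  rcases eq_or_ne T 0 with hT | hT
  · have := t.2; simp [hT] at this ⊢; exact this
  · have h1 : (t : ℝ≥0) / T ≤ (gridIdx n t : ℝ≥0) / 2 ^ n := by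
      rw [le_div_iff₀ (by positivity)]; exact Nat.le_ceil _
    have h2 : (t : ℝ≥0) / T ≤ 1 := div_le_one_of_le₀ t.2 (by positivity)
    calc (t : ℝ≥0) = T * (t / T) := by field_simp
      _ ≤ _ := by gcongr; exact le_min h1 h2

lemma gridCeil_le_of_le {n j : ℕ} {t : Time T} (h : t ≤ gridPt n j) : gridCeil n t ≤ gridPt n j :=
  gridPt_mono n (gridIdx_le_of_le h)

lemma gridCeil_gridPt (n j : ℕ) : gridCeil n (gridPt n j : Time T) = gridPt n j :=
  le_antisymm (gridCeil_le_of_le le_rfl) (le_gridCeil _ _)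

lemma gridCeil_mono (n : ℕ) : Monotone (gridCeil n : Time T → Time T) :=
  (gridPt_mono n).comp (gridIdx_mono n)

/-- The grids are nested, so a finer grid rounds up no further. Thus a function of bounded variation
converges along the roundings of a fixed time. -/
lemma gridCeil_antitone (t : Time T) : Antitone fun n => gridCeil n t := by
  intro n k h
  show gridCeil k t ≤ gridCeil n t
  have := le_gridCeil n t
  rw [gridCeil, gridPt_refine h] at this
  rw [gridCeil.eq_def n, gridPt_refine h]
  exact gridCeil_le_of_le this

lemma gridCeil_le_gridSucc (n : ℕ) (t : Time T) : gridCeil n t ≤ gridSucc n t :=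
  gridPt_mono n (Nat.le_succ _)

/-- The additional grid step makes the inequality strict, as needed for computing right limits along
grid points. -/
lemma lt_gridSucc (n : ℕ) {t : Time T} (h : t < ⊤) : t < gridSucc n t := by
  refine lt_of_le_of_ne ((le_gridCeil n t).trans (gridCeil_le_gridSucc n t)) fun he => ?_
  rcases le_or_gt (2 ^ n) (gridIdx n t + 1) with h1 | h1
  · rw [gridSucc, gridPt_eq_top h1] at he; exact h.ne he
  · have h0 : (0 : ℝ≥0) < T := lt_of_le_of_lt bot_le (show (t : ℝ≥0) < T from h)
    have h2 : (gridCeil n t : ℝ≥0) < gridSucc n t := by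
      rw [gridCeil, gridSucc, coe_gridPt, coe_gridPt]
      have h3 : ((gridIdx n t + 1 : ℕ) : ℝ≥0) / 2 ^ n < 1 := by
        rw [div_lt_one (by positivity)]; exact_mod_cast h1
      rw [min_eq_left h3.le]
      refine mul_lt_mul_of_pos_left ((min_le_left _ _).trans_lt ?_) h0
      gcongr; simp
    exact absurd (he ▸ le_gridCeil n t) (not_le.mpr (show gridCeil n t < gridSucc n t from h2))

lemma gridSucc_le (n : ℕ) (t : Time T) : (gridSucc n t : ℝ≥0) ≤ t + T * (2 / 2 ^ n) := by
  rw [gridSucc, coe_gridPt]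
  rcases eq_or_ne T 0 with hT | hT
  · simp [hT]
  have h1 : (gridIdx n t : ℝ≥0) ≤ t / T * 2 ^ n + 1 := (Nat.ceil_lt_add_one (by positivity)).le
  calc T * min (((gridIdx n t + 1 : ℕ) : ℝ≥0) / 2 ^ n) 1 ≤
      T * (((gridIdx n t + 1 : ℕ) : ℝ≥0) / 2 ^ n) := by gcongr; exact min_le_left _ _
    _ ≤ T * ((t / T * 2 ^ n + 1 + 1) / 2 ^ n) := by push_cast; gcongr
    _ = t + T * (2 / 2 ^ n) := by field_simp; ring

lemma tendsto_gridSucc (t : Time T) : Tendsto (fun n => gridSucc n t) atTop (𝓝 t) := by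
  rw [tendsto_subtype_rng]
  refine tendsto_of_tendsto_of_tendsto_of_le_of_le (tendsto_const_nhds (x := (t : ℝ≥0)))
    (?_ : Tendsto (fun n : ℕ => (t : ℝ≥0) + T * (2 / 2 ^ n)) atTop (𝓝 (t : ℝ≥0)))
    (fun n => (le_gridCeil n t).trans (gridCeil_le_gridSucc n t)) (fun n => gridSucc_le n t)
  have : Tendsto (fun n : ℕ => (2 : ℝ≥0) / 2 ^ n) atTop (𝓝 0) := by
    have := (NNReal.tendsto_pow_atTop_nhds_zero_of_lt_one (r := (1 / 2 : ℝ≥0))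
      (by rw [div_lt_one (by norm_num)]; norm_num)).const_mul 2
    simpa [div_eq_mul_inv] using this
  simpa using (this.const_mul T).const_add (t : ℝ≥0)

lemma tendsto_gridCeil (t : Time T) : Tendsto (fun n => gridCeil n t) atTop (𝓝 t) :=
  tendsto_of_tendsto_of_tendsto_of_le_of_le tendsto_const_nhds (tendsto_gridSucc t)
    (fun n => le_gridCeil n t) (fun n => gridCeil_le_gridSucc n t)

lemma tendsto_gridCeil_Ici (t : Time T) : Tendsto (fun n => gridCeil n t) atTop (𝓝[≥] t) :=
  tendsto_nhdsWithin_iff.mpr ⟨tendsto_gridCeil t, Eventually.of_forall fun n => le_gridCeil n t⟩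

lemma tendsto_gridSucc_Ioi {t : Time T} (ht : t < ⊤) :
    Tendsto (fun n => gridSucc n t) atTop (𝓝[>] t) :=
  tendsto_nhdsWithin_iff.mpr ⟨tendsto_gridSucc t, Eventually.of_forall fun n => lt_gridSucc n ht⟩

lemma tendsto_comp_gridCeil {x : Time T → ℝ} {t : Time T}
    (hx : ContinuousWithinAt x (Set.Ici t) t) :
    Tendsto (fun n => x (gridCeil n t)) atTop (𝓝 (x t)) :=
  hx.tendsto.comp (tendsto_gridCeil_Ici t)

/-- The set of points of the `n`-th grid. -/
def gridSet (T : ℝ≥0) (n : ℕ) : Set (Time T) := Set.range (gridPt n)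

/-- The countable dense set of all grid points. -/
def gridUnion (T : ℝ≥0) : Set (Time T) := ⋃ n, gridSet T n

lemma gridPt_mem (n j : ℕ) : gridPt n j ∈ gridSet T n := ⟨j, rfl⟩

lemma gridSet_mono : Monotone (gridSet T) := by
  rintro n k h _ ⟨j, rfl⟩
  rw [gridPt_refine h]; exact gridPt_mem _ _

lemma gridPt_mem_union (n j : ℕ) : gridPt n j ∈ gridUnion T := Set.mem_iUnion.mpr ⟨n, j, rfl⟩

lemma gridSet_subset_union (n : ℕ) : gridSet T n ⊆ gridUnion T :=
  Set.subset_iUnion (gridSet T) n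

lemma countable_gridUnion : (gridUnion T).Countable :=
  Set.countable_iUnion fun _ => Set.countable_range _

lemma gridCeil_eq_self {n : ℕ} {t : Time T} (h : t ∈ gridSet T n) : gridCeil n t = t := by
  obtain ⟨j, rfl⟩ := h; exact gridCeil_gridPt n j

lemma top_mem_gridSet (n : ℕ) : (⊤ : Time T) ∈ gridSet T n := ⟨2 ^ n, gridPt_eq_top le_rfl⟩

/-- The variation over all grid points is the limit of the variations over the grids. -/
lemma eVariationOn_gridUnion_le {x : Time T → ℝ} {C : ℝ≥0∞}
    (h : ∀ n, eVariationOn x (gridSet T n) ≤ C) : eVariationOn x (gridUnion T) ≤ C := by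
  by_contra! hlt
  -- Variation is lower semicontinuous under pointwise convergence, and at a grid point the rounded
  -- function is eventually equal to `x`.
  have hlim : ∀ t ∈ gridUnion T, Tendsto (fun n => (x ∘ gridCeil n) t) atTop (𝓝 (x t)) := by
    intro t ht
    obtain ⟨m, hm⟩ := Set.mem_iUnion.mp ht
    refine tendsto_const_nhds.congr' ?_
    filter_upwards [eventually_ge_atTop m] with n hn
    rw [Function.comp_apply, gridCeil_eq_self (gridSet_mono hn hm)]
  obtain ⟨n, hn⟩ := (eVariationOn.lowerSemicontinuous_aux hlim hlt).exists
  exact absurd (eVariationOn.comp_le_of_monotoneOn x (gridCeil n) ((gridCeil_mono n).monotoneOn _)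
    (fun t _ => gridPt_mem n (gridIdx n t))) (not_le.mpr ((h n).trans_lt hn))

/-- For right-continuous paths, the variation over the grid points is the full variation. -/
lemma eVariationOn_univ_le {x : Time T → ℝ}
    (hx : ∀ t, ContinuousWithinAt x (Set.Ici t) t) :
    eVariationOn x Set.univ ≤ eVariationOn x (gridUnion T) := by
  by_contra! hlt
  obtain ⟨n, hn⟩ := (eVariationOn.lowerSemicontinuous_aux
    (fun t _ => tendsto_comp_gridCeil (hx t) : ∀ t ∈ Set.univ,
      Tendsto (fun n => (x ∘ gridCeil n) t) atTop (𝓝 (x t))) hlt).exists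
  exact absurd (eVariationOn.comp_le_of_monotoneOn x (gridCeil n) ((gridCeil_mono n).monotoneOn _)
    (fun t _ => gridPt_mem_union n (gridIdx n t))) (not_le.mpr hn)

/-- A function of bounded variation on the grid points has a càdlàg regularization. -/
lemma exists_cadlag_regularization {b : Time T → ℝ} (hb : BoundedVariationOn b (gridUnion T)) :
    ∃ b' : Time T → ℝ, BoundedVariationOn b' Set.univ ∧ IsCadlagPath b' ∧
      ∀ t, Tendsto (fun n => b (gridSucc n t)) atTop (𝓝 (b' t)) := by
  have hex : ∀ t : Time T, ∃ l, Tendsto (fun n => b (gridCeil n t)) atTop (𝓝 l) := by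
    intro t
    have : BoundedVariationOn (b ∘ fun n => gridCeil n t) Set.univ :=
      ((eVariationOn.comp_le_of_antitoneOn b (fun n => gridCeil n t)
        ((gridCeil_antitone t).antitoneOn _)
        (fun n _ => gridPt_mem_union n (gridIdx n t))).trans_lt hb.lt_top).ne
    simpa [Function.comp_def] using this.exists_tendsto_atTop
  choose g hg using hex
  have hgb : ∀ t ∈ gridUnion T, g t = b t := by
    intro t ht
    obtain ⟨m, hm⟩ := Set.mem_iUnion.mp ht
    refine tendsto_nhds_unique (hg t) (tendsto_const_nhds.congr' ?_)
    filter_upwards [eventually_ge_atTop m] with n hn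
    rw [gridCeil_eq_self (gridSet_mono hn hm)]
  -- `g` extends `b` from the grid points to all times without increasing the variation, again by
  -- lower semicontinuity.
  have hgv : BoundedVariationOn g Set.univ := by
    refine ne_top_of_le_ne_top hb ?_
    by_contra! hlt
    obtain ⟨n, hn⟩ := (eVariationOn.lowerSemicontinuous_aux
      (fun t _ => hg t : ∀ t ∈ Set.univ,
        Tendsto (fun n => (b ∘ gridCeil n) t) atTop (𝓝 (g t))) hlt).exists
    exact absurd (eVariationOn.comp_le_of_monotoneOn b (gridCeil n)
      ((gridCeil_mono n).monotoneOn _)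
      (fun t _ => gridPt_mem_union n (gridIdx n t))) (not_le.mpr hn)
  -- The right limits of `g` can be read off along `gridSucc`, where `g` agrees with `b`; at `T`
  -- there is nothing to the right and the value is kept.
  refine ⟨Function.rightLim g, hgv.rightLim, fun t => ⟨hgv.continuousWithinAt_rightLim, _,
    hgv.rightLim.tendsto_leftLim t⟩, fun t => ?_⟩
  rcases eq_or_lt_of_le (le_top : t ≤ ⊤) with rfl | ht
  · rw [rightLim_eq_of_isTop isTop_top, hgb _ (gridSet_subset_union 0 (top_mem_gridSet 0))]
    refine tendsto_const_nhds.congr fun n => ?_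
    rw [top_le_iff.mp ((le_gridCeil n (⊤ : Time T)).trans (gridCeil_le_gridSucc n _))]
  · refine ((hgv.tendsto_rightLim t).comp (tendsto_gridSucc_Ioi ht)).congr fun n => ?_
    exact hgb _ (gridPt_mem_union n _)

end Grid

/-! ### Stopping a path at a possibly infinite time. -/

section StopAt

variable {T : ℝ≥0}

/-- The time `t ∧ a`, for a possibly infinite `a`. -/
noncomputable def stopAt (t : Time T) (a : WithTop (Time T)) : Time T := (min (t : WithTop _) a).untopA

lemma coe_stopAt (t : Time T) (a : WithTop (Time T)) : (stopAt t a : WithTop (Time T)) = min ↑t a := by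
  rw [stopAt, WithTop.untopA_eq_untop (by simp), WithTop.coe_untop]

lemma stopAt_top (t : Time T) : stopAt t ⊤ = t := by
  rw [← WithTop.coe_inj, coe_stopAt, min_eq_left le_top]

lemma stopAt_coe (t s : Time T) : stopAt t (s : WithTop (Time T)) = min t s := by
  rw [← WithTop.coe_inj, coe_stopAt, WithTop.coe_min]

lemma stopAt_of_le {t : Time T} {a : WithTop (Time T)} (h : ↑t ≤ a) : stopAt t a = t := by
  rw [← WithTop.coe_inj, coe_stopAt, min_eq_left h]

lemma stopAt_le (t : Time T) (a : WithTop (Time T)) : stopAt t a ≤ t := by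
  rw [← WithTop.coe_le_coe, coe_stopAt]; exact min_le_left _ _

lemma stopAt_bot (t : Time T) : stopAt t ⊥ = ⊥ := by
  rw [← WithTop.coe_bot, stopAt_coe, min_bot_right]

lemma bot_stopAt (a : WithTop (Time T)) : stopAt ⊥ a = ⊥ := le_bot_iff.mp (stopAt_le _ _)

lemma stopAt_mono (a : WithTop (Time T)) : Monotone fun t : Time T => stopAt t a := by
  intro s t h
  show stopAt s a ≤ stopAt t a
  rw [← WithTop.coe_le_coe, coe_stopAt, coe_stopAt]
  exact min_le_min_right _ (WithTop.coe_le_coe.mpr h)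

lemma stopAt_stopAt (t : Time T) (a b : WithTop (Time T)) :
    stopAt (stopAt t a) b = stopAt t (min a b) := by
  rw [← WithTop.coe_inj, coe_stopAt, coe_stopAt, coe_stopAt, min_assoc]

lemma stopAt_min (s t : Time T) (a : WithTop (Time T)) :
    stopAt (min s t) a = min s (stopAt t a) := by
  rw [← WithTop.coe_inj, coe_stopAt, WithTop.coe_min, WithTop.coe_min, coe_stopAt, min_assoc]

lemma min_stopAt (s t : Time T) (a : WithTop (Time T)) :
    min (stopAt s a) t = stopAt (min s t) a := by
  rw [min_comm, ← stopAt_min, min_comm]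

lemma continuous_stopAt (a : WithTop (Time T)) : Continuous fun t : Time T => stopAt t a := by
  cases a with
  | top => simpa [stopAt_top] using continuous_id'
  | coe s => simpa [stopAt_coe] using continuous_id.min continuous_const

/-- Just before `t` the stopped clock is either still running or already frozen; this gives the left
limits of stopped paths. -/
lemma stopAt_eq_or (a : WithTop (Time T)) (t : Time T) :
    (∀ᶠ s in 𝓝[<] t, stopAt s a = s) ∨ (∀ᶠ s in 𝓝[<] t, stopAt s a = stopAt t a) := by
  rcases le_or_gt (t : WithTop (Time T)) a with h | h
  · left
    filter_upwards [self_mem_nhdsWithin] with s hs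
    exact stopAt_of_le ((WithTop.coe_le_coe.mpr (le_of_lt hs)).trans h)
  · right
    lift a to Time T using (h.trans_le le_top).ne
    have h' : a < t := by exact_mod_cast h
    filter_upwards [Ioo_mem_nhdsLT h'] with s hs
    rw [stopAt_coe, stopAt_coe, min_eq_right h'.le, min_eq_right hs.1.le]

/-- Stopping preserves the càdlàg property. -/
lemma IsCadlagPath.comp_stopAt {x : Time T → ℝ} (hx : IsCadlagPath x) (a : WithTop (Time T)) :
    IsCadlagPath fun t => x (stopAt t a) := by
  intro t
  constructor
  · exact ContinuousWithinAt.comp (f := fun t => stopAt t a) (hx (stopAt t a)).1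
      (continuous_stopAt a).continuousWithinAt fun s hs => stopAt_mono a hs
  · rcases stopAt_eq_or a t with h | h
    · obtain ⟨l, hl⟩ := (hx t).2
      exact ⟨l, hl.congr' (h.mono fun s hs => by simp only [hs])⟩
    · exact ⟨x (stopAt t a), tendsto_const_nhds.congr' (h.mono fun s hs => by simp only [hs])⟩

lemma IsCadlagPath.sub {x y : Time T → ℝ} (hx : IsCadlagPath x) (hy : IsCadlagPath y) :
    IsCadlagPath fun t => x t - y t := by
  intro t
  obtain ⟨l, hl⟩ := (hx t).2
  obtain ⟨m, hm⟩ := (hy t).2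
  exact ⟨(hx t).1.sub (hy t).1, _, hl.sub hm⟩

lemma IsCadlagPath.add {x y : Time T → ℝ} (hx : IsCadlagPath x) (hy : IsCadlagPath y) :
    IsCadlagPath fun t => x t + y t := by
  intro t
  obtain ⟨l, hl⟩ := (hx t).2
  obtain ⟨m, hm⟩ := (hy t).2
  exact ⟨(hx t).1.add (hy t).1, _, hl.add hm⟩

lemma isCadlagPath_const (c : ℝ) : IsCadlagPath fun _ : Time T => c :=
  fun _ => ⟨continuousWithinAt_const, c, tendsto_const_nhds⟩

lemma IsCadlagPath.sum {ι : Type*} {x : ι → Time T → ℝ} (s : Finset ι)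
    (hx : ∀ i ∈ s, IsCadlagPath (x i)) : IsCadlagPath fun t => ∑ i ∈ s, x i t := by
  classical
  induction s using Finset.induction_on with
  | empty => simpa using isCadlagPath_const 0
  | insert i s hi ih =>
    simp only [Finset.sum_insert hi]
    exact (hx i (Finset.mem_insert_self _ _)).add
      (ih fun j hj => hx j (Finset.mem_insert_of_mem hj))

end StopAt

/-! ### Stopping times for a right-continuous filtration. -/

section StoppingTimes

variable {T : ℝ≥0} {Ω : Type*} {mΩ : MeasurableSpace Ω} {𝓕 : Filtration (Time T) mΩ}
  {P : Measure Ω}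

lemma measurableSet_of_forall_gt (h𝓕 : 𝓕.IsRightContinuous) {t : Time T} (ht : t < ⊤) {s : Set Ω}
    (hs : ∀ u, t < u → MeasurableSet[𝓕 u] s) : MeasurableSet[𝓕 t] s := by
  apply h𝓕.RC t s
  rw [Filtration.rightCont_eq_of_not_isMax 𝓕 (not_isMax_of_lt ht)]
  simp only [MeasurableSpace.measurableSet_iInf]
  exact fun u hu => hs u hu

lemma exists_isGLB_withTop {κ : Type*} (f : κ → WithTop (Time T)) :
    ∃ a, IsGLB (Set.range f) a := by
  by_cases h : ∃ k, f k ≠ ⊤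
  · obtain ⟨k₀, hk₀⟩ := h
    set S : Set ℝ≥0 := {x | ∃ t : Time T, (t : ℝ≥0) = x ∧ (t : WithTop (Time T)) ∈ Set.range f}
    have hmem : ∀ k (t : Time T), f k = t → (t : ℝ≥0) ∈ S := fun k t h => ⟨t, rfl, k, h⟩
    lift f k₀ to Time T using hk₀ with t₀ ht₀
    have h0 : sInf S ≤ T := (csInf_le (OrderBot.bddBelow _) (hmem k₀ t₀ ht₀.symm)).trans t₀.2
    refine ⟨((⟨sInf S, h0⟩ : Time T) : WithTop (Time T)), ?_, ?_⟩
    · rintro _ ⟨k, rfl⟩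
      cases hk : f k with
      | top => exact le_top
      | coe t =>
        rw [WithTop.coe_le_coe]
        exact csInf_le (OrderBot.bddBelow _) (hmem k t hk)
    · intro b hb
      have hb0 : b ≤ t₀ := ht₀ ▸ hb ⟨k₀, rfl⟩
      lift b to Time T using (hb0.trans_lt (WithTop.coe_lt_top _)).ne
      rw [WithTop.coe_le_coe]
      refine le_csInf ⟨_, hmem k₀ t₀ ht₀.symm⟩ ?_
      rintro _ ⟨t, rfl, ht⟩
      exact show b ≤ t from WithTop.coe_le_coe.mp (hb ht)
  · push Not at h
    refine ⟨⊤, ?_, fun b _ => le_top⟩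
    rintro _ ⟨k, rfl⟩
    rw [h k]

/-- Countable infima of stopping times are stopping times. -/
lemma exists_isStoppingTime_iInf (h𝓕 : 𝓕.IsRightContinuous) {κ : Type*} [Countable κ]
    {τ : κ → Ω → WithTop (Time T)} (hτ : ∀ k, IsStoppingTime 𝓕 (τ k)) :
    ∃ ρ : Ω → WithTop (Time T), IsStoppingTime 𝓕 ρ ∧ ∀ ω, IsGLB (Set.range fun k => τ k ω) (ρ ω) := by
  choose ρ hρ using fun ω => exists_isGLB_withTop fun k => τ k ω
  have hlt : ∀ u : WithTop (Time T), {ω | ρ ω < u} = ⋃ k, {ω | τ k ω < u} := by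
    intro u
    ext ω
    simp only [Set.mem_ofPred_eq, Set.mem_iUnion, isGLB_lt_iff (hρ ω), Set.mem_range,
      exists_exists_eq_and]
  refine ⟨ρ, fun t => ?_, hρ⟩
  -- At the last time, `≤ T` means `< ⊤` and a countable union suffices. Right-continuity is needed
  -- only before `T`.
  rcases eq_or_lt_of_le (le_top : t ≤ ⊤) with rfl | ht
  · have h1 : ∀ a : WithTop (Time T), a ≤ (⊤ : Time T) ↔ a < ⊤ := by
      intro a
      cases a with
      | top => simp
      | coe t => simp
    simp_rw [h1]
    rw [hlt]
    refine MeasurableSet.iUnion fun k => ?_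
    simp_rw [← h1]
    exact hτ k ⊤
  · refine measurableSet_of_forall_gt h𝓕 ht fun u hu => ?_
    -- Strict inequalities at times decreasing to `t`; the minimum with `u` keeps the events in `𝓕
    -- u`.
    have : {ω | ρ ω ≤ t} = ⋂ m, {ω | ρ ω < (min u (gridSucc m t) : Time T)} := by
      ext ω
      simp only [Set.mem_ofPred_eq, Set.mem_iInter]
      refine ⟨fun h m => h.trans_lt (WithTop.coe_lt_coe.mpr (lt_min hu (lt_gridSucc m ht))),
        fun h => ?_⟩
      lift ρ ω to Time T using ((h 0).trans_le le_top).ne with r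
      rw [WithTop.coe_le_coe]
      refine ge_of_tendsto' (tendsto_gridSucc t) fun m => ?_
      exact ((WithTop.coe_lt_coe.mp (h m)).trans_le (min_le_right _ _)).le
    rw [this]
    refine MeasurableSet.iInter fun m => ?_
    rw [hlt]
    refine MeasurableSet.iUnion fun k => ?_
    exact 𝓕.mono (min_le_left _ _) _ ((hτ k).measurableSet_lt _)

/-- Rounding a stopping time up to a grid gives a stopping time. -/
lemma isStoppingTime_gridCeil {τ : Ω → Time T}
    (hτ : IsStoppingTime 𝓕 fun ω => (τ ω : WithTop (Time T))) (n : ℕ) :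
    IsStoppingTime 𝓕 fun ω => (gridCeil n (τ ω) : WithTop (Time T)) := by
  intro u
  have : {ω | (gridCeil n (τ ω) : WithTop (Time T)) ≤ u} =
      ⋃ j : ℕ, {ω | gridPt n j ≤ u ∧ (τ ω : WithTop (Time T)) ≤ (gridPt n j : Time T)} := by
    ext ω
    simp only [Set.mem_ofPred_eq, Set.mem_iUnion, WithTop.coe_le_coe]
    exact ⟨fun h => ⟨_, h, le_gridCeil n _⟩, fun ⟨j, h1, h2⟩ => (gridCeil_le_of_le h2).trans h1⟩
  rw [this]
  refine MeasurableSet.iUnion fun j => ?_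
  by_cases h : (gridPt n j : Time T) ≤ u
  · simp only [h, true_and]
    exact 𝓕.mono h _ (hτ _)
  · simp [h]

lemma isStoppingTime_stopAt {ρ : Ω → WithTop (Time T)} (hρ : IsStoppingTime 𝓕 ρ) (t : Time T) :
    IsStoppingTime 𝓕 fun ω => (stopAt t (ρ ω) : WithTop (Time T)) := by
  simp_rw [coe_stopAt]
  exact (isStoppingTime_const 𝓕 t).min hρ

/-- Adapted processes with right-continuous paths are progressive. -/
lemma isStronglyProgressive_of_rightCont {X : Time T → Ω → ℝ} (hX : StronglyAdapted 𝓕 X)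
    (hc : ∀ ω t, ContinuousWithinAt (fun s => X s ω) (Set.Ici t) t) :
    IsStronglyProgressive 𝓕 X := by
  intro i
  refine @stronglyMeasurable_of_tendsto (Set.Iic i × Ω) ℝ ℕ
    (MeasurableSpace.prod _ (𝓕 i)) _ _ atTop _ _
    (fun n p => X (min (gridCeil n p.1) i) p.2) _ (fun n => ?_) ?_
  · have h1 : @Measurable (ℕ × Ω) ℝ (MeasurableSpace.prod _ (𝓕 i)) _
        (fun p => X (min (gridPt n p.1) i) p.2) :=
      @measurable_from_prod_countable_right ℕ Ω ℝ _ (𝓕 i) _ _ _ _ fun j =>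
        ((hX (min (gridPt n j) i)).mono (𝓕.mono (min_le_right _ _))).measurable
    have h2 : @Measurable (Set.Iic i × Ω) (ℕ × Ω) (MeasurableSpace.prod _ (𝓕 i))
        (MeasurableSpace.prod _ (𝓕 i)) (fun p => (gridIdx n (p.1 : Time T), p.2)) :=
      (((gridIdx_mono n).measurable.comp measurable_subtype_coe).comp
        (@measurable_fst _ _ _ (𝓕 i))).prodMk (@measurable_snd _ _ _ (𝓕 i))
    exact (h1.comp h2).stronglyMeasurable
  · rw [tendsto_pi_nhds]
    rintro ⟨⟨t, ht⟩, ω⟩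
    refine (hc ω t).tendsto.comp (tendsto_nhdsWithin_iff.mpr ⟨?_, Eventually.of_forall fun n =>
      le_min (le_gridCeil n t) ht⟩)
    simpa [min_eq_left (show t ≤ i from ht)] using (tendsto_gridCeil t).min (tendsto_const_nhds (x := i))

lemma stronglyAdapted_stop {X : Time T → Ω → ℝ} (hX : StronglyAdapted 𝓕 X)
    (hc : ∀ ω, IsCadlagPath fun t => X t ω) {ρ : Ω → WithTop (Time T)} (hρ : IsStoppingTime 𝓕 ρ) :
    StronglyAdapted 𝓕 fun t ω => X (stopAt t (ρ ω)) ω :=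
  IsStronglyProgressive.stronglyAdapted_stoppedProcess
    (isStronglyProgressive_of_rightCont hX fun ω t => (hc ω t).1) hρ

lemma measurable_value {X : Time T → Ω → ℝ} (hX : StronglyAdapted 𝓕 X)
    (hc : ∀ ω, IsCadlagPath fun t => X t ω) {τ : Ω → Time T}
    (hτ : IsStoppingTime 𝓕 fun ω => (τ ω : WithTop (Time T))) :
    Measurable[hτ.measurableSpace] fun ω => X (τ ω) ω := by
  have : (fun ω => X (τ ω) ω) = stoppedValue X fun ω => (τ ω : WithTop (Time T)) := by
    ext ω; simp [stoppedValue]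
  rw [this]
  exact measurable_stoppedValue (isStronglyProgressive_of_rightCont hX fun ω t => (hc ω t).1) hτ

end StoppingTimes

/-! ### Optional sampling for càdlàg martingales. -/

section OptionalSampling

variable {T : ℝ≥0} {Ω : Type*} {mΩ : MeasurableSpace Ω} {𝓕 : Filtration (Time T) mΩ}
  {P : Measure Ω} [IsProbabilityMeasure P]

/-- Optional sampling for càdlàg martingales. -/
lemma value_ae_eq_condExp {N : Time T → Ω → ℝ} (hN : Martingale N 𝓕 P)
    (hc : ∀ ω, IsCadlagPath fun t => N t ω) {τ : Ω → Time T}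
    (hτ : IsStoppingTime 𝓕 fun ω => (τ ω : WithTop (Time T))) :
    Integrable (fun ω => N (τ ω) ω) P ∧
      (fun ω => N (τ ω) ω) =ᵐ[P] P[N ⊤ | hτ.measurableSpace] := by
  have hm : ∀ n, (isStoppingTime_gridCeil hτ n).measurableSpace ≤ mΩ :=
    fun n => (isStoppingTime_gridCeil hτ n).measurableSpace_le
  -- The roundings of `τ` take countably many values, so sampling is elementary for them. Uniform
  -- integrability of conditional expectations of `N ⊤` then allows the passage to `τ`.
  have hval : ∀ n, (fun ω => N (gridCeil n (τ ω)) ω) =ᵐ[P]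
      P[N ⊤ | (isStoppingTime_gridCeil hτ n).measurableSpace] := by
    intro n
    have hle : ∀ ω, (gridCeil n (τ ω) : WithTop (Time T)) ≤ (⊤ : Time T) := fun ω => by simp
    have := hN.stoppedValue_ae_eq_condExp_of_le_const_of_countable_range
      (isStoppingTime_gridCeil hτ n) hle
      ((Set.countable_range fun j : ℕ => ((gridPt n j : Time T) : WithTop (Time T))).mono
        (by rintro _ ⟨ω, rfl⟩; exact ⟨gridIdx n (τ ω), rfl⟩))
    filter_upwards [this] with ω hω
    rw [← hω]; simp [stoppedValue]
  have hui := (hN.integrable ⊤).uniformIntegrable_condExp hm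
  have hlim : ∀ᵐ ω ∂P, Tendsto (fun n =>
      (P[N ⊤ | (isStoppingTime_gridCeil hτ n).measurableSpace]) ω) atTop (𝓝 (N (τ ω) ω)) := by
    filter_upwards [ae_all_iff.mpr hval] with ω hω
    simp_rw [← hω]
    exact tendsto_comp_gridCeil (hc ω _).1
  have hmeas := measurable_value hN.1 hc hτ
  have hLp : MemLp (fun ω => N (τ ω) ω) 1 P := hui.memLp_of_ae_tendsto hlim
  have hconv := tendsto_Lp_finite_of_tendsto_ae le_rfl (by simp) (fun n => hui.1 n) hLp
    hui.unifIntegrable hlim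
  have hint : Integrable (fun ω => N (τ ω) ω) P := memLp_one_iff_integrable.mp hLp
  refine ⟨hint, ae_eq_condExp_of_forall_setIntegral_eq hτ.measurableSpace_le (hN.integrable ⊤)
    (fun s _ _ => hint.integrableOn) (fun s hs _ => ?_) hmeas.stronglyMeasurable.aestronglyMeasurable⟩
  have h1 := tendsto_setIntegral_of_L1' _ hint.aestronglyMeasurable
    (Eventually.of_forall fun n => integrable_condExp) hconv s
  have h2 : ∀ n, ∫ ω in s, (P[N ⊤ | (isStoppingTime_gridCeil hτ n).measurableSpace]) ω ∂P =
      ∫ ω in s, N ⊤ ω ∂P := fun n =>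
    setIntegral_condExp (hm n) (hN.integrable ⊤)
      (hτ.measurableSpace_mono (isStoppingTime_gridCeil hτ n)
        (fun ω => WithTop.coe_le_coe.mpr (le_gridCeil n _)) _ hs)
  simp_rw [h2] at h1
  exact tendsto_nhds_unique h1 tendsto_const_nhds

lemma setIntegral_value {N : Time T → Ω → ℝ} (hN : Martingale N 𝓕 P)
    (hc : ∀ ω, IsCadlagPath fun t => N t ω) {τ : Ω → Time T}
    (hτ : IsStoppingTime 𝓕 fun ω => (τ ω : WithTop (Time T))) {s : Set Ω}
    (hs : MeasurableSet[hτ.measurableSpace] s) :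
    ∫ ω in s, N (τ ω) ω ∂P = ∫ ω in s, N ⊤ ω ∂P := by
  rw [← setIntegral_condExp hτ.measurableSpace_le (hN.integrable ⊤) hs]
  exact integral_congr_ae (ae_restrict_of_ae (value_ae_eq_condExp hN hc hτ).2)

/-- Stopped càdlàg martingales are martingales. -/
lemma martingale_stop {N : Time T → Ω → ℝ} (hN : Martingale N 𝓕 P)
    (hc : ∀ ω, IsCadlagPath fun t => N t ω) {ρ : Ω → WithTop (Time T)} (hρ : IsStoppingTime 𝓕 ρ) :
    Martingale (fun t ω => N (stopAt t (ρ ω)) ω) 𝓕 P := by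
  have had := stronglyAdapted_stop hN.1 hc hρ
  have hint : ∀ t, Integrable (fun ω => N (stopAt t (ρ ω)) ω) P :=
    fun t => (value_ae_eq_condExp hN hc (isStoppingTime_stopAt hρ t)).1
  refine ⟨had, fun s t hst => ?_⟩
  refine (ae_eq_condExp_of_forall_setIntegral_eq (𝓕.le s) (hint t)
    (fun A _ _ => (hint s).integrableOn) (fun A hA _ => ?_) (had s).aestronglyMeasurable).symm
  have hgt : MeasurableSet[𝓕 s] {ω | ↑s < ρ ω} := hρ.measurableSet_gt s
  -- The right-hand side does not depend on `u`. On `s < ρ`, sampling at the stopping time `max s (u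
  -- ∧ ρ)` applies to sets of `𝓕 s`; elsewhere the path is already frozen at `s`.
  have hsplit : ∀ u, s ≤ u → ∫ ω in A, N (stopAt u (ρ ω)) ω ∂P =
      ∫ ω in A ∩ {ω | ↑s < ρ ω}, N ⊤ ω ∂P + ∫ ω in A \ {ω | ↑s < ρ ω}, N (stopAt s (ρ ω)) ω ∂P := by
    intro u hsu
    rw [← integral_inter_add_sdiff (𝓕.le s _ hgt) (hint u).integrableOn]
    congr 1
    · have hτ : IsStoppingTime 𝓕 fun ω => ((max s (stopAt u (ρ ω)) : Time T) : WithTop (Time T)) := by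
        simp_rw [WithTop.coe_max]
        exact (isStoppingTime_const 𝓕 s).max (isStoppingTime_stopAt hρ u)
      rw [← setIntegral_value hN hc hτ]
      · refine setIntegral_congr_fun (𝓕.le s _ (hA.inter hgt)) fun ω hω => ?_
        have : s ≤ stopAt u (ρ ω) := by
          rw [← WithTop.coe_le_coe, coe_stopAt]
          exact le_min (WithTop.coe_le_coe.mpr hsu) (le_of_lt hω.2)
        simp [max_eq_right this]
      · exact hτ.le_measurableSpace_of_const_le
          (fun ω => WithTop.coe_le_coe.mpr (le_max_left _ _)) _ (hA.inter hgt)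
    · refine setIntegral_congr_fun (𝓕.le s _ (hA.diff hgt)) fun ω hω => ?_
      have h1 : ρ ω ≤ s := not_lt.mp hω.2
      have : stopAt u (ρ ω) = stopAt s (ρ ω) := by
        rw [← WithTop.coe_inj, coe_stopAt, coe_stopAt, min_eq_right h1,
          min_eq_right (h1.trans (WithTop.coe_le_coe.mpr hsu))]
      simp [this]
  rw [hsplit s le_rfl, hsplit t hst]

/-- Increments of a càdlàg martingale between stopping times are orthogonal to the past. -/
lemma integral_mul_increment {N : Time T → Ω → ℝ} (hN : Martingale N 𝓕 P)
    (hc : ∀ ω, IsCadlagPath fun t => N t ω) {σ τ : Ω → Time T}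
    (hσ : IsStoppingTime 𝓕 fun ω => (σ ω : WithTop (Time T)))
    (hτ : IsStoppingTime 𝓕 fun ω => (τ ω : WithTop (Time T))) (hστ : ∀ ω, σ ω ≤ τ ω)
    {g : Ω → ℝ} (hg : Measurable[hσ.measurableSpace] g) {C : ℝ} (hgC : ∀ᵐ ω ∂P, |g ω| ≤ C) :
    Integrable (fun ω => g ω * (N (τ ω) ω - N (σ ω) ω)) P ∧
      ∫ ω, g ω * (N (τ ω) ω - N (σ ω) ω) ∂P = 0 := by
  obtain ⟨hi1, he1⟩ := value_ae_eq_condExp hN hc hσ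
  obtain ⟨hi2, he2⟩ := value_ae_eq_condExp hN hc hτ
  have hle : hσ.measurableSpace ≤ hτ.measurableSpace :=
    hσ.measurableSpace_mono hτ fun ω => WithTop.coe_le_coe.mpr (hστ ω)
  have hint : Integrable (fun ω => g ω * (N (τ ω) ω - N (σ ω) ω)) P :=
    (hi2.sub hi1).bdd_mul (hg.mono hσ.measurableSpace_le le_rfl).aestronglyMeasurable hgC
  refine ⟨hint, ?_⟩
  rw [← integral_condExp hσ.measurableSpace_le]
  have h1 : P[fun ω => g ω * (N (τ ω) ω - N (σ ω) ω) | hσ.measurableSpace] =ᵐ[P]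
      g * P[(fun ω => N (τ ω) ω) - (fun ω => N (σ ω) ω) | hσ.measurableSpace] :=
    condExp_mul_of_stronglyMeasurable_left hg.stronglyMeasurable hint (hi2.sub hi1)
  have h2 : P[fun ω => N (τ ω) ω | hσ.measurableSpace] =ᵐ[P] P[N ⊤ | hσ.measurableSpace] :=
    (condExp_congr_ae he2).trans (condExp_condExp_of_le hle hτ.measurableSpace_le)
  have h3 : P[fun ω => N (σ ω) ω | hσ.measurableSpace] =ᵐ[P] P[N ⊤ | hσ.measurableSpace] :=
    (condExp_congr_ae he1).trans (condExp_condExp_of_le le_rfl hσ.measurableSpace_le)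
  have h4 := condExp_sub hi2 hi1 hσ.measurableSpace
  have h5 : P[fun ω => g ω * (N (τ ω) ω - N (σ ω) ω) | hσ.measurableSpace] =ᵐ[P] 0 := by
    filter_upwards [h1, h2, h3, h4] with ω a1 a2 a3 a4
    rw [a1, Pi.mul_apply, a4, Pi.sub_apply, a2, a3, sub_self, mul_zero, Pi.zero_apply]
  rw [integral_congr_ae h5]; simp

end OptionalSampling

/-! ### Null sets, tail probabilities and measurable variation. -/

section General

variable {T : ℝ≥0} {Ω : Type*} {mΩ : MeasurableSpace Ω} {𝓕 : Filtration (Time T) mΩ}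
  {P : Measure Ω} [IsProbabilityMeasure P]

omit [IsProbabilityMeasure P] in
-- Completeness puts the null complement into the σ-algebra at time `0`. Exceptional paths can
-- therefore be set to zero without losing adaptedness.
lemma UsualConditions.measurableSet_of_ae (h𝓕 : UsualConditions 𝓕 P) {p : Ω → Prop}
    (hp : ∀ᵐ ω ∂P, p ω) (t : Time T) : MeasurableSet[𝓕 t] {ω | p ω} := by
  refine 𝓕.mono bot_le _ (MeasurableSet.of_compl ?_)
  exact h𝓕.complete _ (ae_iff.mp hp)

lemma tendsto_measureReal_of_ae_eventually_notMem {E : ℕ → Set Ω} (hE : ∀ k, MeasurableSet (E k))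
    (h : ∀ᵐ ω ∂P, ∀ᶠ k in atTop, ω ∉ E k) : Tendsto (fun k => P.real (E k)) atTop (𝓝 0) := by
  have := tendsto_measure_of_ae_tendsto_indicator_of_isFiniteMeasure (μ := P) (A := ∅) atTop
    MeasurableSet.empty hE (by
      filter_upwards [h] with ω hω
      filter_upwards [hω] with k hk
      simpa using hk)
  rw [measure_empty] at this
  simpa [Measure.real, Function.comp_def] using (ENNReal.tendsto_toReal ENNReal.zero_ne_top).comp this

/-- The stopping times of a localizing sequence are eventually infinite, in probability. -/
lemma tendsto_measureReal_ne_top {τ : ℕ → Ω → WithTop (Time T)}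
    (hτ : IsPreLocalizingSequence 𝓕 τ P) :
    Tendsto (fun k => P.real {ω | τ k ω ≠ ⊤}) atTop (𝓝 0) := by
  refine tendsto_measureReal_of_ae_eventually_notMem (fun k => ?_) ?_
  · have : {ω | τ k ω ≠ ⊤} = {ω | τ k ω ≤ (⊤ : Time T)} := by
      ext ω
      cases h : τ k ω with
      | top => simp [h]
      | coe t => simp [h]
    rw [this]
    exact 𝓕.le _ _ (hτ.isStoppingTime k ⊤)
  · filter_upwards [hτ.tendsto_top] with ω hω
    filter_upwards [(WithTop.tendsto_nhds_top_iff _).mp hω ⊤] with k hk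
    cases h : τ k ω with
    | top => simp
    | coe t => rw [h, WithTop.coe_lt_coe] at hk; exact absurd hk not_top_lt

/-- A tail bound for an almost surely finite random variable. -/
lemma tendsto_measureReal_tail {X : Ω → ℝ≥0∞} (hX : Measurable X) (hfin : ∀ᵐ ω ∂P, X ω ≠ ∞) :
    Tendsto (fun k : ℕ => P.real {ω | (k : ℝ≥0∞) ≤ X ω}) atTop (𝓝 0) := by
  refine tendsto_measureReal_of_ae_eventually_notMem
    (fun k => measurableSet_le measurable_const hX) ?_
  filter_upwards [hfin] with ω hω
  obtain ⟨n, hn⟩ := ENNReal.exists_nat_gt hω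
  filter_upwards [eventually_ge_atTop n] with k hk
  exact not_le.mpr <| hn.trans_le (by exact_mod_cast hk)

omit [IsProbabilityMeasure P] in
lemma martingale_indicator {N : Time T → Ω → ℝ} (hN : Martingale N 𝓕 P) {B : Set Ω}
    (hB : MeasurableSet[𝓕 ⊥] B) : Martingale (fun t => B.indicator (N t)) 𝓕 P := by
  refine ⟨fun t => (hN.1 t).indicator (𝓕.mono bot_le _ hB), fun s t hst => ?_⟩
  refine (condExp_indicator (hN.integrable t) (𝓕.mono bot_le _ hB)).trans ?_
  filter_upwards [hN.2 s t hst] with ω hω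
  by_cases h : ω ∈ B <;> simp [h, hω]

/-- The total variation over the grid points. -/
noncomputable def gridVariation (A : Time T → Ω → ℝ) (ω : Ω) : ℝ≥0∞ :=
  ⨆ m : ℕ, ∑ j ∈ Finset.range (2 ^ m), edist (A (gridPt m j) ω) (A (gridPt m (j + 1)) ω)

lemma gridSet_eq_image (m : ℕ) : gridSet T m = gridPt m '' Set.Iic (2 ^ m) := by
  ext t
  constructor
  · rintro ⟨j, rfl⟩
    rcases le_total j (2 ^ m) with h | h
    · exact ⟨j, h, rfl⟩
    · exact ⟨2 ^ m, Set.mem_Iic.mpr le_rfl, by rw [gridPt_eq_top le_rfl, gridPt_eq_top h]⟩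
  · rintro ⟨j, -, rfl⟩
    exact gridPt_mem m j

/-- With `gridVariation_le`, this identifies the variation of a right-continuous path with a
countable supremum, which is measurable in `ω`. -/
lemma eVariationOn_le_gridVariation {A : Time T → Ω → ℝ} {ω : Ω}
    (hA : ∀ t, ContinuousWithinAt (fun s => A s ω) (Set.Ici t) t) :
    eVariationOn (fun t => A t ω) Set.univ ≤ gridVariation A ω := by
  refine (eVariationOn_univ_le hA).trans (eVariationOn_gridUnion_le fun m => ?_)
  rw [gridSet_eq_image, eVariationOn.image_range_of_monotone _ (gridPt_mono m)]
  exact le_iSup (fun m : ℕ =>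
    ∑ j ∈ Finset.range (2 ^ m), edist (A (gridPt m j) ω) (A (gridPt m (j + 1)) ω)) m

lemma gridVariation_le (A : Time T → Ω → ℝ) (ω : Ω) :
    gridVariation A ω ≤ eVariationOn (fun t => A t ω) Set.univ := by
  refine iSup_le fun m => ?_
  rw [← eVariationOn.image_range_of_monotone (fun t => A t ω) (gridPt_mono m)]
  exact eVariationOn.mono _ (Set.subset_univ _)

lemma measurable_gridVariation {A : Time T → Ω → ℝ} (hA : ∀ t, Measurable (A t)) :
    Measurable (gridVariation A) :=
  Measurable.iSup fun _ => Finset.measurable_sum _ fun _ _ => (hA _).edist (hA _)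

end General

/-! ### The estimate for elementary integrals of a bounded semimartingale. -/

section StoppedIntegral

variable {T : ℝ≥0} {Ω : Type*} {mΩ : MeasurableSpace Ω} {𝓕 : Filtration (Time T) mΩ}
  {P : Measure Ω} [IsProbabilityMeasure P]

lemma exists_threshold {p : ℕ → Prop} (hp : ∀ j, p (j + 1) → p j) (n : ℕ) :
    ∃ J ≤ n, ∀ j < n, p j ↔ j < J := by
  classical
  have hanti : ∀ i j, i ≤ j → p j → p i := by
    intro i j hij
    induction hij with
    | refl => exact id
    | step _ ih => exact fun h => ih (hp _ h)
  by_cases h : ∃ j, ¬ p j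
  · refine ⟨min n (Nat.find h), min_le_left _ _, fun j hj => ?_⟩
    rw [lt_min_iff]
    constructor
    · intro hpj
      refine ⟨hj, ?_⟩
      by_contra hlt
      exact Nat.find_spec h (hanti _ _ (not_lt.mp hlt) hpj)
    · rintro ⟨-, h2⟩
      exact not_not.mp (Nat.find_min h h2)
  · push Not at h
    exact ⟨n, le_rfl, fun j hj => by simp [h j, hj]⟩

/-- Stopping the elementary integral at a grid time. -/
lemma exists_sum_stop {p : ℕ → Prop} [DecidablePred p] (hp : ∀ j, p (j + 1) → p j) (n : ℕ)
    {σ : ℕ → Time T} (hσ : Monotone σ) (g : ℕ → ℝ) (x : Time T → ℝ) :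
    ∃ t, ∑ j ∈ Finset.range n, (if p j then 1 else 0) * g j * (x (σ (j + 1)) - x (σ j)) =
      ∑ j ∈ Finset.range n, g j * (x (min (σ (j + 1)) t) - x (min (σ j) t)) := by
  -- The positions vanish from some index `J` on, so `t = σ J` works. It depends on the path, which
  -- is why losses must be bounded at all times simultaneously.
  obtain ⟨J, -, hJ⟩ := exists_threshold hp n
  refine ⟨σ J, Finset.sum_congr rfl fun j hj => ?_⟩
  rw [Finset.mem_range] at hj
  by_cases h : j < J
  · rw [if_pos ((hJ j hj).mpr h), min_eq_left (hσ h), min_eq_left (hσ h.le), one_mul]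
  · have h' : J ≤ j := not_lt.mp h
    rw [if_neg (mt (hJ j hj).mp h), min_eq_right (hσ h'), min_eq_right (hσ (h'.trans (Nat.le_succ j)))]
    simp

/-- Because `v` starts with `|s 0 - m 0|`, it dominates `|s j - m j|`. Steps before `v` reaches `a`
contribute less than `a`. The crossing step is at most `K + |m (j + 1)| + v j`, hence the constant
`2 * a + K`; the last sum is `|m|` at the crossing. -/
lemma sum_stopped_variation_le {s m v : ℕ → ℝ} {a K : ℝ} (ha : 0 ≤ a) (hs : ∀ j, |s j| ≤ K)
    (hv0 : v 0 = |s 0 - m 0|)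
    (hv : ∀ j, v (j + 1) = v j + |(s (j + 1) - m (j + 1)) - (s j - m j)|) (n : ℕ) :
    ∑ j ∈ Finset.range n, (if v j < a then 1 else 0) * |(s (j + 1) - m (j + 1)) - (s j - m j)| ≤
      (if v n < a then v n else 2 * a + K) +
        ∑ j ∈ Finset.range n, ((if v j < a then 1 else 0) - (if v (j + 1) < a then 1 else 0)) *
          |m (j + 1)| := by
  have hK : 0 ≤ K := (abs_nonneg _).trans (hs 0)
  have hA : ∀ j, |s j - m j| ≤ v j := by
    intro j
    induction j with
    | zero => exact hv0.ge
    | succ j ih =>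
      rw [hv]
      have := abs_add_le (s j - m j) ((s (j + 1) - m (j + 1)) - (s j - m j))
      rw [add_sub_cancel] at this
      linarith
  induction n with
  | zero =>
    simp only [Finset.range_zero, Finset.sum_empty, add_zero]
    have h0 := (abs_nonneg _).trans (hA 0)
    split_ifs with h
    · exact h0
    · linarith [not_lt.mp h]
  | succ n ih =>
    rw [Finset.sum_range_succ, Finset.sum_range_succ]
    have hvn := hv n
    have h0 := (abs_nonneg _).trans (hA n)
    by_cases h1 : v n < a
    · by_cases h2 : v (n + 1) < a
      · simp only [h1, h2, if_true] at ih ⊢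
        linarith
      · simp only [h1, h2, if_true, if_false] at ih ⊢
        have e1 : |(s (n + 1) - m (n + 1)) - (s n - m n)| ≤ K + |m (n + 1)| + v n := by
          have := abs_sub (s (n + 1) - m (n + 1)) (s n - m n)
          have h3 := abs_sub (s (n + 1)) (m (n + 1))
          linarith [hA n, hs (n + 1)]
        linarith
    · have h2 : ¬ v (n + 1) < a := by
        have := abs_nonneg ((s (n + 1) - m (n + 1)) - (s n - m n))
        intro h
        exact h1 (by linarith)
      simp only [h1, h2, if_false] at ih ⊢
      linarith

/-- The expected size of a martingale at the time of stopping. -/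
lemma integral_sum_stopped_le {N : Time T → Ω → ℝ}
    (hN : Martingale N 𝓕 P) (hNc : ∀ ω, IsCadlagPath fun t => N t ω) (n : ℕ)
    {σ : ℕ → Ω → Time T} (hσ : ∀ j, IsStoppingTime 𝓕 fun ω => (σ j ω : WithTop (Time T)))
    (hσm : ∀ ω, Monotone fun j => σ j ω) {v : ℕ → Ω → ℝ} {a : ℝ}
    (hv : ∀ j, Measurable[(hσ j).measurableSpace] (v j)) (hvm : ∀ j ω, v j ω ≤ v (j + 1) ω) :
    Integrable (fun ω => ∑ j ∈ Finset.range n,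
      ((if v j ω < a then 1 else 0) - (if v (j + 1) ω < a then 1 else 0)) * |N (σ (j + 1) ω) ω|) P ∧
    ∫ ω, ∑ j ∈ Finset.range n, ((if v j ω < a then 1 else 0) - (if v (j + 1) ω < a then 1 else 0)) *
      |N (σ (j + 1) ω) ω| ∂P ≤ ∫ ω, |N ⊤ ω| ∂P := by
  set E : ℕ → Set Ω := fun j => {ω | v j ω < a ∧ ¬ v (j + 1) ω < a}
  have hle : ∀ j, (hσ j).measurableSpace ≤ (hσ (j + 1)).measurableSpace := fun j =>
    (hσ j).measurableSpace_mono (hσ (j + 1)) fun ω => WithTop.coe_le_coe.mpr (hσm ω (Nat.le_succ j))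
  have hE : ∀ j, MeasurableSet[(hσ (j + 1)).measurableSpace] (E j) := fun j =>
    (measurableSet_lt ((hv j).mono (hle j) le_rfl) measurable_const).inter
      (measurableSet_lt (hv (j + 1)) measurable_const).compl
  have hE' : ∀ j, MeasurableSet (E j) := fun j => (hσ (j + 1)).measurableSpace_le _ (hE j)
  have hind : ∀ (j : ℕ) (f : Ω → ℝ),
      (fun ω => ((if v j ω < a then 1 else 0) - (if v (j + 1) ω < a then 1 else 0)) * f ω) =
        (E j).indicator f := by
    intro j f
    ext ω
    have := hvm j ω
    by_cases h1 : v j ω < a <;> by_cases h2 : v (j + 1) ω < a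
    · simp [h1, h2, E]
    · rw [Set.indicator_of_mem (show ω ∈ E j from ⟨h1, h2⟩)]
      simp [h1, h2]
    · exact absurd (this.trans_lt h2) h1
    · simp [h1, h2, E]
  have hopt := fun j => value_ae_eq_condExp hN hNc (hσ (j + 1))
  have hint : ∀ j, Integrable (fun ω => ((if v j ω < a then 1 else 0) -
      (if v (j + 1) ω < a then 1 else 0)) * |N (σ (j + 1) ω) ω|) P := by
    intro j
    rw [hind]
    exact (hopt j).1.abs.indicator (hE' j)
  have hint' : ∀ j, Integrable (fun ω => ((if v j ω < a then 1 else 0) -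
      (if v (j + 1) ω < a then 1 else 0)) * |N ⊤ ω|) P := by
    intro j
    rw [hind]
    exact (hN.integrable ⊤).abs.indicator (hE' j)
  refine ⟨integrable_finsetSum _ fun j _ => hint j, ?_⟩
  rw [integral_finsetSum _ fun j _ => hint j]
  calc ∑ j ∈ Finset.range n, ∫ ω, ((if v j ω < a then 1 else 0) -
        (if v (j + 1) ω < a then 1 else 0)) * |N (σ (j + 1) ω) ω| ∂P
      ≤ ∑ j ∈ Finset.range n, ∫ ω, ((if v j ω < a then 1 else 0) -
        (if v (j + 1) ω < a then 1 else 0)) * |N ⊤ ω| ∂P := by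
        refine Finset.sum_le_sum fun j _ => ?_
        rw [hind, hind, integral_indicator (hE' j), integral_indicator (hE' j)]
        -- Crossing at step `j + 1` is known at that time, so conditional Jensen replaces `|N|`
        -- there by `|N ⊤|`. The crossing events are disjoint and their indicators telescope.
        refine le_trans (le_of_eq ?_) (setIntegral_abs_condExp_le (hE j) (N ⊤))
        refine integral_congr_ae (ae_restrict_of_ae ?_)
        filter_upwards [(hopt j).2] with ω hω
        rw [hω]
    _ = ∫ ω, ((if v 0 ω < a then 1 else 0) - (if v n ω < a then 1 else 0)) * |N ⊤ ω| ∂P := by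
        rw [← integral_finsetSum _ fun j _ => hint' j]
        congr 1
        ext ω
        rw [← Finset.sum_mul, Finset.sum_range_sub' fun j => if v j ω < a then (1 : ℝ) else 0]
    _ ≤ ∫ ω, |N ⊤ ω| ∂P := by
        have hvn : ∀ ω, v 0 ω ≤ v n ω := fun ω =>
          monotone_nat_of_le_succ (f := fun j => v j ω) (fun j => hvm j ω) (Nat.zero_le n)
        refine integral_mono_of_nonneg (ae_of_all _ fun ω => mul_nonneg ?_ (abs_nonneg _))
          (hN.integrable ⊤).abs (ae_of_all _ fun ω => mul_le_of_le_one_left (abs_nonneg _) ?_)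
        · have := hvn ω
          split_ifs <;> first | (norm_num; done) | (exfalso; linarith)
        · split_ifs <;> norm_num

/-- The main estimate for elementary integrals with respect to a bounded semimartingale whose
martingale part is a true martingale. -/
lemma measureReal_integral_ge_le {S N : Time T → Ω → ℝ} {K δ h a η : ℝ} (hS : StronglyAdapted 𝓕 S)
    (hSc : ∀ ω, IsCadlagPath fun t => S t ω) (hSK : ∀ ω t, |S t ω| ≤ K)
    (hN : Martingale N 𝓕 P) (hNc : ∀ ω, IsCadlagPath fun t => N t ω) (n : ℕ)
    {σ : ℕ → Ω → Time T} (hσ : ∀ j, IsStoppingTime 𝓕 fun ω => (σ j ω : WithTop (Time T)))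
    (hσm : ∀ ω, Monotone fun j => σ j ω) (hσ0 : ∀ ω, σ 0 ω = ⊥) {g : ℕ → Ω → ℝ}
    (hg : ∀ j, Measurable[(hσ j).measurableSpace] (g j)) (hh : 0 ≤ h) (hgh : ∀ j ω, |g j ω| ≤ h)
    (hδ0 : 0 ≤ δ)
    (hδ : ∀ᵐ ω ∂P, ∀ t, -δ ≤ ∑ j ∈ Finset.range n,
      g j ω * (S (min (σ (j + 1) ω) t) ω - S (min (σ j ω) t) ω))
    (ha : 0 ≤ a) (hη : h * a < η) :
    P.real {ω | η ≤ ∑ j ∈ Finset.range n, g j ω * (S (σ (j + 1) ω) ω - S (σ j ω) ω)} ≤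
      P.real {ω | ENNReal.ofReal a ≤ ENNReal.ofReal |S ⊥ ω - N ⊥ ω| +
        eVariationOn (fun t => S t ω - N t ω) Set.univ} +
      2 * (δ + h * (2 * a + K + ∫ ω, |N ⊤ ω| ∂P)) / (η - h * a) := by
  set v : ℕ → Ω → ℝ := fun j ω => |S (σ 0 ω) ω - N (σ 0 ω) ω| + ∑ i ∈ Finset.range j,
    |(S (σ (i + 1) ω) ω - N (σ (i + 1) ω) ω) - (S (σ i ω) ω - N (σ i ω) ω)| with hvdef
  have hle : ∀ i j, i ≤ j → (hσ i).measurableSpace ≤ (hσ j).measurableSpace := fun i j hij =>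
    (hσ i).measurableSpace_mono (hσ j) fun ω => WithTop.coe_le_coe.mpr (hσm ω hij)
  have hAm : ∀ i, Measurable[(hσ i).measurableSpace] fun ω => S (σ i ω) ω - N (σ i ω) ω := fun i =>
    (measurable_value hS hSc (hσ i)).sub (measurable_value hN.1 hNc (hσ i))
  have habs : Measurable (fun x : ℝ => |x|) := measurable_abs
  have hvmeas : ∀ j, Measurable[(hσ j).measurableSpace] (v j) := by
    intro j
    refine Measurable.add (habs.comp ((hAm 0).mono (hle 0 j (Nat.zero_le j)) le_rfl))
      (Finset.measurable_sum _ fun i hi => ?_)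
    have hi := Finset.mem_range.mp hi
    exact habs.comp (((hAm (i + 1)).mono (hle _ j hi) le_rfl).sub
      ((hAm i).mono (hle i j hi.le) le_rfl))
  have hvs : ∀ j ω, v (j + 1) ω = v j ω +
      |(S (σ (j + 1) ω) ω - N (σ (j + 1) ω) ω) - (S (σ j ω) ω - N (σ j ω) ω)| := by
    intro j ω
    simp only [hvdef, Finset.sum_range_succ]
    ring
  have hvm : ∀ j ω, v j ω ≤ v (j + 1) ω := fun j ω => by
    rw [hvs]; exact le_add_of_nonneg_right (abs_nonneg _)
  set χ : ℕ → Ω → ℝ := fun j ω => if v j ω < a then 1 else 0 with hχdef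
  have hχ01 : ∀ j ω, 0 ≤ χ j ω ∧ χ j ω ≤ 1 := fun j ω => by
    simp only [hχdef]; split_ifs <;> norm_num
  set I : Ω → ℝ := fun ω => ∑ j ∈ Finset.range n,
    χ j ω * g j ω * (N (σ (j + 1) ω) ω - N (σ j ω) ω) with hIdef
  set W : Ω → ℝ := fun ω => ∑ j ∈ Finset.range n,
    (χ j ω - χ (j + 1) ω) * |N (σ (j + 1) ω) ω| with hWdef
  have hWint : Integrable W P := (integral_sum_stopped_le hN hNc n hσ hσm hvmeas hvm).1
  have hWle : ∫ ω, W ω ∂P ≤ ∫ ω, |N ⊤ ω| ∂P :=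
    (integral_sum_stopped_le hN hNc n hσ hσm hvmeas hvm).2
  have hinc : ∀ j, Integrable (fun ω => χ j ω * g j ω * (N (σ (j + 1) ω) ω - N (σ j ω) ω)) P ∧
      ∫ ω, χ j ω * g j ω * (N (σ (j + 1) ω) ω - N (σ j ω) ω) ∂P = 0 := by
    intro j
    refine integral_mul_increment hN hNc (hσ j) (hσ (j + 1)) (fun ω => hσm ω (Nat.le_succ j))
      (g := fun ω => χ j ω * g j ω) (C := h) ?_ (ae_of_all _ fun ω => ?_)
    · refine Measurable.mul ?_ (hg j)
      exact Measurable.ite (measurableSet_lt (hvmeas j) measurable_const) measurable_const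
        measurable_const
    · rw [abs_mul, abs_of_nonneg (hχ01 j ω).1]
      exact (mul_le_of_le_one_left (abs_nonneg _) (hχ01 j ω).2).trans (hgh j ω)
  have hIint : Integrable I P := integrable_finsetSum _ fun j _ => (hinc j).1
  have hI0 : ∫ ω, I ω ∂P = 0 := by
    rw [hIdef, integral_finsetSum _ fun j _ => (hinc j).1]
    exact Finset.sum_eq_zero fun j _ => (hinc j).2
  have hK : ∀ ω, 0 ≤ K := fun ω => (abs_nonneg _).trans (hSK ω ⊥)
  have hvar : ∀ ω, ∑ j ∈ Finset.range n, χ j ω *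
      |(S (σ (j + 1) ω) ω - N (σ (j + 1) ω) ω) - (S (σ j ω) ω - N (σ j ω) ω)| ≤
      2 * a + K + W ω := by
    intro ω
    refine (sum_stopped_variation_le (s := fun j => S (σ j ω) ω) (m := fun j => N (σ j ω) ω)
      (v := fun j => v j ω) ha (fun j => hSK ω _) (by simp [hvdef]) (fun j => hvs j ω) n).trans ?_
    have : (if v n ω < a then v n ω else 2 * a + K) ≤ 2 * a + K := by
      split_ifs with h1
      · linarith [hK ω]
      · exact le_rfl
    simp only [hWdef, hχdef]
    linarith
  have hdecomp : ∀ ω, ∀ c : ℕ → ℝ, ∑ j ∈ Finset.range n, c j * (S (σ (j + 1) ω) ω - S (σ j ω) ω) =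
      ∑ j ∈ Finset.range n, c j * (N (σ (j + 1) ω) ω - N (σ j ω) ω) +
      ∑ j ∈ Finset.range n, c j *
        ((S (σ (j + 1) ω) ω - N (σ (j + 1) ω) ω) - (S (σ j ω) ω - N (σ j ω) ω)) := by
    intro ω c
    rw [← Finset.sum_add_distrib]
    exact Finset.sum_congr rfl fun j _ => by ring
  have hbound : ∀ ω, ∀ c : ℕ → ℝ, (∀ j, 0 ≤ c j) → |∑ j ∈ Finset.range n, c j * g j ω *
      ((S (σ (j + 1) ω) ω - N (σ (j + 1) ω) ω) - (S (σ j ω) ω - N (σ j ω) ω))| ≤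
      h * ∑ j ∈ Finset.range n, c j *
        |(S (σ (j + 1) ω) ω - N (σ (j + 1) ω) ω) - (S (σ j ω) ω - N (σ j ω) ω)| := by
    intro ω c hc
    refine (Finset.abs_sum_le_sum_abs _ _).trans ?_
    rw [Finset.mul_sum]
    refine Finset.sum_le_sum fun j _ => ?_
    rw [abs_mul, abs_mul, abs_of_nonneg (hc j)]
    have := mul_le_mul_of_nonneg_left (hgh j ω) (hc j)
    nlinarith [abs_nonneg ((S (σ (j + 1) ω) ω - N (σ (j + 1) ω) ω) - (S (σ j ω) ω - N (σ j ω) ω))]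
  -- The truncated gains from `S` are its gains at some earlier time, hence at least `-δ`; the part
  -- due to `S - N` is at most `h` times the counted variation.
  have hIlow : ∀ᵐ ω ∂P, -(δ + h * (2 * a + K + W ω)) ≤ I ω := by
    filter_upwards [hδ] with ω hω
    obtain ⟨t, ht⟩ := exists_sum_stop (p := fun j => v j ω < a)
      (fun j h1 => (hvm j ω).trans_lt h1) n (hσm ω) (fun j => g j ω) (fun t => S t ω)
    have h1 := hω t
    rw [← ht, hdecomp ω fun j => (if v j ω < a then 1 else 0) * g j ω] at h1
    have h2 := hbound ω (fun j => χ j ω) fun j => (hχ01 j ω).1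
    have h3 := mul_le_mul_of_nonneg_left (hvar ω) hh
    have h4 := (abs_le.mp (h2.trans h3)).2
    have h5 : -δ ≤ I ω + ∑ j ∈ Finset.range n, χ j ω * g j ω *
      ((S (σ (j + 1) ω) ω - N (σ (j + 1) ω) ω) - (S (σ j ω) ω - N (σ j ω) ω)) := h1
    linarith
  have hWnn : ∀ ω, 0 ≤ W ω := by
    intro ω
    refine Finset.sum_nonneg fun j _ => mul_nonneg ?_ (abs_nonneg _)
    simp only [hχdef]
    have := hvm j ω
    split_ifs <;> first | (norm_num; done) | (exfalso; linarith)
  have hIabs : ∫ ω, |I ω| ∂P ≤ 2 * (δ + h * (2 * a + K + ∫ ω, |N ⊤ ω| ∂P)) := by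
    have hi3 : Integrable (fun ω => 2 * h * W ω) P := hWint.const_mul _
    have hi4 : Integrable (fun ω => 2 * (δ + h * (2 * a + K)) + 2 * h * W ω) P :=
      (integrable_const _).add hi3
    have hi2 : Integrable (fun ω => 2 * (δ + h * (2 * a + K + W ω))) P :=
      ((integrable_const δ).add (((integrable_const _).add hWint).const_mul h)).const_mul 2
    -- From `I ≥ -c` with `c ≥ 0` follows `|I| ≤ I + 2c`, and `I` has mean zero.
    calc ∫ ω, |I ω| ∂P ≤ ∫ ω, (I ω + 2 * (δ + h * (2 * a + K + W ω))) ∂P := by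
          refine integral_mono_ae hIint.abs (hIint.add hi2) ?_
          filter_upwards [hIlow] with ω hω
          have h1 : 0 ≤ δ + h * (2 * a + K + W ω) := by
            have := hWnn ω; have := hK ω; positivity
          exact abs_le.mpr ⟨by linarith, by linarith⟩
      _ = 2 * (δ + h * (2 * a + K + ∫ ω, W ω ∂P)) := by
          have : (fun ω => I ω + 2 * (δ + h * (2 * a + K + W ω))) =
              fun ω => I ω + (2 * (δ + h * (2 * a + K)) + 2 * h * W ω) := by
            ext ω; ring
          rw [this, integral_add hIint hi4, hI0, integral_add (integrable_const _) hi3,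
            show ∫ ω, 2 * h * W ω ∂P = 2 * h * ∫ ω, W ω ∂P from integral_const_mul _ _]
          simp only [integral_const, probReal_univ, one_smul]
          ring
      _ ≤ _ := by gcongr
  have hpos : 0 < η - h * a := by linarith
  have hmarkov : P.real {ω | η - h * a ≤ |I ω|} ≤
      2 * (δ + h * (2 * a + K + ∫ ω, |N ⊤ ω| ∂P)) / (η - h * a) := by
    rw [le_div_iff₀ hpos, mul_comm]
    exact (mul_meas_ge_le_integral_of_nonneg (ae_of_all _ fun ω => abs_nonneg _) hIint.abs _).trans
      hIabs
  refine (measureReal_mono (?_ : _ ⊆ _ ∪ {ω | η - h * a ≤ |I ω|})).trans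
    ((measureReal_union_le _ _).trans (add_le_add le_rfl hmarkov))
  intro ω hω
  -- If `v n < a`, no position was dropped and the full gain exceeds `I` by at most `h * a`.
  -- Otherwise the variation of `S - N`, with its initial size, has reached `a`.
  by_cases hva : v n ω < a
  · right
    have hvj : ∀ j, j ≤ n → v j ω < a := fun j hj =>
      (monotone_nat_of_le_succ (f := fun j => v j ω) (fun j => hvm j ω) hj).trans_lt hva
    have hI : I ω = ∑ j ∈ Finset.range n, g j ω * (N (σ (j + 1) ω) ω - N (σ j ω) ω) := by
      refine Finset.sum_congr rfl fun j hj => ?_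
      simp [hχdef, hvj j (Finset.mem_range.mp hj).le]
    have h1 : η ≤ ∑ j ∈ Finset.range n, g j ω * (S (σ (j + 1) ω) ω - S (σ j ω) ω) := hω
    rw [hdecomp ω fun j => g j ω, ← hI] at h1
    have h2 := hbound ω (fun _ => 1) fun _ => zero_le_one
    simp only [one_mul] at h2
    have h3 : ∑ j ∈ Finset.range n,
        |(S (σ (j + 1) ω) ω - N (σ (j + 1) ω) ω) - (S (σ j ω) ω - N (σ j ω) ω)| ≤ v n ω :=
      le_add_of_nonneg_left (abs_nonneg _)
    have h4 := mul_le_mul_of_nonneg_left (h3.trans hva.le) hh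
    have h5 := (abs_le.mp (h2.trans h4)).2
    exact (show η - h * a ≤ I ω by linarith).trans (le_abs_self _)
  · left
    show ENNReal.ofReal a ≤ _
    refine (ENNReal.ofReal_le_ofReal (not_lt.mp hva)).trans ?_
    rw [hvdef, ENNReal.ofReal_add (abs_nonneg _) (Finset.sum_nonneg fun _ _ => abs_nonneg _), hσ0]
    refine add_le_add le_rfl ?_
    rw [ENNReal.ofReal_sum_of_nonneg fun _ _ => abs_nonneg _]
    refine le_trans (le_of_eq ?_) (eVariationOn.sum_le (n := n)
      (f := fun t => S t ω - N t ω) (hσm ω) fun _ => Set.mem_univ _)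
    refine Finset.sum_congr rfl fun j _ => ?_
    rw [edist_dist, Real.dist_eq]

end StoppedIntegral

/-! ### Pathwise bounds for simple integrands. -/

section SimpleIntegrandLemmas

variable {T : ℝ≥0} {Ω : Type*} {mΩ : MeasurableSpace Ω} {𝓕 : Filtration (Time T) mΩ}
  {P : Measure Ω}

lemma ae_abs_le_of_supNorm_le {G : Time T → Ω → ℝ} {c : ℝ} (hc : 0 ≤ c)
    (h : supNorm P G ≤ ENNReal.ofReal c) (t : Time T) : ∀ᵐ ω ∂P, |G t ω| ≤ c := by
  have h1 : eLpNormEssSup (G t) P ≤ ENNReal.ofReal c := by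
    rw [← eLpNorm_exponent_top]
    exact (le_iSup (fun t => eLpNorm (G t) ∞ P) t).trans h
  filter_upwards [ae_le_eLpNormEssSup (f := G t) (μ := P)] with ω hω
  have := hω.trans h1
  rwa [← ofReal_norm, ENNReal.ofReal_le_ofReal_iff hc, Real.norm_eq_abs] at this

lemma supNorm_le_of_ae {G : Time T → Ω → ℝ} {c : ℝ} (h : ∀ t, ∀ᵐ ω ∂P, |G t ω| ≤ c) :
    supNorm P G ≤ ENNReal.ofReal c := by
  refine iSup_le fun t => ?_
  rw [eLpNorm_exponent_top]
  exact eLpNormEssSup_le_of_ae_bound (by simpa using h t)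

namespace SimpleIntegrand

/-- The times of a simple integrand, extended to all indices. -/
def time (H : SimpleIntegrand 𝓕 P) (j : ℕ) (ω : Ω) : Time T :=
  H.τ ⟨min j H.n, Nat.lt_succ_of_le (min_le_right _ _)⟩ ω

/-- The coefficients of a simple integrand, extended to all indices. -/
noncomputable def coef (H : SimpleIntegrand 𝓕 P) (j : ℕ) : Ω → ℝ :=
  if h : j < H.n then H.f ⟨j, h⟩ else fun _ => 0

lemma isStoppingTime_time (H : SimpleIntegrand 𝓕 P) (j : ℕ) :
    IsStoppingTime 𝓕 fun ω => (H.time j ω : WithTop (Time T)) := H.isStoppingTime _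

lemma time_mono (H : SimpleIntegrand 𝓕 P) (ω : Ω) : Monotone fun j => H.time j ω := by
  intro i j hij
  exact H.mono ω (Fin.mk_le_mk.mpr (min_le_min_right _ hij))

lemma time_zero (H : SimpleIntegrand 𝓕 P) (ω : Ω) : H.time 0 ω = ⊥ := by
  rw [← H.τ_zero ω, time]
  congr 1

lemma time_castSucc (H : SimpleIntegrand 𝓕 P) (j : Fin H.n) (ω : Ω) :
    H.time j ω = H.τ j.castSucc ω := by
  rw [time]
  congr 1
  ext; simp [j.2.le]

lemma time_succ (H : SimpleIntegrand 𝓕 P) (j : Fin H.n) (ω : Ω) :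
    H.time (j + 1) ω = H.τ j.succ ω := by
  rw [time]
  congr 1
  ext; simp [Nat.succ_le_of_lt j.2]

lemma coef_coe (H : SimpleIntegrand 𝓕 P) (j : Fin H.n) : H.coef j = H.f j := by
  simp [coef]

lemma measurable_coef (H : SimpleIntegrand 𝓕 P) (j : ℕ) :
    Measurable[(H.isStoppingTime_time j).measurableSpace] (H.coef j) := by
  by_cases h : j < H.n
  · have e : (⟨min j H.n, Nat.lt_succ_of_le (min_le_right _ _)⟩ : Fin (H.n + 1)) =
        Fin.castSucc ⟨j, h⟩ := by ext; simp [h.le]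
    show Measurable[(H.isStoppingTime ⟨min j H.n, _⟩).measurableSpace] (H.coef j)
    rw [coef, dif_pos h, e]
    exact H.measurable_f ⟨j, h⟩
  · rw [coef, dif_neg h]
    exact measurable_const

lemma integral_eq (H : SimpleIntegrand 𝓕 P) (S : Time T → Ω → ℝ) (t : Time T) (ω : Ω) :
    H.integral S t ω = ∑ j ∈ Finset.range H.n, H.coef j ω *
      (S (min (H.time (j + 1) ω) t) ω - S (min (H.time j ω) t) ω) := by
  rw [integral, ← Fin.sum_univ_eq_sum_range fun j => H.coef j ω *
      (S (min (H.time (j + 1) ω) t) ω - S (min (H.time j ω) t) ω)]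
  refine Finset.sum_congr rfl fun j _ => ?_
  rw [coef_coe, time_succ, time_castSucc]

lemma process_eq (H : SimpleIntegrand 𝓕 P) {j : ℕ} {t : Time T} {ω : Ω} (hj : j < H.n)
    (h1 : H.time j ω < t) (h2 : t ≤ H.time (j + 1) ω) : H.process t ω = H.coef j ω := by
  rw [process, Finset.sum_eq_single ⟨j, hj⟩]
  · rw [if_pos, ← coef_coe]
    rw [← time_castSucc, ← time_succ]
    exact ⟨h1, h2⟩
  · rintro i - hi
    rw [if_neg]
    rw [← time_castSucc, ← time_succ]
    rintro ⟨h3, h4⟩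
    rcases lt_trichotomy (i : ℕ) j with h | h | h
    · exact absurd (h1.trans_le (h4.trans (H.time_mono ω h))) (lt_irrefl _)
    · exact hi (Fin.ext h)
    · exact absurd (h3.trans_le (h2.trans (H.time_mono ω h))) (lt_irrefl _)
  · simp

/-- The norm of the process does not see a coefficient whose interval is empty. A nonempty interval
contains a grid point, and countably many grid points need only one null set. -/
lemma ae_abs_coef_le (H : SimpleIntegrand 𝓕 P) {h : ℝ} (hh : 0 ≤ h)
    (hH : supNorm P H.process ≤ ENNReal.ofReal h) :
    ∀ᵐ ω ∂P, ∀ j, H.time j ω < H.time (j + 1) ω → |H.coef j ω| ≤ h := by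
  have : ∀ᵐ ω ∂P, ∀ t ∈ gridUnion T, |H.process t ω| ≤ h :=
    (ae_ball_iff countable_gridUnion).mpr fun t _ => ae_abs_le_of_supNorm_le hh hH t
  filter_upwards [this] with ω hω j hj
  by_cases hn : j < H.n
  · obtain ⟨n, hlt⟩ := ((tendsto_gridSucc (H.time j ω)).eventually_lt_const hj).exists
    rw [← H.process_eq hn (lt_gridSucc n (hj.trans_le le_top)) hlt.le]
    exact hω _ (gridPt_mem_union _ _)
  · simp [coef, hn, hh]

lemma tendsto_integral_gridCeil (H : SimpleIntegrand 𝓕 P) {S : Time T → Ω → ℝ} {ω : Ω}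
    (hS : IsCadlagPath fun t => S t ω) (t : Time T) :
    Tendsto (fun n => H.integral S (gridCeil n t) ω) atTop (𝓝 (H.integral S t ω)) := by
  have h : ∀ s : Time T, Tendsto (fun n => S (min s (gridCeil n t)) ω) atTop
      (𝓝 (S (min s t) ω)) := fun s =>
    (hS (min s t)).1.tendsto.comp (tendsto_nhdsWithin_iff.mpr
      ⟨tendsto_const_nhds.min (tendsto_gridCeil t),
        Eventually.of_forall fun n => min_le_min_left _ (le_gridCeil n t)⟩)
  exact tendsto_finsetSum _ fun j _ => ((h _).sub (h _)).const_mul _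

/-- The norm gives the bound at each fixed time almost surely; one null set serves all grid times,
and right-continuity gives the other times. -/
lemma ae_neg_le_integral (H : SimpleIntegrand 𝓕 P) {S : Time T → Ω → ℝ} (hS : IsCadlag P S)
    {δ : ℝ} (hδ : 0 ≤ δ)
    (hH : supNorm P (fun t ω => max (-H.integral S t ω) 0) ≤ ENNReal.ofReal δ) :
    ∀ᵐ ω ∂P, ∀ t, -δ ≤ H.integral S t ω := by
  have : ∀ᵐ ω ∂P, ∀ t ∈ gridUnion T, |max (-H.integral S t ω) 0| ≤ δ :=
    (ae_ball_iff countable_gridUnion).mpr fun t _ => ae_abs_le_of_supNorm_le hδ hH t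
  filter_upwards [this, hS] with ω hω hc t
  refine ge_of_tendsto' (H.tendsto_integral_gridCeil hc t) fun n => ?_
  have h1 := hω (gridCeil n t) (gridPt_mem_union _ _)
  rw [abs_of_nonneg (le_max_right _ _)] at h1
  linarith [le_max_left (-H.integral S (gridCeil n t) ω) 0]

end SimpleIntegrand

end SimpleIntegrandLemmas

/-! ### Localization: stopping and killing on a set. -/

section Cut

variable {T : ℝ≥0} {Ω : Type*} {mΩ : MeasurableSpace Ω} {𝓕 : Filtration (Time T) mΩ}
  {P : Measure Ω}

/-- The process stopped at `ρ` and put to zero outside of `F`. -/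
noncomputable def cut (F : Set Ω) (ρ : Ω → WithTop (Time T)) (X : Time T → Ω → ℝ) :
    Time T → Ω → ℝ := fun t ω => F.indicator (X (stopAt t (ρ ω))) ω

lemma cut_of_mem {F : Set Ω} {ρ : Ω → WithTop (Time T)} {X : Time T → Ω → ℝ} {ω : Ω} (h : ω ∈ F)
    (t : Time T) : cut F ρ X t ω = X (stopAt t (ρ ω)) ω := Set.indicator_of_mem h _

lemma cut_of_notMem {F : Set Ω} {ρ : Ω → WithTop (Time T)} {X : Time T → Ω → ℝ} {ω : Ω}
    (h : ω ∉ F) (t : Time T) : cut F ρ X t ω = 0 := Set.indicator_of_notMem h _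

lemma isCadlagPath_cut {F : Set Ω} {X : Time T → Ω → ℝ}
    (hX : ∀ ω ∈ F, IsCadlagPath fun t => X t ω) (ρ : Ω → WithTop (Time T)) (ω : Ω) :
    IsCadlagPath fun t => cut F ρ X t ω := by
  by_cases h : ω ∈ F
  · simp only [cut_of_mem h]
    exact (hX ω h).comp_stopAt _
  · simp only [cut_of_notMem h]
    exact isCadlagPath_const 0

lemma stronglyAdapted_cut {F : Set Ω} (hF : MeasurableSet[𝓕 ⊥] F) {X : Time T → Ω → ℝ}
    (hXa : StronglyAdapted 𝓕 X) (hX : ∀ ω ∈ F, IsCadlagPath fun t => X t ω)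
    {ρ : Ω → WithTop (Time T)} (hρ : IsStoppingTime 𝓕 ρ) : StronglyAdapted 𝓕 (cut F ρ X) :=
  stronglyAdapted_stop (X := fun t => F.indicator (X t))
    (fun t => (hXa t).indicator (𝓕.mono bot_le _ hF))
    (fun ω => by
      have := isCadlagPath_cut hX (fun _ => ⊤) ω
      simpa only [cut, stopAt_top] using this) hρ

lemma martingale_cut [IsProbabilityMeasure P] {F : Set Ω} (hF : MeasurableSet[𝓕 ⊥] F)
    {X : Time T → Ω → ℝ} {κ : Ω → WithTop (Time T)}
    (hX : Martingale (cut {ω | ⊥ < κ ω} κ X) 𝓕 P) (hFκ : F ⊆ {ω | ⊥ < κ ω})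
    (hXc : ∀ ω ∈ F, IsCadlagPath fun t => X t ω) {π : Ω → WithTop (Time T)}
    (hπ : IsStoppingTime 𝓕 π) : Martingale (cut F (fun ω => min (κ ω) (π ω)) X) 𝓕 P := by
  have h1 : (fun t => F.indicator (cut {ω | ⊥ < κ ω} κ X t)) = cut F κ X := by
    ext t ω
    by_cases h : ω ∈ F
    · rw [Set.indicator_of_mem h, cut_of_mem h, cut_of_mem (hFκ h)]
    · rw [Set.indicator_of_notMem h, cut_of_notMem h]
  have h2 := martingale_stop (h1 ▸ martingale_indicator hX hF) (isCadlagPath_cut hXc κ) hπ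
  convert h2 using 3 with t ω
  by_cases h : ω ∈ F
  · rw [cut_of_mem h, cut_of_mem h, stopAt_stopAt, min_comm]
  · rw [cut_of_notMem h, cut_of_notMem h]

/-- Transfers loss bounds valid at all times from a process to its localization. -/
lemma SimpleIntegrand.integral_cut (H : SimpleIntegrand 𝓕 P) {F : Set Ω}
    {ρ : Ω → WithTop (Time T)} {X : Time T → Ω → ℝ} {ω : Ω} (h : ω ∈ F) (t : Time T) :
    H.integral (cut F ρ X) t ω = H.integral X (stopAt t (ρ ω)) ω := by
  simp only [integral, cut_of_mem h]
  refine Finset.sum_congr rfl fun j _ => ?_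
  simp only [stopAt_min]

end Cut

section Semimartingales

variable {T : ℝ≥0} {Ω : Type*} {mΩ : MeasurableSpace Ω} {𝓕 : Filtration (Time T) mΩ}
  {P : Measure Ω} [IsProbabilityMeasure P]

/-- Elementary integrals with respect to a bounded semimartingale with a true martingale as
martingale part. -/
lemma tendsto_measureReal_integral_ge {S N : Time T → Ω → ℝ} {K : ℝ} (hS : StronglyAdapted 𝓕 S)
    (hSc : ∀ ω, IsCadlagPath fun t => S t ω) (hSK : ∀ ω t, |S t ω| ≤ K)
    (hN : Martingale N 𝓕 P) (hNc : ∀ ω, IsCadlagPath fun t => N t ω)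
    (hA : ∀ᵐ ω ∂P, BoundedVariationOn (fun t => S t ω - N t ω) Set.univ)
    {H : ℕ → SimpleIntegrand 𝓕 P} {δ h : ℕ → ℝ} (hδ0 : ∀ k, 0 ≤ δ k) (hh0 : ∀ k, 0 ≤ h k)
    (hδ : Tendsto δ atTop (𝓝 0)) (hh : Tendsto h atTop (𝓝 0))
    (hneg : ∀ᶠ k in atTop, ∀ᵐ ω ∂P, ∀ t, -δ k ≤ (H k).integral S t ω)
    (hcoef : ∀ᶠ k in atTop, ∀ᵐ ω ∂P, ∀ j, (H k).time j ω < (H k).time (j + 1) ω →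
      |(H k).coef j ω| ≤ h k) {η : ℝ} (hη : 0 < η) :
    Tendsto (fun k => P.real {ω | η ≤ (H k).integral S ⊤ ω}) atTop (𝓝 0) := by
  set X : Ω → ℝ≥0∞ := fun ω => ENNReal.ofReal |S ⊥ ω - N ⊥ ω| +
    gridVariation (fun t ω => S t ω - N t ω) ω with hXdef
  have hSm : ∀ t, Measurable (S t) := fun t => ((hS t).mono (𝓕.le t)).measurable
  have hNm : ∀ t, Measurable (N t) := fun t => ((hN.1 t).mono (𝓕.le t)).measurable
  have hX : Measurable X := by
    refine Measurable.add ?_ (measurable_gridVariation fun t => (hSm t).sub (hNm t))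
    exact ((measurable_abs : Measurable fun x : ℝ => |x|).comp ((hSm ⊥).sub (hNm ⊥))).ennreal_ofReal
  have hXfin : ∀ᵐ ω ∂P, X ω ≠ ∞ := by
    filter_upwards [hA] with ω hω
    exact ENNReal.add_ne_top.mpr ⟨ENNReal.ofReal_ne_top,
      ne_top_of_le_ne_top hω (gridVariation_le (fun t ω => S t ω - N t ω) ω)⟩
  -- For fixed `a` the last term vanishes as `k → ∞`; a large `a` then makes the tail of `X` small.
  have hkey : ∀ a : ℕ, ∀ᶠ k in atTop, P.real {ω | η ≤ (H k).integral S ⊤ ω} ≤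
      P.real {ω | (a : ℝ≥0∞) ≤ X ω} +
        2 * (δ k + h k * (2 * a + K + ∫ ω, |N ⊤ ω| ∂P)) / (η - h k * a) := by
    intro a
    have h1 : ∀ᶠ k in atTop, h k * a < η := by
      have := hh.mul_const (a : ℝ)
      rw [zero_mul] at this
      exact this.eventually_lt_const hη
    filter_upwards [h1, hneg, hcoef] with k hk hnegk hcoefk
    -- Truncation makes the bound hold everywhere and, up to a null set, alters coefficients only on
    -- empty intervals, leaving the integral unchanged.
    set g : ℕ → Ω → ℝ := fun j ω => max (-h k) (min (h k) ((H k).coef j ω)) with hgdef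
    have heq : ∀ᵐ ω ∂P, ∀ t, (H k).integral S t ω = ∑ j ∈ Finset.range (H k).n, g j ω *
        (S (min ((H k).time (j + 1) ω) t) ω - S (min ((H k).time j ω) t) ω) := by
      filter_upwards [hcoefk] with ω hω t
      rw [SimpleIntegrand.integral_eq]
      refine Finset.sum_congr rfl fun j _ => ?_
      rcases eq_or_lt_of_le ((H k).time_mono ω (Nat.le_succ j)) with he | hlt
      · have he' : (H k).time (j + 1) ω = (H k).time j ω := he.symm
        rw [he', sub_self, mul_zero, mul_zero]
      · have := abs_le.mp (hω j hlt)
        simp only [hgdef]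
        rw [min_eq_right this.2, max_eq_right this.1]
    have hmain := measureReal_integral_ge_le (P := P) hS hSc hSK hN hNc (H k).n
      (H k).isStoppingTime_time (H k).time_mono (H k).time_zero (g := g) (δ := δ k) (h := h k)
      (a := a) (η := η)
      (fun j => measurable_const.max (measurable_const.min ((H k).measurable_coef j))) (hh0 k)
      (fun j ω => abs_le.mpr ⟨le_max_left _ _, max_le (by linarith [hh0 k]) (min_le_left _ _)⟩)
      (hδ0 k)
      (by filter_upwards [hnegk, heq] with ω h2 h3 t using (h3 t) ▸ h2 t)
      (Nat.cast_nonneg a) hk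
    refine le_trans (le_of_eq ?_) (hmain.trans (add_le_add (measureReal_mono fun ω hω => ?_) le_rfl))
    · refine measureReal_congr ?_
      filter_upwards [heq] with ω hω
      have := hω ⊤
      simp only [min_top_right] at this
      show (η ≤ _) = (η ≤ _)
      rw [this]
    · have h2 : ENNReal.ofReal a ≤ ENNReal.ofReal |S ⊥ ω - N ⊥ ω| +
        eVariationOn (fun t => S t ω - N t ω) Set.univ := hω
      rw [ENNReal.ofReal_natCast] at h2
      refine h2.trans (add_le_add le_rfl ?_)
      exact eVariationOn_le_gridVariation (A := fun t ω => S t ω - N t ω)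
        fun t => ((hSc ω).sub (hNc ω) t).1
  have htail := tendsto_measureReal_tail hX hXfin
  refine Metric.tendsto_atTop'.mpr fun ε hε => ?_
  obtain ⟨a, ha⟩ := (htail.eventually_lt_const (half_pos hε)).exists
  have hlim : Tendsto (fun k => 2 * (δ k + h k * (2 * a + K + ∫ ω, |N ⊤ ω| ∂P)) / (η - h k * a))
      atTop (𝓝 0) := by
    have h1 := ((hδ.add (hh.mul_const (2 * a + K + ∫ ω, |N ⊤ ω| ∂P))).const_mul 2).div
      ((tendsto_const_nhds (x := η)).sub (hh.mul_const (a : ℝ))) (by simpa using hη.ne')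
    simp only [zero_mul, add_zero, mul_zero, zero_div] at h1
    exact h1
  obtain ⟨n, hn⟩ := eventually_atTop.mp ((hkey a).and (hlim.eventually_lt_const (half_pos hε)))
  refine ⟨n, fun k hk => ?_⟩
  rw [Real.dist_eq, sub_zero, abs_of_nonneg measureReal_nonneg]
  linarith [(hn k hk.le).1, (hn k hk.le).2]

/-- The localizing times of `M` and `S` are combined, and bad paths are killed. Where both times of
index `m` are infinite, `S` and its localization almost surely have the same gains, and the rest has
small probability. -/
theorem noFreeLunch_of_isSemimartingale (h𝓕 : UsualConditions 𝓕 P) {S : Time T → Ω → ℝ}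
    (hS : StronglyAdapted 𝓕 S) (hSc : IsCadlag P S) (hSb : IsLocallyBounded 𝓕 P S)
    (hsm : IsSemimartingale 𝓕 P S) : NoFreeLunchVanishingRiskLittleInvestment 𝓕 P S := by
  intro H hneg hproc
  obtain ⟨M, A, hM, hA, hSMA⟩ := hsm
  obtain ⟨κ, hκ, hκM⟩ := hM.locally_martingale
  obtain ⟨π, hπ, hπS⟩ := hSb
  have hδ0 : ∀ᶠ k in atTop, supNorm P (fun t ω => max (-(H k).integral S t ω) 0) ≠ ∞ :=
    (hneg.eventually_lt_const ENNReal.zero_lt_top).mono fun k hk => hk.ne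
  have hh0 : ∀ᶠ k in atTop, supNorm P (H k).process ≠ ∞ :=
    (hproc.eventually_lt_const ENNReal.zero_lt_top).mono fun k hk => hk.ne
  have hδ := (ENNReal.tendsto_toReal ENNReal.zero_ne_top).comp hneg
  have hh := (ENNReal.tendsto_toReal ENNReal.zero_ne_top).comp hproc
  rw [tendstoInMeasure_iff_measureReal_dist]
  intro η hη
  refine Metric.tendsto_atTop'.mpr fun ε hε => ?_
  obtain ⟨m, hm1, hm2⟩ := (((tendsto_measureReal_ne_top hκ.toIsPreLocalizingSequence).eventually_lt_const
    (show 0 < ε / 3 by linarith)).and ((tendsto_measureReal_ne_top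
      hπ.toIsPreLocalizingSequence).eventually_lt_const (show 0 < ε / 3 by linarith))).exists
  obtain ⟨K, hK⟩ := hπS m
  set good : Ω → Prop := fun ω => IsCadlagPath (fun t => S t ω) ∧ IsCadlagPath (fun t => M t ω) ∧
    ∀ t, |cut {ω | ⊥ < π m ω} (π m) S t ω| ≤ K with hgood
  have hgood_ae : ∀ᵐ ω ∂P, good ω := by
    filter_upwards [hSc, hM.cadlag, hK] with ω h1 h2 h3 using ⟨h1, h2, h3⟩
  have hpos : ∀ {τ : Ω → WithTop (Time T)}, IsStoppingTime 𝓕 τ → MeasurableSet[𝓕 ⊥] {ω | ⊥ < τ ω} :=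
    fun {τ} hτ => hτ.measurableSet_gt ⊥
  set F : Set Ω := {ω | good ω} ∩ ({ω | ⊥ < κ m ω} ∩ {ω | ⊥ < π m ω}) with hFdef
  have hF : MeasurableSet[𝓕 ⊥] F := (h𝓕.measurableSet_of_ae hgood_ae ⊥).inter
    ((hpos (hκ.isStoppingTime m)).inter (hpos (hπ.isStoppingTime m)))
  set θ : Ω → WithTop (Time T) := fun ω => min (κ m ω) (π m ω) with hθdef
  have hθ : IsStoppingTime 𝓕 θ := (hκ.isStoppingTime m).min (hπ.isStoppingTime m)
  have hlim := tendsto_measureReal_integral_ge (P := P) (S := cut F θ S) (N := cut F θ M)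
    (K := max K 0) (H := H) (stronglyAdapted_cut hF hS (fun ω hω => hω.1.1) hθ)
    (isCadlagPath_cut (fun ω hω => hω.1.1) θ)
    (fun ω t => by
      by_cases h : ω ∈ F
      · rw [cut_of_mem h]
        have := h.1.2.2 (stopAt t (κ m ω))
        rw [cut_of_mem h.2.2, stopAt_stopAt] at this
        exact le_max_of_le_left this
      · rw [cut_of_notMem h, abs_zero]
        exact le_max_right _ _)
    (martingale_cut hF (hκM m) (fun ω hω => hω.2.1) (fun ω hω => hω.1.2.1) (hπ.isStoppingTime m))
    (isCadlagPath_cut (fun ω hω => hω.1.2.1) θ)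
    (by
      filter_upwards [hA.boundedVariation] with ω hω
      by_cases h : ω ∈ F
      · simp only [cut_of_mem h, hSMA, add_sub_cancel_left]
        exact ne_top_of_le_ne_top hω (eVariationOn.comp_le_of_monotoneOn (fun t => A t ω)
          (fun t => stopAt t (θ ω)) ((stopAt_mono (θ ω)).monotoneOn _) fun _ _ => Set.mem_univ _)
      · simp only [cut_of_notMem h, sub_self]
        have h0 : eVariationOn (fun _ : Time T => (0 : ℝ)) Set.univ = 0 :=
          eVariationOn.constant_on (by simp [Set.Subsingleton])
        exact ne_top_of_le_ne_top ENNReal.zero_ne_top h0.le)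
    (fun k => ENNReal.toReal_nonneg) (fun k => ENNReal.toReal_nonneg) hδ hh
    (by
      filter_upwards [hδ0] with k hk
      filter_upwards [(H k).ae_neg_le_integral hSc ENNReal.toReal_nonneg
        (ENNReal.ofReal_toReal hk).ge] with ω hω t
      by_cases h : ω ∈ F
      · rw [SimpleIntegrand.integral_cut _ h]
        exact hω _
      · simp [SimpleIntegrand.integral, cut_of_notMem h])
    (by
      filter_upwards [hh0] with k hk
      exact (H k).ae_abs_coef_le ENNReal.toReal_nonneg (ENNReal.ofReal_toReal hk).ge) hη
  obtain ⟨n, hn⟩ := eventually_atTop.mp (hlim.eventually_lt_const (show 0 < ε / 3 by linarith))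
  refine ⟨n, fun k hk => ?_⟩
  rw [Real.dist_eq, sub_zero, abs_of_nonneg measureReal_nonneg]
  have hsub : P.real {ω | η ≤ dist (max ((H k).integral S ⊤ ω) 0) 0} ≤
      P.real ({ω | κ m ω ≠ ⊤} ∪ ({ω | π m ω ≠ ⊤} ∪ {ω | η ≤ (H k).integral (cut F θ S) ⊤ ω})) := by
    refine ENNReal.toReal_mono (measure_ne_top _ _) (measure_mono_ae ?_)
    filter_upwards [hgood_ae] with ω hω h1
    by_cases h2 : κ m ω = ⊤
    · by_cases h3 : π m ω = ⊤
      · refine Or.inr (Or.inr ?_)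
        have hωF : ω ∈ F := ⟨hω, by simp [h2], by simp [h3]⟩
        show η ≤ _
        rw [SimpleIntegrand.integral_cut _ hωF, hθdef]
        simp only [h2, h3, min_self, stopAt_top]
        have h4 : η ≤ dist (max ((H k).integral S ⊤ ω) 0) 0 := h1
        rw [Real.dist_eq, sub_zero, abs_of_nonneg (le_max_right _ _)] at h4
        rcases le_max_iff.mp h4 with h5 | h5
        · exact h5
        · exact absurd h5 (not_le.mpr hη)
      · exact Or.inr (Or.inl h3)
    · exact Or.inl h2
  have h1 := measureReal_union_le (μ := P) {ω | κ m ω ≠ ⊤}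
    ({ω | π m ω ≠ ⊤} ∪ {ω | η ≤ (H k).integral (cut F θ S) ⊤ ω})
  have h2 := measureReal_union_le (μ := P) {ω | π m ω ≠ ⊤}
    {ω | η ≤ (H k).integral (cut F θ S) ⊤ ω}
  linarith [hn k hk.le]

end Semimartingales

/-! ### No free lunch bounds the gains on grids. -/

section GridTrading

variable {T : ℝ≥0} {Ω : Type*} {mΩ : MeasurableSpace Ω} {𝓕 : Filtration (Time T) mΩ}
  {P : Measure Ω}

namespace SimpleIntegrand

/-- A simple integrand which is zero after the last of the given stopping times. -/
noncomputable def ofNat [IsProbabilityMeasure P] (N : ℕ) (σ : ℕ → Ω → Time T)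
    (hσ : ∀ j, IsStoppingTime 𝓕 fun ω => (σ j ω : WithTop (Time T)))
    (hσm : ∀ ω, Monotone fun j => σ j ω) (hσ0 : ∀ ω, σ 0 ω = ⊥) (g : ℕ → Ω → ℝ) (C : ℝ)
    (hg : ∀ j, Measurable[(hσ j).measurableSpace] (g j)) (hgC : ∀ j ω, |g j ω| ≤ C) :
    SimpleIntegrand 𝓕 P where
  n := N + 1
  τ j ω := if (j : ℕ) ≤ N then σ j ω else ⊤
  isStoppingTime j := by
    by_cases h : (j : ℕ) ≤ N
    · simp only [h, if_true]; exact hσ j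
    · simp only [h, if_false]; exact isStoppingTime_const 𝓕 ⊤
  mono ω i j hij := by
    have hij' : (i : ℕ) ≤ j := hij
    by_cases h : (j : ℕ) ≤ N
    · simp only [h, hij'.trans h, if_true]; exact hσm ω hij'
    · simp only [h, if_false]; exact le_top
  τ_zero ω := by simp [hσ0]
  τ_last ω := by simp
  f j := if (j : ℕ) < N then g j else fun _ => 0
  measurable_f j := by
    by_cases h : (j : ℕ) < N
    · have aux : ∀ (ρ : Ω → WithTop (Time T)) (hρ : IsStoppingTime 𝓕 ρ),
          ρ = (fun ω => (σ j ω : WithTop (Time T))) → Measurable[hρ.measurableSpace] (g j) := by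
        rintro ρ hρ rfl; exact hg j
      rw [if_pos h]
      refine aux _ _ ?_
      ext1 ω
      simp [h.le]
    · rw [if_neg h]; exact measurable_const
  memLp_f j := by
    refine memLp_top_of_bound (C := C) ?_ (ae_of_all _ fun ω => ?_)
    · by_cases h : (j : ℕ) < N
      · rw [if_pos h]; exact ((hg j).mono (hσ j).measurableSpace_le le_rfl).aestronglyMeasurable
      · rw [if_neg h]; exact aestronglyMeasurable_const
    · by_cases h : (j : ℕ) < N
      · rw [if_pos h]; exact hgC j ω
      · rw [if_neg h, norm_zero]; exact (abs_nonneg _).trans (hgC 0 ω)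

section ofNat

variable [IsProbabilityMeasure P] {N : ℕ} {σ : ℕ → Ω → Time T}
    {hσ : ∀ j, IsStoppingTime 𝓕 fun ω => (σ j ω : WithTop (Time T))}
    {hσm : ∀ ω, Monotone fun j => σ j ω} {hσ0 : ∀ ω, σ 0 ω = ⊥} {g : ℕ → Ω → ℝ} {C : ℝ}
    {hg : ∀ j, Measurable[(hσ j).measurableSpace] (g j)} {hgC : ∀ j ω, |g j ω| ≤ C}

lemma integral_ofNat (S : Time T → Ω → ℝ) (t : Time T) (ω : Ω) :
    (ofNat (P := P) N σ hσ hσm hσ0 g C hg hgC).integral S t ω = ∑ j ∈ Finset.range N,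
      g j ω * (S (min (σ (j + 1) ω) t) ω - S (min (σ j ω) t) ω) := by
  change ∑ j : Fin (N + 1), (if (j : ℕ) < N then g j else fun _ => 0) ω *
    (S (min (if (j.succ : ℕ) ≤ N then σ j.succ ω else ⊤) t) ω -
      S (min (if (j.castSucc : ℕ) ≤ N then σ j.castSucc ω else ⊤) t) ω) = _
  rw [Fin.sum_univ_castSucc]
  simp only [Fin.val_castSucc, Fin.is_lt, if_true, Fin.val_last, lt_irrefl, if_false, zero_mul,
    add_zero, Fin.val_succ]
  rw [← Fin.sum_univ_eq_sum_range fun j => g j ω *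
      (S (min (σ (j + 1) ω) t) ω - S (min (σ j ω) t) ω)]
  refine Finset.sum_congr rfl fun j _ => ?_
  rw [if_pos (Nat.succ_le_of_lt j.2), if_pos j.2.le]

lemma abs_process_ofNat_le (t : Time T) (ω : Ω) :
    |(ofNat (P := P) N σ hσ hσm hσ0 g C hg hgC).process t ω| ≤ C := by
  set H := ofNat (P := P) N σ hσ hσm hσ0 g C hg hgC
  have h0 : 0 ≤ C := (abs_nonneg _).trans (hgC 0 ω)
  have hf : ∀ j, |H.coef j ω| ≤ C := by
    intro j
    rw [coef]
    split_ifs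
    · change |(if j < N then g j else fun _ => 0) ω| ≤ C
      split_ifs <;> simp [h0, hgC]
    · simpa using h0
  by_cases h : ∃ j : Fin H.n, H.τ j.castSucc ω < t ∧ t ≤ H.τ j.succ ω
  · obtain ⟨j, h1, h2⟩ := h
    rw [H.process_eq j.2 (by rwa [H.time_castSucc]) (by rwa [H.time_succ])]
    exact hf _
  · push Not at h
    rw [process, Finset.sum_eq_zero fun j _ => if_neg fun h1 => not_lt.mpr h1.2 (h j h1.1), abs_zero]
    exact h0

end ofNat

end SimpleIntegrand

/-- On `p ≤ π`, what is known at `p` is known at `p ∧ π`; elsewhere the function is zero. -/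
lemma measurable_indicator_stopAt {π : Ω → WithTop (Time T)} (hπ : IsStoppingTime 𝓕 π) {p : Time T}
    {f : Ω → ℝ} (hf : Measurable[𝓕 p] f)
    (h : IsStoppingTime 𝓕 fun ω => (stopAt p (π ω) : WithTop (Time T))) :
    Measurable[h.measurableSpace] ({ω | ↑p ≤ π ω}.indicator f) := by
  have aux : ∀ (ρ : Ω → WithTop (Time T)) (hρ : IsStoppingTime 𝓕 ρ),
      ρ = (fun ω => min ↑p (π ω)) → ∀ B, MeasurableSet[𝓕 p] B →
        MeasurableSet[hρ.measurableSpace] (B ∩ {ω | ↑p ≤ π ω}) := by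
    rintro ρ hρ rfl B hB
    exact (isStoppingTime_const 𝓕 p).measurableSet_inter_le hπ B
      (by rwa [IsStoppingTime.measurableSpace_const])
  have h1 := aux _ h (by ext1 ω; rw [coe_stopAt])
  intro B hB
  have h2 : MeasurableSet[h.measurableSpace] {ω | ↑p ≤ π ω} := by
    simpa using h1 _ MeasurableSet.univ
  by_cases h0 : (0 : ℝ) ∈ B
  · have : {ω | ↑p ≤ π ω}.indicator f ⁻¹' B = (f ⁻¹' B ∩ {ω | ↑p ≤ π ω}) ∪ {ω | ↑p ≤ π ω}ᶜ := by
      ext ω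
      by_cases h3 : ↑p ≤ π ω <;> simp [Set.indicator, h3, h0]
    rw [this]
    exact (h1 _ (hf hB)).union h2.compl
  · have : {ω | ↑p ≤ π ω}.indicator f ⁻¹' B = f ⁻¹' B ∩ {ω | ↑p ≤ π ω} := by
      ext ω
      by_cases h3 : ↑p ≤ π ω <;> simp [Set.indicator, h3, h0]
    rw [this]
    exact h1 _ (hf hB)

/-- Trading at grid times with bounded positions and bounded losses, the gains are bounded in
probability. -/
def BoundedGridGains (𝓕 : Filtration (Time T) mΩ) (P : Measure Ω) (Z : Time T → Ω → ℝ) : Prop :=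
  ∀ C L ε : ℝ, 0 < ε → ∃ c : ℝ, ∀ (n : ℕ) (f : ℕ → Ω → ℝ),
    (∀ j, Measurable[𝓕 (gridPt n j)] (f j)) → (∀ j ω, |f j ω| ≤ C) →
    (∀ ω t, -L ≤ ∑ j ∈ Finset.range (2 ^ n),
      f j ω * (Z (min (gridPt n (j + 1)) t) ω - Z (min (gridPt n j) t) ω)) →
    P.real {ω | c ≤ ∑ j ∈ Finset.range (2 ^ n),
      f j ω * (Z (gridPt n (j + 1)) ω - Z (gridPt n j) ω)} ≤ ε

/-- Otherwise, for each `k`, some strategy gains at least `k + 1` with probability above `ε`.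
Dividing it by `k + 1` makes size and risk vanish while a gain of at least `1` keeps that
probability. Trading the localized process on a grid is trading `S` at grid times stopped at `π`;
off `G`, almost surely `π` is `0` and nothing is traded. -/
theorem boundedGridGains_cut [IsProbabilityMeasure P] {S : Time T → Ω → ℝ}
    (hS : NoFreeLunchVanishingRiskLittleInvestment 𝓕 P S) {G : Set Ω} {π : Ω → WithTop (Time T)}
    (hπ : IsStoppingTime 𝓕 π) (hG : ∀ᵐ ω ∂P, ω ∉ G → π ω = ⊥) :
    BoundedGridGains 𝓕 P (cut G π S) := by
  intro C L ε hε
  by_contra! hcon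
  choose n f hfm hfC hfL hfP using fun k : ℕ => hcon (k + 1)
  set σ : ℕ → ℕ → Ω → Time T := fun k j ω => stopAt (gridPt (n k) j) (π ω) with hσdef
  have hσ : ∀ k j, IsStoppingTime 𝓕 fun ω => (σ k j ω : WithTop (Time T)) := fun k j =>
    isStoppingTime_stopAt hπ _
  set g : ℕ → ℕ → Ω → ℝ := fun k j ω =>
    (1 / ((k : ℝ) + 1)) * {ω | ↑(gridPt (n k) j : Time T) ≤ π ω}.indicator (f k j) ω with hgdef
  have hg : ∀ k j, Measurable[(hσ k j).measurableSpace] (g k j) := fun k j =>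
    (measurable_indicator_stopAt hπ (hfm k j) _).const_mul _
  have hC0 : ∀ ω : Ω, 0 ≤ C := fun ω => (abs_nonneg _).trans (hfC 0 0 ω)
  have hk0 : ∀ k : ℕ, 0 < 1 / ((k : ℝ) + 1) := fun k => by positivity
  have hgC : ∀ k j ω, |g k j ω| ≤ (1 / ((k : ℝ) + 1)) * C := by
    intro k j ω
    rw [hgdef, abs_mul, abs_of_pos (hk0 k)]
    refine mul_le_mul_of_nonneg_left ?_ (hk0 k).le
    by_cases h : ↑(gridPt (n k) j : Time T) ≤ π ω
    · rw [Set.indicator_of_mem (show ω ∈ {ω | _ ≤ π ω} from h)]; exact hfC k j ω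
    · rw [Set.indicator_of_notMem (show ω ∉ {ω | _ ≤ π ω} from h), abs_zero]; exact hC0 ω
  set H : ℕ → SimpleIntegrand 𝓕 P := fun k => SimpleIntegrand.ofNat (2 ^ n k) (σ k) (hσ k)
    (fun ω => (stopAt_mono (π ω)).comp (gridPt_mono (n k)))
    (fun ω => by simp only [hσdef, gridPt_zero, bot_stopAt]) (g k) _ (hg k) (hgC k)
  have hint : ∀ᵐ ω ∂P, ∀ k t, (H k).integral S t ω = (1 / ((k : ℝ) + 1)) *
      ∑ j ∈ Finset.range (2 ^ n k), f k j ω * (cut G π S (min (gridPt (n k) (j + 1)) t) ω -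
        cut G π S (min (gridPt (n k) j) t) ω) := by
    filter_upwards [hG] with ω hω k t
    rw [SimpleIntegrand.integral_ofNat, Finset.mul_sum]
    refine Finset.sum_congr rfl fun j _ => ?_
    simp only [hgdef, hσdef]
    rw [mul_assoc]
    congr 1
    by_cases h : ω ∈ G
    · rw [cut_of_mem h, cut_of_mem h, min_stopAt, min_stopAt]
      by_cases h1 : ↑(gridPt (n k) j : Time T) ≤ π ω
      · rw [Set.indicator_of_mem (show ω ∈ {ω | _ ≤ π ω} from h1)]
      · rw [Set.indicator_of_notMem (show ω ∉ {ω | _ ≤ π ω} from h1), zero_mul]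
        have h2 : ∀ i, j ≤ i → stopAt (gridPt (n k) i) (π ω) = stopAt (gridPt (n k) j) (π ω) := by
          intro i hij
          have h3 : π ω ≤ ↑(gridPt (n k) j : Time T) := (not_le.mp h1).le
          rw [← WithTop.coe_inj, coe_stopAt, coe_stopAt, min_eq_right h3,
            min_eq_right (h3.trans (WithTop.coe_le_coe.mpr (gridPt_mono _ hij)))]
        rw [← min_stopAt, ← min_stopAt, h2 (j + 1) (Nat.le_succ j), sub_self, mul_zero]
    · rw [cut_of_notMem h, cut_of_notMem h, hω h, stopAt_bot, stopAt_bot]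
      simp
  have hlim : ∀ a : ℝ, Tendsto (fun k : ℕ => ENNReal.ofReal ((1 / ((k : ℝ) + 1)) * a)) atTop (𝓝 0) := by
    intro a
    have := (tendsto_one_div_add_atTop_nhds_zero_nat (𝕜 := ℝ)).mul_const a
    rw [zero_mul] at this
    simpa using ENNReal.tendsto_ofReal this
  have hconv := hS H
    (tendsto_of_tendsto_of_tendsto_of_le_of_le tendsto_const_nhds (hlim (max L 0))
      (fun k => zero_le) fun k => supNorm_le_of_ae fun t => by
        filter_upwards [hint] with ω hω
        have h1 : 0 ≤ max L 0 := le_max_right _ _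
        rw [abs_of_nonneg (le_max_right _ _), hω]
        refine max_le ?_ (mul_nonneg (hk0 k).le h1)
        rw [← mul_neg]
        refine mul_le_mul_of_nonneg_left ?_ (hk0 k).le
        linarith [hfL k ω t, le_max_left L 0])
    (tendsto_of_tendsto_of_tendsto_of_le_of_le tendsto_const_nhds (hlim C)
      (fun k => zero_le) fun k => supNorm_le_of_ae fun t => ae_of_all _ fun ω =>
        SimpleIntegrand.abs_process_ofNat_le t ω)
  rw [tendstoInMeasure_iff_measureReal_dist] at hconv
  obtain ⟨k, hk⟩ := ((hconv 1 one_pos).eventually_lt_const hε).exists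
  refine absurd (hfP k) (not_lt.mpr (le_trans ?_ hk.le))
  refine ENNReal.toReal_mono (measure_ne_top _ _) (measure_mono_ae ?_)
  filter_upwards [hint] with ω hω h1
  show 1 ≤ dist _ _
  rw [Real.dist_eq, sub_zero]
  refine le_trans (le_max_of_le_left ?_) (le_abs_self _)
  rw [hω]
  simp only [min_top_right]
  rw [one_div, ← div_eq_inv_mul, one_le_div (by positivity)]
  exact h1

/-- Every time lies in an interval of the grid, and the gains up to this time are the gains of the
completed intervals together with those in the current one. -/
lemma exists_sum_grid (n : ℕ) (t : Time T) : ∃ J < 2 ^ n, ∀ (f : ℕ → ℝ) (z : Time T → ℝ),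
    ∑ j ∈ Finset.range (2 ^ n), f j * (z (min (gridPt n (j + 1)) t) - z (min (gridPt n j) t)) =
      ∑ j ∈ Finset.range J, f j * (z (gridPt n (j + 1)) - z (gridPt n j)) +
        f J * (z t - z (gridPt n J)) := by
  have h0 : (0 : ℕ) < 2 ^ n := by positivity
  obtain ⟨J, hJ, h1, h2⟩ : ∃ J < 2 ^ n, gridPt n J ≤ t ∧ t ≤ gridPt n (J + 1) := by
    rcases Nat.eq_zero_or_pos (gridIdx n t) with h | h
    · refine ⟨0, h0, by rw [gridPt_zero]; exact bot_le, ?_⟩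
      have := le_gridCeil n t
      rw [gridCeil, h] at this
      exact this.trans (gridPt_mono n (Nat.zero_le _))
    · refine ⟨gridIdx n t - 1, by have := gridIdx_le n t; omega, ?_, ?_⟩
      · by_contra hlt
        have := gridIdx_le_of_le (not_le.mp hlt).le
        omega
      · rw [Nat.sub_add_cancel h]; exact le_gridCeil n t
  refine ⟨J, hJ, fun f z => ?_⟩
  have hsplit : 2 ^ n = (J + 1) + (2 ^ n - (J + 1)) := by omega
  rw [hsplit, Finset.sum_range_add, Finset.sum_range_succ, min_eq_right h2, min_eq_left h1,
    Finset.sum_eq_zero (s := Finset.range (2 ^ n - (J + 1))), add_zero]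
  · congr 1
    refine Finset.sum_congr rfl fun j hj => ?_
    have hj' := Finset.mem_range.mp hj
    rw [min_eq_left ((gridPt_mono n (Nat.succ_le_of_lt hj')).trans h1),
      min_eq_left ((gridPt_mono n hj'.le).trans h1)]
  · intro j _
    rw [min_eq_right (h2.trans (gridPt_mono n (by omega))),
      min_eq_right (h2.trans (gridPt_mono n (by omega)))]
    simp

end GridTrading

/-! ### Doob decomposition in discrete time. -/

section Discrete

variable {Ω : Type*} {mΩ : MeasurableSpace Ω} {P : Measure Ω}

lemma integrable_of_abs_le [IsFiniteMeasure P] {f : Ω → ℝ} {C : ℝ} (hf : Measurable f)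
    (h : ∀ ω, |f ω| ≤ C) : Integrable f P :=
  Integrable.of_bound hf.aestronglyMeasurable C (ae_of_all _ h)

/-- The quadratic variation of a process in discrete time. -/
def quadVar (X : ℕ → Ω → ℝ) (j : ℕ) (ω : Ω) : ℝ :=
  ∑ i ∈ Finset.range j, (X (i + 1) ω - X i ω) ^ 2

/-- The drift of a process in discrete time bounded by `K`, that is the conditional expectation of
its increments, truncated so that it is bounded everywhere. -/
noncomputable def drift (𝒢 : Filtration ℕ mΩ) (P : Measure Ω) (K : ℝ) (X : ℕ → Ω → ℝ) (j : ℕ)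
    (ω : Ω) : ℝ :=
  max (-(2 * K)) (min (2 * K) ((P[fun ω => X (j + 1) ω - X j ω | 𝒢 j]) ω))

/-- The increments of the martingale part of a process in discrete time. -/
noncomputable def innov (𝒢 : Filtration ℕ mΩ) (P : Measure Ω) (K : ℝ) (X : ℕ → Ω → ℝ) (j : ℕ)
    (ω : Ω) : ℝ :=
  X (j + 1) ω - X j ω - drift 𝒢 P K X j ω

variable {𝒢 : Filtration ℕ mΩ} {K : ℝ} {X : ℕ → Ω → ℝ}

lemma quadVar_succ (j : ℕ) (ω : Ω) :
    quadVar X (j + 1) ω = quadVar X j ω + (X (j + 1) ω - X j ω) ^ 2 := Finset.sum_range_succ _ _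

lemma quadVar_mono (ω : Ω) : Monotone fun j => quadVar X j ω :=
  monotone_nat_of_le_succ fun j => by rw [quadVar_succ]; nlinarith [sq_nonneg (X (j + 1) ω - X j ω)]

lemma quadVar_nonneg (j : ℕ) (ω : Ω) : 0 ≤ quadVar X j ω :=
  Finset.sum_nonneg fun _ _ => sq_nonneg _

lemma measurable_quadVar (hX : ∀ j, Measurable[𝒢 j] (X j)) (j : ℕ) :
    Measurable[𝒢 j] (quadVar X j) :=
  Finset.measurable_sum _ fun i hi => by
    have h := Finset.mem_range.mp hi
    exact (((hX (i + 1)).mono (𝒢.mono h) le_rfl).sub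
      ((hX i).mono (𝒢.mono h.le) le_rfl)).pow_const 2

lemma measurable_drift (j : ℕ) : Measurable[𝒢 j] (drift 𝒢 P K X j) :=
  measurable_const.max (measurable_const.min stronglyMeasurable_condExp.measurable)

lemma abs_drift_le (hK : 0 ≤ K) (j : ℕ) (ω : Ω) : |drift 𝒢 P K X j ω| ≤ 2 * K :=
  abs_le.mpr ⟨le_max_left _ _, max_le (by linarith) (min_le_left _ _)⟩

lemma measurable_innov (hX : ∀ j, Measurable[𝒢 j] (X j)) (j : ℕ) :
    Measurable[𝒢 (j + 1)] (innov 𝒢 P K X j) :=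
  ((hX (j + 1)).sub ((hX j).mono (𝒢.mono (Nat.le_succ j)) le_rfl)).sub
    ((measurable_drift j).mono (𝒢.mono (Nat.le_succ j)) le_rfl)

lemma abs_increment_le (hXK : ∀ j ω, |X j ω| ≤ K) (j : ℕ) (ω : Ω) :
    |X (j + 1) ω - X j ω| ≤ 2 * K := by
  have := abs_sub (X (j + 1) ω) (X j ω)
  linarith [hXK (j + 1) ω, hXK j ω]

lemma abs_innov_le (hK : 0 ≤ K) (hXK : ∀ j ω, |X j ω| ≤ K) (j : ℕ) (ω : Ω) :
    |innov 𝒢 P K X j ω| ≤ 4 * K := by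
  have := abs_sub (X (j + 1) ω - X j ω) (drift 𝒢 P K X j ω)
  have h1 := abs_increment_le hXK j ω
  have h2 := abs_drift_le (𝒢 := 𝒢) (P := P) (X := X) hK j ω
  rw [innov]
  linarith

/-- Increments are bounded by `2 * K`, so the truncation in `drift` is almost surely inactive and
`innov` is a martingale difference. -/
lemma integral_mul_innov [IsProbabilityMeasure P] (hK : 0 ≤ K) (hX : ∀ j, Measurable[𝒢 j] (X j))
    (hXK : ∀ j ω, |X j ω| ≤ K) {j : ℕ} {g : Ω → ℝ} (hg : Measurable[𝒢 j] g) {c : ℝ}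
    (hgc : ∀ ω, |g ω| ≤ c) : ∫ ω, g ω * innov 𝒢 P K X j ω ∂P = 0 := by
  have hXm : ∀ j, Measurable (X j) := fun j => (hX j).mono (𝒢.le j) le_rfl
  have hgm : Measurable g := hg.mono (𝒢.le j) le_rfl
  have hi : Integrable (fun ω => X (j + 1) ω - X j ω) P :=
    integrable_of_abs_le ((hXm _).sub (hXm _)) (abs_increment_le hXK j)
  have hgi : Integrable (g * fun ω => X (j + 1) ω - X j ω) P :=
    hi.bdd_mul hgm.aestronglyMeasurable (ae_of_all _ hgc)
  have hgd : Integrable (fun ω => g ω * drift 𝒢 P K X j ω) P :=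
    (integrable_of_abs_le ((measurable_drift j).mono (𝒢.le j) le_rfl) (abs_drift_le hK j)).bdd_mul
      hgm.aestronglyMeasurable (ae_of_all _ hgc)
  have hb := ae_bdd_abs_condExp_of_ae_bdd_abs (m := 𝒢 j) (μ := P) (R := 2 * K)
    (f := fun ω => X (j + 1) ω - X j ω) (ae_of_all _ (abs_increment_le hXK j))
  have he : (fun ω => g ω * drift 𝒢 P K X j ω) =ᵐ[P] P[g * fun ω => X (j + 1) ω - X j ω | 𝒢 j] := by
    refine EventuallyEq.trans ?_ (condExp_mul_of_stronglyMeasurable_left hg.stronglyMeasurable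
      hgi hi).symm
    filter_upwards [hb] with ω hω
    have h2 := abs_le.mp hω
    rw [Pi.mul_apply, drift, min_eq_right h2.2, max_eq_right h2.1]
  calc ∫ ω, g ω * innov 𝒢 P K X j ω ∂P
      = ∫ ω, ((g * fun ω => X (j + 1) ω - X j ω) ω - g ω * drift 𝒢 P K X j ω) ∂P := by
        refine integral_congr_ae (ae_of_all _ fun ω => ?_)
        simp only [innov, Pi.mul_apply]
        ring
    _ = 0 := by
        rw [integral_sub hgi hgd, integral_congr_ae he, integral_condExp, sub_self]

/-- Squares are counted while their sum is below `c`; the last one overshoots by at most `(2 * K) ^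
2`. -/
lemma sum_quadVar_lt_le (hXK : ∀ j ω, |X j ω| ≤ K) {c : ℝ} (hc : 0 ≤ c) (n : ℕ) (ω : Ω) :
    ∑ i ∈ Finset.range n, (if quadVar X i ω < c then 1 else 0) * (X (i + 1) ω - X i ω) ^ 2 ≤
      c + 4 * K ^ 2 := by
  have hsq : ∀ j, (X (j + 1) ω - X j ω) ^ 2 ≤ 4 * K ^ 2 := fun j => by
    have := abs_increment_le hXK j ω
    rw [← sq_abs]
    nlinarith [abs_nonneg (X (j + 1) ω - X j ω)]
  suffices h : ∀ n, ∑ i ∈ Finset.range n, (if quadVar X i ω < c then 1 else 0) *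
      (X (i + 1) ω - X i ω) ^ 2 ≤ if quadVar X n ω < c then quadVar X n ω else c + 4 * K ^ 2 by
    refine (h n).trans ?_
    split_ifs with h1
    · nlinarith [sq_nonneg K]
    · exact le_rfl
  intro n
  induction n with
  | zero =>
    simp only [Finset.range_zero, Finset.sum_empty]
    split_ifs
    · exact quadVar_nonneg _ _
    · positivity
  | succ n ih =>
    rw [Finset.sum_range_succ]
    have h1 := quadVar_succ (X := X) n ω
    have h2 := hsq n
    have h3 := sq_nonneg (X (n + 1) ω - X n ω)
    split_ifs at ih ⊢ with h4 h5 h6 <;> linarith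

/-- Transforms of the martingale part, up to the time when the quadratic variation exceeds `c`, are
bounded in `L²`. -/
lemma integral_sq_sum_innov_le [IsProbabilityMeasure P] (hK : 0 ≤ K)
    (hX : ∀ j, Measurable[𝒢 j] (X j)) (hXK : ∀ j ω, |X j ω| ≤ K) {c : ℝ} (hc : 0 ≤ c)
    {u : ℕ → Ω → ℝ} (hu : ∀ j, Measurable[𝒢 j] (u j))
    (huc : ∀ j ω, |u j ω| ≤ if quadVar X j ω < c then 1 else 0) (n : ℕ) :
    ∫ ω, (∑ i ∈ Finset.range n, u i ω * innov 𝒢 P K X i ω) ^ 2 ∂P ≤ c + 4 * K ^ 2 := by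
  have hXm : ∀ j, Measurable (X j) := fun j => (hX j).mono (𝒢.le j) le_rfl
  have hum : ∀ j, Measurable (u j) := fun j => (hu j).mono (𝒢.le j) le_rfl
  have hqm : ∀ j, Measurable (quadVar X j) := fun j => (measurable_quadVar hX j).mono (𝒢.le j) le_rfl
  have hmm : ∀ j, Measurable (innov 𝒢 P K X j) := fun j =>
    (measurable_innov hX j).mono (𝒢.le _) le_rfl
  have hdm : ∀ j, Measurable (drift 𝒢 P K X j) := fun j =>
    (measurable_drift j).mono (𝒢.le _) le_rfl
  have hu1 : ∀ j ω, |u j ω| ≤ 1 := fun j ω => (huc j ω).trans (by split_ifs <;> norm_num)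
  set q : ℕ → Ω → ℝ := fun j ω => (if quadVar X j ω < c then 1 else 0) * (X (j + 1) ω - X j ω) ^ 2
    with hq
  have hqmeas : ∀ j, Measurable (q j) := fun j =>
    (Measurable.ite (measurableSet_lt (hqm j) measurable_const) measurable_const
      measurable_const).mul (((hXm _).sub (hXm _)).pow_const 2)
  have hqi : ∀ j, Integrable (q j) P := fun j => by
    refine integrable_of_abs_le (C := (2 * K) ^ 2) (hqmeas j) fun ω => ?_
    simp only [hq]
    rw [abs_mul, abs_pow]
    have h1 := pow_le_pow_left₀ (abs_nonneg _) (abs_increment_le hXK j ω) 2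
    have h2 : |(if quadVar X j ω < c then 1 else 0 : ℝ)| ≤ 1 := by split_ifs <;> norm_num
    calc _ ≤ 1 * |X (j + 1) ω - X j ω| ^ 2 := mul_le_mul_of_nonneg_right h2 (by positivity)
      _ ≤ _ := by rwa [one_mul]
  have hterm : ∀ j, ∫ ω, (u j ω * innov 𝒢 P K X j ω) ^ 2 ∂P ≤ ∫ ω, q j ω ∂P := by
    intro j
    have hA : Integrable (fun ω => (u j ω * innov 𝒢 P K X j ω) ^ 2) P := by
      refine integrable_of_abs_le (C := (1 * (4 * K)) ^ 2) (((hum j).mul (hmm j)).pow_const 2)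
        fun ω => ?_
      rw [abs_pow, abs_mul]
      exact pow_le_pow_left₀ (by positivity) (mul_le_mul (hu1 j ω) (abs_innov_le hK hXK j ω)
        (abs_nonneg _) zero_le_one) 2
    have hB : Integrable (fun ω => 2 * u j ω ^ 2 * drift 𝒢 P K X j ω * innov 𝒢 P K X j ω) P := by
      refine integrable_of_abs_le (C := 2 * 1 ^ 2 * (2 * K) * (4 * K))
        (((((hum j).pow_const 2).const_mul 2).mul (hdm j)).mul (hmm j)) fun ω => ?_
      rw [abs_mul, abs_mul, abs_mul, abs_pow, abs_two]
      have := hu1 j ω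
      have := abs_drift_le (𝒢 := 𝒢) (P := P) (X := X) hK j ω
      have := abs_innov_le (𝒢 := 𝒢) (P := P) hK hXK j ω
      gcongr
    have h0 : ∫ ω, 2 * u j ω ^ 2 * drift 𝒢 P K X j ω * innov 𝒢 P K X j ω ∂P = 0 := by
      refine integral_mul_innov (c := 2 * 1 ^ 2 * (2 * K)) hK hX hXK
        ((((hu j).pow_const 2).const_mul 2).mul (measurable_drift j)) fun ω => ?_
      rw [abs_mul, abs_mul, abs_pow, abs_two]
      have := hu1 j ω
      have := abs_drift_le (𝒢 := 𝒢) (P := P) (X := X) hK j ω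
      gcongr
    -- Adding the vanishing mixed term completes the square to `(u * (innov + drift)) ^ 2`, up to
    -- the nonnegative term `(u * drift) ^ 2`.
    rw [← add_zero (∫ ω, (u j ω * innov 𝒢 P K X j ω) ^ 2 ∂P), ← h0, ← integral_add hA hB]
    refine integral_mono (hA.add hB) (hqi j) fun ω => ?_
    have h1 : u j ω ^ 2 ≤ if quadVar X j ω < c then 1 else 0 := by
      rw [← sq_abs]
      have := huc j ω
      split_ifs at this ⊢ with h2
      · nlinarith [abs_nonneg (u j ω)]
      · nlinarith [abs_nonneg (u j ω)]
    have h2 : X (j + 1) ω - X j ω = innov 𝒢 P K X j ω + drift 𝒢 P K X j ω := by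
      rw [innov]; ring
    simp only [hq, h2]
    have h3 := mul_le_mul_of_nonneg_right h1
      (sq_nonneg (innov 𝒢 P K X j ω + drift 𝒢 P K X j ω))
    nlinarith [sq_nonneg (u j ω * drift 𝒢 P K X j ω)]
  have hUm : ∀ n, Measurable[𝒢 n] fun ω => ∑ i ∈ Finset.range n, u i ω * innov 𝒢 P K X i ω := by
    intro n
    refine Finset.measurable_sum _ fun i hi => ?_
    have h := Finset.mem_range.mp hi
    exact ((hu i).mono (𝒢.mono h.le) le_rfl).mul ((measurable_innov hX i).mono (𝒢.mono h) le_rfl)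
  have hUb : ∀ n ω, |∑ i ∈ Finset.range n, u i ω * innov 𝒢 P K X i ω| ≤ n * (4 * K) := by
    intro n ω
    refine (Finset.abs_sum_le_sum_abs _ _).trans ((Finset.sum_le_sum (g := fun _ => 4 * K)
      fun i _ => ?_).trans (by simp))
    rw [abs_mul]
    have := mul_le_mul (hu1 i ω) (abs_innov_le (𝒢 := 𝒢) (P := P) hK hXK i ω) (abs_nonneg _)
      zero_le_one
    linarith
  -- Martingale differences are orthogonal, so second moments add up.
  have hsq : ∀ n, ∫ ω, (∑ i ∈ Finset.range n, u i ω * innov 𝒢 P K X i ω) ^ 2 ∂P ≤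
      ∑ i ∈ Finset.range n, ∫ ω, q i ω ∂P := by
    intro n
    induction n with
    | zero => simp
    | succ n ih =>
      set U : Ω → ℝ := fun ω => ∑ i ∈ Finset.range n, u i ω * innov 𝒢 P K X i ω with hU
      have hUm' : Measurable U := (hUm n).mono (𝒢.le n) le_rfl
      have h1 : Integrable (fun ω => U ω ^ 2) P :=
        integrable_of_abs_le (C := (n * (4 * K)) ^ 2) (hUm'.pow_const 2) fun ω => by
          rw [abs_pow]; exact pow_le_pow_left₀ (abs_nonneg _) (hUb n ω) 2
      have h2 : Integrable (fun ω => 2 * U ω * u n ω * innov 𝒢 P K X n ω) P := by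
        refine integrable_of_abs_le (C := 2 * (n * (4 * K)) * 1 * (4 * K))
          (((hUm'.const_mul 2).mul (hum n)).mul (hmm n)) fun ω => ?_
        rw [abs_mul, abs_mul, abs_mul, abs_two]
        have := hUb n ω
        have := hu1 n ω
        have := abs_innov_le (𝒢 := 𝒢) (P := P) hK hXK n ω
        gcongr
      have h3 : Integrable (fun ω => (u n ω * innov 𝒢 P K X n ω) ^ 2) P := by
        refine integrable_of_abs_le (C := (1 * (4 * K)) ^ 2) (((hum n).mul (hmm n)).pow_const 2)
          fun ω => ?_
        rw [abs_pow, abs_mul]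
        exact pow_le_pow_left₀ (by positivity) (mul_le_mul (hu1 n ω) (abs_innov_le hK hXK n ω)
          (abs_nonneg _) zero_le_one) 2
      have h0 : ∫ ω, 2 * U ω * u n ω * innov 𝒢 P K X n ω ∂P = 0 := by
        refine integral_mul_innov (c := 2 * (n * (4 * K)) * 1) hK hX hXK
          (((hUm n).const_mul 2).mul (hu n)) fun ω => ?_
        rw [abs_mul, abs_mul, abs_two]
        have := hUb n ω
        have := hu1 n ω
        gcongr
      have h4 : (fun ω => (∑ i ∈ Finset.range (n + 1), u i ω * innov 𝒢 P K X i ω) ^ 2) =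
          fun ω => U ω ^ 2 + 2 * U ω * u n ω * innov 𝒢 P K X n ω +
            (u n ω * innov 𝒢 P K X n ω) ^ 2 := by
        ext ω
        rw [Finset.sum_range_succ]
        simp only [hU]
        ring
      have h12 : Integrable (fun ω => U ω ^ 2 + 2 * U ω * u n ω * innov 𝒢 P K X n ω) P := h1.add h2
      rw [h4, integral_add h12 h3, integral_add h1 h2, h0, add_zero, Finset.sum_range_succ]
      exact add_le_add ih (hterm n)
  refine (hsq n).trans ?_
  rw [← integral_finsetSum _ fun i _ => hqi i]
  calc ∫ ω, ∑ i ∈ Finset.range n, q i ω ∂P ≤ ∫ _, (c + 4 * K ^ 2) ∂P :=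
        integral_mono (integrable_finsetSum _ fun i _ => hqi i) (integrable_const _)
          fun ω => sum_quadVar_lt_le hXK hc n ω
    _ = _ := by simp

/-- Stopping a sum when it falls below `-L`. -/
lemma sum_stop_below {w : ℕ → ℝ} {L b : ℝ} (hL : 0 < L) (hw : ∀ i, |w i| ≤ b)
    {β : ℕ → ℝ} (hβ1 : ∀ i, (∀ l ≤ i, -L < ∑ k ∈ Finset.range l, w k) → β i = 1)
    (hβ0 : ∀ i, (¬ ∀ l ≤ i, -L < ∑ k ∈ Finset.range l, w k) → β i = 0) (n : ℕ) :
    ((∀ l ≤ n, -L < ∑ k ∈ Finset.range l, w k) →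
      ∑ i ∈ Finset.range n, β i * w i = ∑ i ∈ Finset.range n, w i) ∧
    ((¬ ∀ l ≤ n, -L < ∑ k ∈ Finset.range l, w k) →
      -L - b ≤ ∑ i ∈ Finset.range n, β i * w i ∧ ∑ i ∈ Finset.range n, β i * w i ≤ -L) := by
  induction n with
  | zero => simp [hL]
  | succ n ih =>
    rw [Finset.sum_range_succ]
    by_cases h : ∀ l ≤ n, -L < ∑ k ∈ Finset.range l, w k
    · rw [ih.1 h, hβ1 n h, one_mul, ← Finset.sum_range_succ]
      refine ⟨fun _ => rfl, fun h2 => ?_⟩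
      have h3 : ∑ k ∈ Finset.range (n + 1), w k ≤ -L := by
        by_contra h4
        refine h2 fun l hl => ?_
        rcases Nat.le_succ_iff.mp hl with h5 | rfl
        · exact h l h5
        · exact not_le.mp h4
      refine ⟨?_, h3⟩
      rw [Finset.sum_range_succ]
      linarith [h n le_rfl, (abs_le.mp (hw n)).1]
    · rw [hβ0 n h, zero_mul, add_zero]
      refine ⟨fun h2 => absurd (fun l hl => h2 l (hl.trans (Nat.le_succ n))) h, fun _ => ih.2 h⟩

end Discrete

/-! ### Quadratic variation and drift are bounded in probability. -/

section DriftVariation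

variable {T : ℝ≥0} {Ω : Type*} {mΩ : MeasurableSpace Ω} {𝓕 : Filtration (Time T) mΩ}
  {P : Measure Ω}

/-- The filtration along the points of a grid. -/
noncomputable def gridFiltration (𝓕 : Filtration (Time T) mΩ) (n : ℕ) : Filtration ℕ mΩ where
  seq j := 𝓕 (gridPt n j)
  mono' _ _ h := 𝓕.mono (gridPt_mono n h)
  le' _ := 𝓕.le _

/-- The variation of the drift up to the time when the quadratic variation exceeds `c`. -/
noncomputable def driftVar {Ω : Type*} {mΩ : MeasurableSpace Ω} (𝒢 : Filtration ℕ mΩ)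
    (P : Measure Ω) (K : ℝ) (X : ℕ → Ω → ℝ) (c : ℝ) (j : ℕ) (ω : Ω) : ℝ :=
  ∑ i ∈ Finset.range j, (if quadVar X i ω < c then 1 else 0) * |drift 𝒢 P K X i ω|

variable [IsProbabilityMeasure P] {Z : Time T → Ω → ℝ} {K : ℝ}

/-- Since `-2 x (y - x) = (y - x)² - y² + x²`, holding `-2Z` earns the quadratic variation up to a
term of size `K ^ 2`, and never loses more than `K ^ 2`, even between grid points. -/
lemma exists_quadVar_bound (hZ : ∀ t, Measurable[𝓕 t] (Z t))
    (hZK : ∀ t ω, |Z t ω| ≤ K) (hb : BoundedGridGains 𝓕 P Z) {ε : ℝ} (hε : 0 < ε) :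
    ∃ c : ℝ, 0 < c ∧ ∀ n, P.real {ω | c ≤ quadVar (fun j => Z (gridPt n j)) (2 ^ n) ω} ≤ ε := by
  obtain ⟨c, hc⟩ := hb (2 * K) (K ^ 2) ε hε
  have hZ2 : ∀ t ω, Z t ω ^ 2 ≤ K ^ 2 := fun t ω => by
    rw [← sq_abs]; exact pow_le_pow_left₀ (abs_nonneg _) (hZK t ω) 2
  have hid : ∀ n J ω, ∑ i ∈ Finset.range J, -2 * Z (gridPt n i) ω *
      (Z (gridPt n (i + 1)) ω - Z (gridPt n i) ω) =
      quadVar (fun j => Z (gridPt n j)) J ω - Z (gridPt n J) ω ^ 2 + Z (gridPt n 0) ω ^ 2 := by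
    intro n J ω
    induction J with
    | zero => simp [quadVar]
    | succ J ih =>
      rw [Finset.sum_range_succ, ih, quadVar_succ]
      ring
  refine ⟨max 1 (c + K ^ 2), by positivity, fun n => (measureReal_mono fun ω hω => ?_).trans
    (hc n (fun j ω => -2 * Z (gridPt n j) ω) (fun j => (hZ _).const_mul _) (fun j ω => ?_)
      fun ω t => ?_)⟩
  · have h1 : max 1 (c + K ^ 2) ≤ quadVar (fun j => Z (gridPt n j)) (2 ^ n) ω := hω
    show c ≤ _
    rw [hid]
    have := hZ2 (gridPt n (2 ^ n)) ω
    nlinarith [le_max_right 1 (c + K ^ 2), sq_nonneg (Z (gridPt n 0) ω)]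
  · rw [abs_mul, abs_neg, abs_two]
    linarith [hZK (gridPt n j) ω]
  · obtain ⟨J, -, hJ⟩ := exists_sum_grid n t
    rw [hJ (fun j => -2 * Z (gridPt n j) ω) fun t => Z t ω, hid]
    nlinarith [hZ2 t ω, sq_nonneg (Z t ω - Z (gridPt n J) ω), sq_nonneg (Z (gridPt n 0) ω),
      quadVar_nonneg (X := fun j => Z (gridPt n j)) J ω]

/-- The sign of the drift, held while the quadratic variation is below `c`, earns the variation of
the drift plus a martingale transform `W` bounded in `L²`. Closing the position once `W` falls to
`-L` bounds the losses and is unlikely to happen for large `L`. -/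
lemma exists_driftVar_bound (hZ : ∀ t, Measurable[𝓕 t] (Z t)) (hK : 0 ≤ K)
    (hZK : ∀ t ω, |Z t ω| ≤ K) (hb : BoundedGridGains 𝓕 P Z) {c : ℝ} (hc : 0 ≤ c) {ε : ℝ}
    (hε : 0 < ε) : ∃ C : ℝ, 0 < C ∧ ∀ n, P.real {ω | C ≤ driftVar (gridFiltration 𝓕 n) P K
      (fun j => Z (gridPt n j)) c (2 ^ n) ω} ≤ ε := by
  classical
  obtain ⟨L, hL, hL2⟩ : ∃ L : ℝ, 0 < L ∧ (c + 4 * K ^ 2) / L ^ 2 ≤ ε / 2 := by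
    have h : Tendsto (fun L : ℝ => (c + 4 * K ^ 2) / L ^ 2) atTop (𝓝 0) :=
      tendsto_const_nhds.div_atTop (tendsto_pow_atTop two_ne_zero)
    obtain ⟨L, h1, h2⟩ := ((h.eventually_le_const (half_pos hε)).and (eventually_gt_atTop 0)).exists
    exact ⟨L, h2, h1⟩
  -- The loss allowance consists of `L`, an overshoot by one innovation of at most `4 * K`, and `2 *
  -- K` for the interval in progress.
  obtain ⟨c₁, hc₁⟩ := hb 1 (L + 6 * K) (ε / 2) (half_pos hε)
  refine ⟨max 1 (c₁ + L), by positivity, fun n => ?_⟩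
  set 𝒢 := gridFiltration 𝓕 n
  set X : ℕ → Ω → ℝ := fun j => Z (gridPt n j) with hXdef
  have hX : ∀ j, Measurable[𝒢 j] (X j) := fun j => hZ _
  have hXK : ∀ j ω, |X j ω| ≤ K := fun j ω => hZK _ ω
  set h : ℕ → Ω → ℝ := fun i ω => (if quadVar X i ω < c then 1 else 0) *
    (if 0 ≤ drift 𝒢 P K X i ω then 1 else -1) with hh
  have hhm : ∀ i, Measurable[𝒢 i] (h i) := fun i =>
    (Measurable.ite (measurableSet_lt (measurable_quadVar hX i) measurable_const) measurable_const
      measurable_const).mul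
    (Measurable.ite (measurableSet_le measurable_const (measurable_drift i)) measurable_const
      measurable_const)
  have hhc : ∀ i ω, |h i ω| ≤ if quadVar X i ω < c then 1 else 0 := fun i ω => by
    simp only [hh]
    split_ifs <;> norm_num
  have hh1 : ∀ i ω, |h i ω| ≤ 1 := fun i ω => (hhc i ω).trans (by split_ifs <;> norm_num)
  have hha : ∀ i ω, h i ω * drift 𝒢 P K X i ω =
      (if quadVar X i ω < c then 1 else 0) * |drift 𝒢 P K X i ω| := fun i ω => by
    simp only [hh]
    split_ifs with h1 h2 h2
    · rw [abs_of_nonneg h2]; ring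
    · rw [abs_of_neg (not_le.mp h2)]; ring
    · ring
    · ring
  set W : ℕ → Ω → ℝ := fun l ω => ∑ k ∈ Finset.range l, h k ω * innov 𝒢 P K X k ω with hW
  have hWm : ∀ l, Measurable[𝒢 l] (W l) := fun l => Finset.measurable_sum _ fun k hk => by
    have := Finset.mem_range.mp hk
    exact ((hhm k).mono (𝒢.mono this.le) le_rfl).mul
      ((measurable_innov hX k).mono (𝒢.mono this) le_rfl)
  set β : ℕ → Ω → ℝ := fun i ω => if ∀ l ≤ i, -L < W l ω then 1 else 0 with hβ
  have hβm : ∀ i, Measurable[𝒢 i] (β i) := fun i => by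
    refine Measurable.ite ?_ measurable_const measurable_const
    have : {ω | ∀ l ≤ i, -L < W l ω} = ⋂ l, ⋂ (_ : l ≤ i), {ω | -L < W l ω} := by ext; simp
    rw [this]
    exact MeasurableSet.iInter fun l => MeasurableSet.iInter fun hl =>
      measurableSet_lt measurable_const ((hWm l).mono (𝒢.mono hl) le_rfl)
  have hβ01 : ∀ i ω, 0 ≤ β i ω ∧ β i ω ≤ 1 := fun i ω => by
    simp only [hβ]; split_ifs <;> norm_num
  set U : ℕ → Ω → ℝ := fun j ω => ∑ i ∈ Finset.range j, (β i ω * h i ω) * innov 𝒢 P K X i ω with hU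
  have hβh : ∀ i ω, |β i ω * h i ω| ≤ |h i ω| := fun i ω => by
    rw [abs_mul, abs_of_nonneg (hβ01 i ω).1]
    exact mul_le_of_le_one_left (abs_nonneg _) (hβ01 i ω).2
  have hstopped := fun ω j => sum_stop_below (w := fun i => h i ω * innov 𝒢 P K X i ω) (b := 4 * K) hL
    (fun i => by
      rw [abs_mul]
      have := mul_le_mul (hh1 i ω) (abs_innov_le (𝒢 := 𝒢) (P := P) hK hXK i ω) (abs_nonneg _)
        zero_le_one
      linarith)
    (β := fun i => β i ω) (fun i hi => if_pos hi) (fun i hi => if_neg hi) j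
  have hUeq : ∀ ω j, ∑ i ∈ Finset.range j, β i ω * (h i ω * innov 𝒢 P K X i ω) = U j ω := fun ω j =>
    Finset.sum_congr rfl fun i _ => (mul_assoc _ _ _).symm
  simp only [hUeq] at hstopped
  have hUlow : ∀ ω j, -L - 4 * K ≤ U j ω := by
    intro ω j
    by_cases h1 : ∀ l ≤ j, -L < W l ω
    · rw [(hstopped ω j).1 h1]
      linarith [h1 j le_rfl]
    · exact ((hstopped ω j).2 h1).1
  have hsplit : ∀ ω j, ∑ i ∈ Finset.range j, (β i ω * h i ω) * (X (i + 1) ω - X i ω) =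
      U j ω + ∑ i ∈ Finset.range j, β i ω * ((if quadVar X i ω < c then 1 else 0) *
        |drift 𝒢 P K X i ω|) := by
    intro ω j
    rw [hU, ← Finset.sum_add_distrib]
    refine Finset.sum_congr rfl fun i _ => ?_
    rw [← hha, innov]
    ring
  have hsq := integral_sq_sum_innov_le (P := P) hK hX hXK hc
    (u := fun i ω => β i ω * h i ω) (fun i => (hβm i).mul (hhm i))
    (fun i ω => (hβh i ω).trans (hhc i ω)) (2 ^ n)
  have hUmeas : Measurable (U (2 ^ n)) := Finset.measurable_sum _ fun i _ =>
    (((hβm i).mul (hhm i)).mono (𝒢.le i) le_rfl).mul ((measurable_innov hX i).mono (𝒢.le _) le_rfl)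
  have hUi : Integrable (fun ω => U (2 ^ n) ω ^ 2) P := by
    refine integrable_of_abs_le (C := (∑ i ∈ Finset.range (2 ^ n), 1 * (4 * K)) ^ 2)
      (hUmeas.pow_const 2) fun ω => ?_
    rw [abs_pow]
    refine pow_le_pow_left₀ (abs_nonneg _) ((Finset.abs_sum_le_sum_abs _ _).trans
      (Finset.sum_le_sum fun i _ => ?_)) 2
    rw [abs_mul]
    exact mul_le_mul ((hβh i ω).trans (hh1 i ω)) (abs_innov_le hK hXK i ω) (abs_nonneg _)
      zero_le_one
  -- After stopping, `U` remains at or below `-L`, so its final value detects the crossing and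
  -- Chebyshev replaces a maximal inequality.
  have hcheb : P.real {ω | L ^ 2 ≤ U (2 ^ n) ω ^ 2} ≤ ε / 2 := by
    refine le_trans ?_ hL2
    rw [le_div_iff₀ (by positivity), mul_comm]
    exact (mul_meas_ge_le_integral_of_nonneg (ae_of_all _ fun ω => sq_nonneg _) hUi _).trans hsq
  have hgain := hc₁ n (fun i ω => β i ω * h i ω) (fun i => (hβm i).mul (hhm i))
    (fun i ω => (hβh i ω).trans (hh1 i ω)) fun ω t => by
      obtain ⟨J, -, hJ⟩ := exists_sum_grid n t
      rw [hJ (fun i => β i ω * h i ω) fun t => Z t ω]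
      have h1 := hsplit ω J
      have h2 : 0 ≤ ∑ i ∈ Finset.range J, β i ω * ((if quadVar X i ω < c then 1 else 0) *
        |drift 𝒢 P K X i ω|) := Finset.sum_nonneg fun i _ => mul_nonneg (hβ01 i ω).1
          (mul_nonneg (by split_ifs <;> norm_num) (abs_nonneg _))
      have h3 : |β J ω * h J ω * (Z t ω - Z (gridPt n J) ω)| ≤ 2 * K := by
        rw [abs_mul]
        have h4 := abs_sub (Z t ω) (Z (gridPt n J) ω)
        have h5 := mul_le_mul ((hβh J ω).trans (hh1 J ω)) le_rfl
          (abs_nonneg (Z t ω - Z (gridPt n J) ω)) zero_le_one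
        linarith [hZK t ω, hZK (gridPt n J) ω]
      have h6 := (abs_le.mp h3).1
      have h7 := hUlow ω J
      simp only [hXdef] at h1 h2
      linarith
  refine (measureReal_mono (?_ : _ ⊆ {ω | c₁ ≤ ∑ j ∈ Finset.range (2 ^ n), β j ω * h j ω *
    (Z (gridPt n (j + 1)) ω - Z (gridPt n j) ω)} ∪ {ω | L ^ 2 ≤ U (2 ^ n) ω ^ 2})).trans
      ((measureReal_union_le _ _).trans (by linarith))
  intro ω hω
  by_cases h1 : ∀ l ≤ 2 ^ n, -L < W l ω
  · left
    have h2 : max 1 (c₁ + L) ≤ driftVar 𝒢 P K X c (2 ^ n) ω := hω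
    have h3 := hsplit ω (2 ^ n)
    rw [(hstopped ω (2 ^ n)).1 h1] at h3
    have h4 : ∑ i ∈ Finset.range (2 ^ n), β i ω * ((if quadVar X i ω < c then 1 else 0) *
        |drift 𝒢 P K X i ω|) = driftVar 𝒢 P K X c (2 ^ n) ω := by
      refine Finset.sum_congr rfl fun i hi => ?_
      have : β i ω = 1 := if_pos fun l hl => h1 l (hl.trans (Finset.mem_range.mp hi).le)
      rw [this, one_mul]
    show c₁ ≤ _
    have h5 := h1 (2 ^ n) le_rfl
    simp only [hXdef, hW] at h3 h4 h2 h5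
    linarith [le_max_right 1 (c₁ + L)]
  · right
    have h2 := ((hstopped ω (2 ^ n)).2 h1).2
    show L ^ 2 ≤ U (2 ^ n) ω ^ 2
    nlinarith

end DriftVariation

/-! ### Decomposition of the killed process on one grid. -/

section GridSemimartingale

variable {T : ℝ≥0} {Ω : Type*} {mΩ : MeasurableSpace Ω} {𝓕 : Filtration (Time T) mΩ}
  {P : Measure Ω}

/-- A decomposition of the process `Y` on a set `D` of times into a martingale `N` bounded by `C`
and a remainder whose variation is controlled by that of `v`, with values in `[0, C]`. -/
structure IsGridSemimartingale (𝓕 : Filtration (Time T) mΩ) (P : Measure Ω) (D : Set (Time T))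
    (C : ℝ) (Y N v : Time T → Ω → ℝ) : Prop where
  measurable : ∀ t ∈ D, Measurable[𝓕 t] (N t)
  abs_le : ∀ t ∈ D, ∀ ω, |N t ω| ≤ C
  integral_mul_sub : ∀ s ∈ D, ∀ t ∈ D, s ≤ t → ∀ (g : Ω → ℝ) (c : ℝ), Measurable[𝓕 s] g →
    (∀ ω, |g ω| ≤ c) → ∫ ω, g ω * (N t ω - N s ω) ∂P = 0
  nonneg : ∀ t ∈ D, ∀ ω, 0 ≤ v t ω
  le : ∀ t ∈ D, ∀ ω, v t ω ≤ C
  abs_sub_le : ∀ s ∈ D, ∀ t ∈ D, s ≤ t → ∀ ω,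
    |(Y t ω - N t ω) - (Y s ω - N s ω)| ≤ v t ω - v s ω

lemma IsGridSemimartingale.mono {D D' : Set (Time T)} {C : ℝ} {Y N v : Time T → Ω → ℝ}
    (h : IsGridSemimartingale 𝓕 P D C Y N v) (hD : D' ⊆ D) :
    IsGridSemimartingale 𝓕 P D' C Y N v where
  measurable t ht := h.measurable t (hD ht)
  abs_le t ht := h.abs_le t (hD ht)
  integral_mul_sub s hs t ht := h.integral_mul_sub s (hD hs) t (hD ht)
  nonneg t ht := h.nonneg t (hD ht)
  le t ht := h.le t (hD ht)
  abs_sub_le s hs t ht := h.abs_sub_le s (hD hs) t (hD ht)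

/-- Convex combinations. -/
lemma IsGridSemimartingale.sum [IsProbabilityMeasure P] {ι : Type*} {s : Finset ι} {w : ι → ℝ}
    (hw : ∀ i ∈ s, 0 ≤ w i) (hw1 : ∑ i ∈ s, w i = 1) {D : Set (Time T)} {C : ℝ}
    {Y N v : ι → Time T → Ω → ℝ}
    (h : ∀ i ∈ s, IsGridSemimartingale 𝓕 P D C (Y i) (N i) (v i)) :
    IsGridSemimartingale 𝓕 P D C (fun t ω => ∑ i ∈ s, w i * Y i t ω)
      (fun t ω => ∑ i ∈ s, w i * N i t ω) (fun t ω => ∑ i ∈ s, w i * v i t ω) where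
  measurable t ht := Finset.measurable_sum _ fun i hi => ((h i hi).measurable t ht).const_mul _
  abs_le t ht ω := by
    refine (Finset.abs_sum_le_sum_abs _ _).trans
      ((Finset.sum_le_sum (g := fun i => w i * C) fun i hi => ?_).trans ?_)
    · rw [abs_mul, abs_of_nonneg (hw i hi)]
      exact mul_le_mul_of_nonneg_left ((h i hi).abs_le t ht ω) (hw i hi)
    · rw [← Finset.sum_mul, hw1, one_mul]
  integral_mul_sub r hr t ht hrt g c hg hgc := by
    have h1 : ∀ ω, g ω * (∑ i ∈ s, w i * N i t ω - ∑ i ∈ s, w i * N i r ω) =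
        ∑ i ∈ s, w i * (g ω * (N i t ω - N i r ω)) := fun ω => by
      rw [← Finset.sum_sub_distrib, Finset.mul_sum]
      exact Finset.sum_congr rfl fun i _ => by ring
    simp_rw [h1]
    rw [integral_finsetSum]
    · refine Finset.sum_eq_zero fun i hi => ?_
      rw [integral_const_mul, (h i hi).integral_mul_sub r hr t ht hrt g c hg hgc, mul_zero]
    · intro i hi
      refine Integrable.const_mul (integrable_of_abs_le (C := c * (C + C)) ?_ fun ω => ?_) _
      · exact (hg.mono (𝓕.le r) le_rfl).mul ((((h i hi).measurable t ht).mono (𝓕.le t) le_rfl).sub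
          (((h i hi).measurable r hr).mono (𝓕.le r) le_rfl))
      · rw [abs_mul]
        exact mul_le_mul (hgc ω) ((abs_sub _ _).trans (add_le_add ((h i hi).abs_le t ht ω)
          ((h i hi).abs_le r hr ω))) (abs_nonneg _) ((abs_nonneg _).trans (hgc ω))
  nonneg t ht ω := Finset.sum_nonneg fun i hi => mul_nonneg (hw i hi) ((h i hi).nonneg t ht ω)
  le t ht ω := by
    refine (Finset.sum_le_sum (g := fun i => w i * C) fun i hi => ?_).trans ?_
    · exact mul_le_mul_of_nonneg_left ((h i hi).le t ht ω) (hw i hi)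
    · rw [← Finset.sum_mul, hw1, one_mul]
  abs_sub_le r hr t ht hrt ω := by
    have h1 : (∑ i ∈ s, w i * Y i t ω - ∑ i ∈ s, w i * N i t ω) -
        (∑ i ∈ s, w i * Y i r ω - ∑ i ∈ s, w i * N i r ω) =
        ∑ i ∈ s, w i * ((Y i t ω - N i t ω) - (Y i r ω - N i r ω)) := by
      simp only [← Finset.sum_sub_distrib]
      exact Finset.sum_congr rfl fun i _ => by ring
    rw [h1, ← Finset.sum_sub_distrib]
    refine (Finset.abs_sum_le_sum_abs _ _).trans (Finset.sum_le_sum fun i hi => ?_)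
    rw [abs_mul, abs_of_nonneg (hw i hi), ← mul_sub]
    exact mul_le_mul_of_nonneg_left ((h i hi).abs_sub_le r hr t ht hrt ω) (hw i hi)

lemma gridPt_gridIdx {n : ℕ} {t : Time T} (h : t ∈ gridSet T n) : gridPt n (gridIdx n t) = t :=
  gridCeil_eq_self h

/-- A decomposition in discrete time gives a decomposition on a grid. -/
lemma isGridSemimartingale_of_nat [IsProbabilityMeasure P] {n : ℕ} {C : ℝ} {Y : Time T → Ω → ℝ}
    {x N v : ℕ → Ω → ℝ} (hY : ∀ t ∈ gridSet T n, ∀ ω, Y t ω = x (gridIdx n t) ω)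
    (hNm : ∀ j, Measurable[𝓕 (gridPt n j)] (N j)) (hNC : ∀ j ω, |N j ω| ≤ C)
    (horth : ∀ (j : ℕ) (g : Ω → ℝ) (c : ℝ), Measurable[𝓕 (gridPt n j)] g → (∀ ω, |g ω| ≤ c) →
      ∫ ω, g ω * (N (j + 1) ω - N j ω) ∂P = 0)
    (hv0 : ∀ j ω, 0 ≤ v j ω) (hvC : ∀ j ω, v j ω ≤ C)
    (hB : ∀ j ω, |(x (j + 1) ω - N (j + 1) ω) - (x j ω - N j ω)| ≤ v (j + 1) ω - v j ω) :
    IsGridSemimartingale 𝓕 P (gridSet T n) C Y (fun t => N (gridIdx n t))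
      (fun t => v (gridIdx n t)) where
  measurable t ht := by
    have := hNm (gridIdx n t)
    rwa [gridPt_gridIdx ht] at this
  abs_le _ _ _ := hNC _ _
  integral_mul_sub s hs t _ hst g c hg hgc := by
    have hNm' : ∀ j, Measurable (N j) := fun j => (hNm j).mono (𝓕.le _) le_rfl
    have hg' : Measurable g := hg.mono (𝓕.le _) le_rfl
    have hint : ∀ j, Integrable (fun ω => g ω * N j ω) P := fun j => by
      refine integrable_of_abs_le (C := c * C) (hg'.mul (hNm' j)) fun ω => ?_
      rw [abs_mul]
      exact mul_le_mul (hgc ω) (hNC j ω) (abs_nonneg _) ((abs_nonneg _).trans (hgc ω))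
    simp_rw [mul_sub]
    rw [integral_sub (hint _) (hint _), sub_eq_zero]
    have hidx := gridIdx_mono n hst
    generalize gridIdx n t = k at hidx
    induction k, hidx using Nat.le_induction with
    | base => rfl
    | succ j hj ih =>
      rw [← ih, ← sub_eq_zero, ← integral_sub (hint _) (hint _)]
      simp_rw [← mul_sub]
      refine horth j g c (hg.mono (𝓕.mono ?_) le_rfl) hgc
      rw [← gridPt_gridIdx hs]
      exact gridPt_mono n hj
  nonneg _ _ _ := hv0 _ _
  le _ _ _ := hvC _ _
  abs_sub_le s hs t ht hst ω := by
    have hidx := gridIdx_mono n hst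
    have key : ∀ i j, i ≤ j → |(x j ω - N j ω) - (x i ω - N i ω)| ≤ v j ω - v i ω := by
      intro i j hij
      induction hij with
      | refl => simp
      | @step j _ ih =>
        have := hB j ω
        have h1 := abs_add_le ((x (j + 1) ω - N (j + 1) ω) - (x j ω - N j ω))
          ((x j ω - N j ω) - (x i ω - N i ω))
        rw [sub_add_sub_cancel] at h1
        exact h1.trans (by linarith)
    rw [hY s hs, hY t ht]
    exact key _ _ hidx

variable [IsProbabilityMeasure P] {Z : Time T → Ω → ℝ} {K : ℝ}

omit [IsProbabilityMeasure P] in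
lemma driftVar_succ {𝒢 : Filtration ℕ mΩ} {X : ℕ → Ω → ℝ} {c : ℝ} (j : ℕ) (ω : Ω) :
    driftVar 𝒢 P K X c (j + 1) ω = driftVar 𝒢 P K X c j ω +
      (if quadVar X j ω < c then 1 else 0) * |drift 𝒢 P K X j ω| := Finset.sum_range_succ _ _

omit [IsProbabilityMeasure P] in
lemma driftVar_mono {𝒢 : Filtration ℕ mΩ} {X : ℕ → Ω → ℝ} {c : ℝ} (ω : Ω) :
    Monotone fun j => driftVar 𝒢 P K X c j ω :=
  monotone_nat_of_le_succ fun j => by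
    rw [driftVar_succ]
    exact le_add_of_nonneg_right (mul_nonneg (by split_ifs <;> norm_num) (abs_nonneg _))

omit [IsProbabilityMeasure P] in
lemma measurable_driftVar {𝒢 : Filtration ℕ mΩ} {X : ℕ → Ω → ℝ} {c : ℝ}
    (hX : ∀ j, Measurable[𝒢 j] (X j)) (j : ℕ) :
    Measurable[𝒢 j] (driftVar 𝒢 P K X c (j + 1)) :=
  Finset.measurable_sum _ fun i hi => by
    have h := 𝒢.mono (Nat.lt_succ_iff.mp (Finset.mem_range.mp hi))
    refine (Measurable.ite (measurableSet_lt ((measurable_quadVar hX i).mono h le_rfl)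
      measurable_const) measurable_const measurable_const).mul ?_
    exact (measurable_abs : Measurable fun x : ℝ => |x|).comp ((measurable_drift i).mono h le_rfl)

/-- If the gains from trading at grid times are bounded in probability, then on every grid there is a
decomposition of the process killed at a late time. -/
theorem exists_isGridSemimartingale (hZ : ∀ t, Measurable[𝓕 t] (Z t)) (hK : 0 ≤ K)
    (hZK : ∀ t ω, |Z t ω| ≤ K) (hb : BoundedGridGains 𝓕 P Z) {ε : ℝ} (hε : 0 < ε) :
    ∃ C : ℝ, 0 < C ∧ ∀ n, ∃ α N v : Time T → Ω → ℝ,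
      (∀ t ∈ gridSet T n, Measurable[𝓕 t] (α t)) ∧ (∀ t ω, 0 ≤ α t ω ∧ α t ω ≤ 1) ∧
      (∀ ω, Antitone fun t => α t ω) ∧ P.real {ω | α ⊤ ω ≠ 1} ≤ ε ∧
      IsGridSemimartingale 𝓕 P (gridSet T n) C (fun t ω => α t ω * Z t ω) N v := by
  classical
  obtain ⟨c, hc, hcP⟩ := exists_quadVar_bound hZ hZK hb (half_pos hε)
  obtain ⟨C, hC, hCP⟩ := exists_driftVar_bound hZ hK hZK hb hc.le (half_pos hε)
  refine ⟨5 * K + C, by positivity, fun n => ?_⟩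
  set 𝒢 := gridFiltration 𝓕 n
  set X : ℕ → Ω → ℝ := fun j => Z (gridPt n j) with hXdef
  have hX : ∀ j, Measurable[𝒢 j] (X j) := fun j => hZ _
  have hXK : ∀ j ω, |X j ω| ≤ K := fun j ω => hZK _ ω
  set V := driftVar 𝒢 P K X c with hV
  -- The drift variation up to `j + 1` is known at `j`, so `α` is adapted. The margin `2 * K` bounds
  -- one drift term: if the variation up to `2 ^ n` is below `C`, the additional term does not kill.
  set α : ℕ → Ω → ℝ := fun j ω => if quadVar X j ω < c ∧ V (j + 1) ω < C + 2 * K then 1 else 0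
    with hα
  have hα01 : ∀ j ω, 0 ≤ α j ω ∧ α j ω ≤ 1 := fun j ω => by
    simp only [hα]; split_ifs <;> norm_num
  have hαm : ∀ j, Measurable[𝒢 j] (α j) := fun j =>
    Measurable.ite ((measurableSet_lt (measurable_quadVar hX j) measurable_const).inter
      (measurableSet_lt (measurable_driftVar hX j) measurable_const)) measurable_const
      measurable_const
  have hαanti : ∀ ω, Antitone fun j => α j ω := fun ω i j hij => by
    have h1 := quadVar_mono (X := X) ω hij
    have h2 := driftVar_mono (𝒢 := 𝒢) (P := P) (K := K) (X := X) (c := c) ω (Nat.succ_le_succ hij)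
    simp only [hα]
    split_ifs with h3 h4
    · exact le_rfl
    · exact absurd ⟨h1.trans_lt h3.1, h2.trans_lt h3.2⟩ h4
    · exact zero_le_one
    · exact le_rfl
  set d : ℕ → Ω → ℝ := fun j ω => ∑ i ∈ Finset.range j, α i ω * |drift 𝒢 P K X i ω| with hd
  have hdC : ∀ j ω, d j ω ≤ C + 2 * K := by
    intro j ω
    have hle : ∀ j, d j ω ≤ V j ω := fun j => Finset.sum_le_sum fun i _ => by
      refine mul_le_mul_of_nonneg_right ?_ (abs_nonneg _)
      simp only [hα]
      split_ifs with h1 h2 h2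
      · exact le_rfl
      · exact absurd h1.1 h2
      · exact zero_le_one
      · exact le_rfl
    induction j with
    | zero => simp only [hd, Finset.range_zero, Finset.sum_empty]; positivity
    | succ j ih =>
      by_cases h1 : quadVar X j ω < c ∧ V (j + 1) ω < C + 2 * K
      · exact (hle _).trans h1.2.le
      · have : α j ω = 0 := if_neg h1
        simp only [hd] at ih ⊢
        rw [Finset.sum_range_succ, this, zero_mul, add_zero]
        exact ih
  have hd0 : ∀ j ω, 0 ≤ d j ω := fun j ω =>
    Finset.sum_nonneg fun i _ => mul_nonneg (hα01 i ω).1 (abs_nonneg _)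
  set N : ℕ → Ω → ℝ := fun j ω => ∑ i ∈ Finset.range j, α i ω * innov 𝒢 P K X i ω with hN
  -- The first term pays for the jump to zero at killing, the second for the drift.
  set v : ℕ → Ω → ℝ := fun j ω => K * (1 - α j ω) + d j ω with hv
  have hB : ∀ j ω, |(α (j + 1) ω * X (j + 1) ω - N (j + 1) ω) - (α j ω * X j ω - N j ω)| ≤
      v (j + 1) ω - v j ω := by
    intro j ω
    have e1 : (α (j + 1) ω * X (j + 1) ω - N (j + 1) ω) - (α j ω * X j ω - N j ω) =
        -((α j ω - α (j + 1) ω) * X (j + 1) ω) + α j ω * drift 𝒢 P K X j ω := by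
      simp only [hN, Finset.sum_range_succ, innov]
      ring
    have e2 : v (j + 1) ω - v j ω = (α j ω - α (j + 1) ω) * K + α j ω * |drift 𝒢 P K X j ω| := by
      simp only [hv, hd, Finset.sum_range_succ]
      ring
    rw [e1, e2]
    refine (abs_add_le _ _).trans (add_le_add ?_ ?_)
    · rw [abs_neg, abs_mul, abs_of_nonneg (sub_nonneg.mpr (hαanti ω (Nat.le_succ j)))]
      exact mul_le_mul_of_nonneg_left (hXK _ ω) (sub_nonneg.mpr (hαanti ω (Nat.le_succ j)))
    · rw [abs_mul, abs_of_nonneg (hα01 j ω).1]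
  have hv0 : ∀ j ω, 0 ≤ v j ω := fun j ω =>
    add_nonneg (mul_nonneg hK (sub_nonneg.mpr (hα01 j ω).2)) (hd0 j ω)
  have hvC : ∀ j ω, v j ω ≤ C + 3 * K := fun j ω => by
    have := mul_le_mul_of_nonneg_left (show 1 - α j ω ≤ 1 by linarith [(hα01 j ω).1]) hK
    simp only [hv]
    linarith [hdC j ω]
  have hαX : ∀ j ω, |α j ω * X j ω| ≤ K := fun j ω => by
    rw [abs_mul, abs_of_nonneg (hα01 j ω).1]
    exact (mul_le_of_le_one_left (abs_nonneg _) (hα01 j ω).2).trans (hXK j ω)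
  -- The remainder moves by at most `C + 3 * K` and the killed process is bounded by `K` at both
  -- ends, so the martingale part is bounded pathwise.
  have hNC : ∀ j ω, |N j ω| ≤ 5 * K + C := by
    intro j ω
    have key : |(α j ω * X j ω - N j ω) - α 0 ω * X 0 ω| ≤ v j ω - v 0 ω := by
      induction j with
      | zero => simp [hN]
      | succ j ih =>
        have := abs_add_le ((α (j + 1) ω * X (j + 1) ω - N (j + 1) ω) - (α j ω * X j ω - N j ω))
          ((α j ω * X j ω - N j ω) - α 0 ω * X 0 ω)
        rw [sub_add_sub_cancel] at this
        linarith [hB j ω]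
    have h1 := abs_le.mp key
    have h2 := abs_le.mp (hαX j ω)
    have h3 := abs_le.mp (hαX 0 ω)
    exact abs_le.mpr ⟨by linarith [hvC j ω, hv0 0 ω], by linarith [hvC j ω, hv0 0 ω]⟩
  refine ⟨fun t => α (gridIdx n t), fun t => N (gridIdx n t), fun t => v (gridIdx n t), ?_,
    fun t ω => hα01 _ _, fun ω => (hαanti ω).comp_monotone (gridIdx_mono n), ?_, ?_⟩
  · intro t ht
    have : Measurable[𝓕 (gridPt n (gridIdx n t))] (α (gridIdx n t)) := hαm (gridIdx n t)
    rwa [gridPt_gridIdx ht] at this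
  · refine (measureReal_mono (?_ : _ ⊆ {ω | c ≤ quadVar X (2 ^ n) ω} ∪
      {ω | C ≤ V (2 ^ n) ω})).trans ((measureReal_union_le _ _).trans
        (by linarith [hcP n, hCP n]))
    intro ω hω
    by_contra h
    rw [Set.mem_union, not_or] at h
    have h1 : quadVar X (2 ^ n) ω < c := not_le.mp h.1
    have h2 : V (2 ^ n) ω < C := not_le.mp h.2
    refine hω (le_antisymm (hα01 _ _).2 (le_trans (le_of_eq ?_) (hαanti ω (gridIdx_le n ⊤))))
    have h3 := driftVar_succ (𝒢 := 𝒢) (P := P) (K := K) (X := X) (c := c) (2 ^ n) ω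
    rw [if_pos h1, one_mul] at h3
    have h4 := abs_drift_le (𝒢 := 𝒢) (P := P) (X := X) hK (2 ^ n) ω
    exact (if_pos ⟨h1, by simp only [hV] at h2 ⊢; linarith⟩).symm
  · refine isGridSemimartingale_of_nat (x := fun j ω => α j ω * X j ω) (fun t ht ω => ?_)
      (fun j => ?_) hNC (fun j g b hg hgb => ?_) hv0 (fun j ω => by linarith [hvC j ω]) hB
    · simp only [hXdef, gridPt_gridIdx ht]
    · refine Finset.measurable_sum _ fun i hi => ?_
      have h := Finset.mem_range.mp hi
      exact ((hαm i).mono (𝒢.mono h.le) le_rfl).mul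
        ((measurable_innov hX i).mono (𝒢.mono h) le_rfl)
    · have h1 : ∀ ω, g ω * (N (j + 1) ω - N j ω) = (g ω * α j ω) * innov 𝒢 P K X j ω := fun ω => by
        simp only [hN, Finset.sum_range_succ]
        ring
      simp_rw [h1]
      refine integral_mul_innov (c := b) hK hX hXK (Measurable.mul hg (hαm j)) fun ω => ?_
      rw [abs_mul, abs_of_nonneg (hα01 j ω).1]
      exact (mul_le_of_le_one_right (abs_nonneg _) (hα01 j ω).2).trans (hgb ω)

end GridSemimartingale

/-! ### Convergent convex combinations of bounded sequences. -/

section ConvexCombinations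

/-- A bounded sequence in a Hilbert space has convex combinations of its tails converging quickly. -/
theorem exists_convexCombination_norm_sub_le {E : Type*} [NormedAddCommGroup E]
    [InnerProductSpace ℝ E] [CompleteSpace E] {x : ℕ → E} {R : ℝ} (hx : ∀ n, ‖x n‖ ≤ R) {e : ℕ → ℝ}
    (he : ∀ n, 0 < e n) :
    ∃ (w : ℕ → ℕ →₀ ℝ) (y : E), (∀ n i, 0 ≤ w n i) ∧ (∀ n, ∀ i < n, w n i = 0) ∧
      (∀ n, ∑ i ∈ (w n).support, w n i = 1) ∧
      ∀ n, ‖∑ i ∈ (w n).support, w n i • x i - y‖ ≤ e n := by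
  set A : ℕ → Set (ℕ →₀ ℝ) := fun n => {w | (∀ i, 0 ≤ w i) ∧ (∀ i < n, w i = 0) ∧
    Finsupp.linearCombination ℝ (fun _ : ℕ => (1 : ℝ)) w = 1} with hA
  set F := Finsupp.linearCombination ℝ x with hF
  have hAanti : ∀ {m n : ℕ}, m ≤ n → A n ⊆ A m := fun hmn w hw =>
    ⟨hw.1, fun i hi => hw.2.1 i (hi.trans_le hmn), hw.2.2⟩
  have hsingle : ∀ n, Finsupp.single n 1 ∈ A n := fun n =>
    ⟨fun i => by rw [Finsupp.single_apply]; split_ifs <;> norm_num,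
      fun i hi => Finsupp.single_eq_of_ne (by omega), by simp⟩
  have hmid : ∀ {n} {v w : ℕ →₀ ℝ}, v ∈ A n → w ∈ A n → (1 / 2 : ℝ) • (v + w) ∈ A n := by
    rintro n v w ⟨h1, h2, h3⟩ ⟨h4, h5, h6⟩
    refine ⟨fun i => ?_, fun i hi => ?_, ?_⟩
    · simp only [Finsupp.smul_apply, Finsupp.add_apply, smul_eq_mul]
      have := h1 i; have := h4 i; positivity
    · simp [h2 i hi, h5 i hi]
    · rw [map_smul, map_add, h3, h6]; norm_num
  -- The least squared norm over the `n`-th tail increases in `n` and is bounded. Midpoints of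
  -- near-minimizers stay in the earlier tail, so the parallelogram law makes near-minimizers
  -- Cauchy.
  set a : ℕ → ℝ := fun n => sInf ((fun w => ‖F w‖ ^ 2) '' A n) with ha
  have hbdd : ∀ n, BddBelow ((fun w => ‖F w‖ ^ 2) '' A n) := fun n =>
    ⟨0, by rintro _ ⟨w, -, rfl⟩; positivity⟩
  have hne : ∀ n, ((fun w => ‖F w‖ ^ 2) '' A n).Nonempty := fun n => ⟨_, _, hsingle n, rfl⟩
  have hamono : Monotone a := fun m n hmn =>
    csInf_le_csInf (hbdd m) (hne n) (Set.image_mono (hAanti hmn))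
  have haR : ∀ n, a n ≤ R ^ 2 := fun n => by
    refine (csInf_le (hbdd n) ⟨_, hsingle n, rfl⟩).trans ?_
    simp only [hF, Finsupp.linearCombination_single, one_smul]
    exact pow_le_pow_left₀ (norm_nonneg _) (hx n) 2
  have hlim := tendsto_atTop_ciSup hamono ⟨R ^ 2, by rintro _ ⟨n, rfl⟩; exact haR n⟩
  set L := ⨆ n, a n
  have haL : ∀ n, a n ≤ L := fun n => le_ciSup (f := a) ⟨R ^ 2, by rintro _ ⟨n, rfl⟩; exact haR n⟩ n
  have hchoose : ∀ n : ℕ, ∃ w ∈ A n, ‖F w‖ ^ 2 < a n + 1 / ((n : ℝ) + 1) := fun n => by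
    obtain ⟨_, ⟨w, hw, rfl⟩, h⟩ := exists_lt_of_csInf_lt (hne n)
      (show sInf ((fun w => ‖F w‖ ^ 2) '' A n) < a n + 1 / ((n : ℝ) + 1) by
        have : (0 : ℝ) < 1 / ((n : ℝ) + 1) := by positivity
        simp only [ha]; linarith)
    exact ⟨w, hw, h⟩
  choose w hwA hwF using hchoose
  have hdist : ∀ n m, n ≤ m →
      ‖F (w n) - F (w m)‖ ^ 2 ≤ 4 * (L - a n) + 4 * (1 / ((n : ℝ) + 1)) := by
    intro n m hnm
    have h1 := csInf_le (hbdd n) ⟨_, hmid (hwA n) (hAanti hnm (hwA m)), rfl⟩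
    have h2 : ‖F ((1 / 2 : ℝ) • (w n + w m))‖ ^ 2 = ‖F (w n) + F (w m)‖ ^ 2 / 4 := by
      rw [map_smul, map_add, norm_smul, mul_pow]; norm_num; ring
    simp only [h2] at h1
    have h3 := parallelogram_law_with_norm ℝ (F (w n)) (F (w m))
    have h4 : (1 : ℝ) / ((m : ℝ) + 1) ≤ 1 / ((n : ℝ) + 1) := by
      have : (n : ℝ) ≤ m := by exact_mod_cast hnm
      gcongr
    have h5 : a n ≤ ‖F (w n) + F (w m)‖ ^ 2 / 4 := h1
    nlinarith [hwF n, hwF m, haL n, haL m]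
  have hcauchy : CauchySeq fun n => F (w n) := by
    refine Metric.cauchySeq_iff'.mpr fun ε hε => ?_
    have h1 : Tendsto (fun n : ℕ => 4 * (L - a n) + 4 * (1 / ((n : ℝ) + 1))) atTop (𝓝 0) := by
      have := ((tendsto_const_nhds (x := L)).sub hlim).const_mul 4 |>.add
        ((tendsto_one_div_add_atTop_nhds_zero_nat (𝕜 := ℝ)).const_mul 4)
      simpa using this
    obtain ⟨n, hn⟩ := (h1.eventually_lt_const (pow_pos hε 2)).exists
    refine ⟨n, fun m hm => ?_⟩
    rw [dist_comm, dist_eq_norm]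
    exact lt_of_pow_lt_pow_left₀ 2 hε.le ((hdist n m hm).trans_lt hn)
  obtain ⟨y, hy⟩ := cauchySeq_tendsto_of_complete hcauchy
  -- Later combinations still use only the tail from `n`, so any rate can be imposed.
  have hφ : ∀ n, ∃ m, n ≤ m ∧ ‖F (w m) - y‖ ≤ e n := fun n => by
    obtain ⟨m, h1, h2⟩ := ((eventually_ge_atTop n).and
      ((Metric.tendsto_nhds.mp hy) (e n) (he n))).exists
    exact ⟨m, h1, by rw [← dist_eq_norm]; exact h2.le⟩
  choose φ hφn hφy using hφ
  refine ⟨fun n => w (φ n), y, fun n i => (hwA _).1 i,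
    fun n i hi => (hwA _).2.1 i (hi.trans_le (hφn n)), fun n => ?_, fun n => hφy n⟩
  have := (hwA (φ n)).2.2
  simpa [Finsupp.linearCombination_apply, Finsupp.sum] using this

variable {Ω : Type*} {mΩ : MeasurableSpace Ω} {P : Measure Ω}

lemma ae_tendsto_zero_of_integral_abs_le {h : ℕ → Ω → ℝ} (hi : ∀ n, Integrable (h n) P)
    (hh : ∀ n, ∫ ω, |h n ω| ∂P ≤ (1 / 2) ^ n) : ∀ᵐ ω ∂P, Tendsto (fun n => h n ω) atTop (𝓝 0) := by
  have h1 : ∀ n, ∫⁻ ω, ‖h n ω‖ₑ ∂P ≤ ENNReal.ofReal ((1 / 2) ^ n) := fun n => by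
    rw [← ofReal_integral_norm_eq_lintegral_enorm (hi n)]
    exact ENNReal.ofReal_le_ofReal (hh n)
  have h2 : ∫⁻ ω, ∑' n, ‖h n ω‖ₑ ∂P ≠ ∞ := by
    rw [lintegral_tsum fun n => (hi n).1.enorm]
    refine ne_top_of_le_ne_top ?_ (ENNReal.tsum_le_tsum h1)
    rw [← ENNReal.ofReal_tsum_of_nonneg (fun n => by positivity) summable_geometric_two]
    exact ENNReal.ofReal_ne_top
  filter_upwards [ae_lt_top' (AEMeasurable.tsum fun n => (hi n).1.enorm) h2] with ω hω
  have h3 := ENNReal.tendsto_atTop_zero_of_tsum_ne_top hω.ne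
  exact tendsto_zero_iff_enorm_tendsto_zero.mpr h3

/-- Convex combinations of the tails of a bounded sequence of random variables converging quickly. -/
theorem exists_convexCombination_integral_le [IsProbabilityMeasure P] {f : ℕ → Ω → ℝ} {C : ℝ}
    (hf : ∀ n, Measurable (f n)) (hC : ∀ n ω, |f n ω| ≤ C) :
    ∃ (w : ℕ → ℕ →₀ ℝ) (Y : Ω → ℝ), (∀ n i, 0 ≤ w n i) ∧ (∀ n, ∀ i < n, w n i = 0) ∧
      (∀ n, ∑ i ∈ (w n).support, w n i = 1) ∧ Measurable Y ∧ Integrable Y P ∧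
      ∀ n, ∫ ω, |∑ i ∈ (w n).support, w n i * f i ω - Y ω| ∂P ≤ (1 / 2) ^ n := by
  have hmem : ∀ n, MemLp (f n) 2 P := fun n =>
    MemLp.of_bound (hf n).aestronglyMeasurable C (ae_of_all _ (hC n))
  obtain ⟨w, y, h0, h1, h2, h3⟩ := exists_convexCombination_norm_sub_le
    (x := fun n => (hmem n).toLp (f n)) (R := |C|) (fun n => by
      refine (Lp.norm_le_of_ae_bound (C := |C|) (abs_nonneg _) ?_).trans (by simp [measureUnivNNReal])
      filter_upwards [(hmem n).coeFn_toLp] with ω hω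
      rw [hω]
      exact (hC n ω).trans (le_abs_self C)) (e := fun n => (1 / 2) ^ n) (fun n => by positivity)
  refine ⟨w, y, h0, h1, h2, (Lp.stronglyMeasurable y).measurable, (Lp.memLp y).integrable (by norm_num), fun n => ?_⟩
  have hmeas : MemLp (fun ω => ∑ i ∈ (w n).support, w n i * f i ω - y ω) 2 P :=
    (memLp_finsetSum _ fun i _ => (hmem i).const_mul (w n i)).sub (Lp.memLp y)
  have e1 : (∑ i ∈ (w n).support, w n i • (hmem i).toLp (f i)) - y = hmeas.toLp _ := by
    refine Lp.ext ?_
    have h4 := Lp.coeFn_sub (∑ i ∈ (w n).support, w n i • (hmem i).toLp (f i)) y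
    have h5 : ∀ i, ⇑(w n i • (hmem i).toLp (f i)) =ᵐ[P] fun ω => w n i * f i ω := fun i => by
      filter_upwards [Lp.coeFn_smul (w n i) ((hmem i).toLp (f i)), (hmem i).coeFn_toLp] with ω h6 h7
      rw [h6, Pi.smul_apply, h7, smul_eq_mul]
    have h8 := Lp.coeFn_finsetSum (w n).support fun i => w n i • (hmem i).toLp (f i)
    filter_upwards [h4, h8, ae_all_iff.mpr h5, hmeas.coeFn_toLp] with ω a b c d
    rw [a, Pi.sub_apply, b, d, Finset.sum_apply]
    simp only [c]
  have e2 := h3 n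
  rw [e1, Lp.norm_toLp] at e2
  have e3 : eLpNorm (fun ω => ∑ i ∈ (w n).support, w n i * f i ω - y ω) 1 P ≤
      eLpNorm (fun ω => ∑ i ∈ (w n).support, w n i * f i ω - y ω) 2 P :=
    eLpNorm_le_eLpNorm_of_exponent_le (by norm_num) hmeas.1
  have e4 := (ENNReal.toReal_mono hmeas.eLpNorm_ne_top e3).trans e2
  rw [eLpNorm_one_eq_lintegral_enorm, ← integral_norm_eq_lintegral_enorm hmeas.1] at e4
  exact e4

end ConvexCombinations

/-! ### One stopping time for all fine grids. -/

section StoppedGridSemimartingale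

variable {T : ℝ≥0} {Ω : Type*} {mΩ : MeasurableSpace Ω} {𝓕 : Filtration (Time T) mΩ}
  {P : Measure Ω} [IsProbabilityMeasure P] {Z : Time T → Ω → ℝ} {K : ℝ}

/-- If `a` is beyond the `j`-th grid point, its rounding is at least the next one, so the whole
interval is traversed before stopping. -/
lemma stopAt_map_gridCeil_of_lt {n j : ℕ} {a : WithTop (Time T)} (h : ↑(gridPt n j : Time T) < a) :
    stopAt (gridPt n j) (a.map (gridCeil n)) = gridPt n j ∧
      stopAt (gridPt n (j + 1)) (a.map (gridCeil n)) = gridPt n (j + 1) := by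
  suffices h1 : ↑(gridPt n (j + 1) : Time T) ≤ a.map (gridCeil n) from
    ⟨stopAt_of_le ((WithTop.coe_le_coe.mpr (gridPt_mono n (Nat.le_succ j))).trans h1),
      stopAt_of_le h1⟩
  cases a with
  | top => simp
  | coe r =>
    rw [WithTop.map_coe, WithTop.coe_le_coe]
    refine gridPt_mono n (Nat.succ_le_of_lt ?_)
    by_contra h2
    exact absurd (WithTop.coe_lt_coe.mp h)
      (not_lt.mpr ((le_gridCeil n r).trans (gridPt_mono n (not_lt.mp h2))))

lemma stopAt_map_gridCeil_of_le {n i j : ℕ} {a : WithTop (Time T)}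
    (h : a ≤ ↑(gridPt n j : Time T)) (hij : j ≤ i) :
    stopAt (gridPt n i) (a.map (gridCeil n)) = stopAt (gridPt n j) (a.map (gridCeil n)) := by
  lift a to Time T using (h.trans_lt (WithTop.coe_lt_top _)).ne
  have h1 := gridCeil_le_of_le (WithTop.coe_le_coe.mp h)
  rw [WithTop.map_coe, stopAt_coe, stopAt_coe, min_eq_right h1,
    min_eq_right (h1.trans (gridPt_mono n hij))]

/-- Dividing by `R` before `R` falls below `1/2`. -/
lemma IsGridSemimartingale.div_of_half_le {n : ℕ} {C : ℝ} {R N v : Time T → Ω → ℝ} (hK : 0 ≤ K)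
    (hZK : ∀ t ω, |Z t ω| ≤ K)
    (h : IsGridSemimartingale 𝓕 P (gridSet T n) C (fun t ω => R t ω * Z t ω) N v)
    (hRm : ∀ t ∈ gridSet T n, Measurable[𝓕 t] (R t)) (hR01 : ∀ t ω, R t ω ≤ 1)
    (hRanti : ∀ ω, Antitone fun t => R t ω) {ρ : Ω → WithTop (Time T)} (hρ : IsStoppingTime 𝓕 ρ)
    (hRρ : ∀ t ∈ gridSet T n, ∀ ω, ↑t < ρ ω → 1 / 2 ≤ R t ω) (hR0 : ∀ t ω, 0 ≤ R t ω) :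
    ∃ N' v', IsGridSemimartingale 𝓕 P (gridSet T n) (2 * C + 4 * K)
      (fun t ω => Z (stopAt t ((ρ ω).map (gridCeil n))) ω) N' v' := by
  classical
  -- The new martingale is the transform of `N` by `1 / R` before `ρ`, where this factor is at most
  -- `2`.
  set u : ℕ → Ω → ℝ := fun j ω => (if ↑(gridPt n j : Time T) < ρ ω then 1 else 0) *
    (R (gridPt n j) ω)⁻¹ with hu
  have hum : ∀ j, Measurable[𝓕 (gridPt n j)] (u j) := fun j =>
    (Measurable.ite (hρ.measurableSet_gt _) measurable_const measurable_const).mul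
      (hRm _ (gridPt_mem n j)).inv
  have hu02 : ∀ j ω, 0 ≤ u j ω ∧ u j ω ≤ 2 := fun j ω => by
    simp only [hu]
    split_ifs with h1
    · have := hRρ _ (gridPt_mem n j) ω h1
      refine ⟨by rw [one_mul]; exact inv_nonneg.mpr (hR0 _ _), ?_⟩
      rw [one_mul, inv_le_comm₀ (by linarith) two_pos]
      linarith
    · simp
  set x : ℕ → Ω → ℝ := fun j ω => Z (stopAt (gridPt n j) ((ρ ω).map (gridCeil n))) ω with hx
  set M : ℕ → Ω → ℝ := fun J ω => ∑ j ∈ Finset.range J,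
    u j ω * (N (gridPt n (j + 1)) ω - N (gridPt n j) ω) with hM
  set V : ℕ → Ω → ℝ := fun j ω => 2 * (v (gridPt n j) ω + K * (1 - R (gridPt n j) ω)) with hV
  have hB : ∀ j ω, |(x (j + 1) ω - M (j + 1) ω) - (x j ω - M j ω)| ≤ V (j + 1) ω - V j ω := by
    intro j ω
    have hRle := hRanti ω (gridPt_mono n (Nat.le_succ j))
    have hBj := h.abs_sub_le _ (gridPt_mem n j) _ (gridPt_mem n (j + 1))
      (gridPt_mono n (Nat.le_succ j)) ω
    have hKR : |Z (gridPt n (j + 1)) ω * (R (gridPt n j) ω - R (gridPt n (j + 1)) ω)| ≤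
        K * (R (gridPt n j) ω - R (gridPt n (j + 1)) ω) := by
      rw [abs_mul, abs_of_nonneg (sub_nonneg.mpr hRle)]
      exact mul_le_mul_of_nonneg_right (hZK _ _) (sub_nonneg.mpr hRle)
    -- Discrete product rule: the increment of `R * Z` differs from `R` times that of `Z` by a term
    -- paid for by the decrease of `R`.
    have e1 : (x (j + 1) ω - M (j + 1) ω) - (x j ω - M j ω) = u j ω *
        (((R (gridPt n (j + 1)) ω * Z (gridPt n (j + 1)) ω - N (gridPt n (j + 1)) ω) -
          (R (gridPt n j) ω * Z (gridPt n j) ω - N (gridPt n j) ω)) +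
          Z (gridPt n (j + 1)) ω * (R (gridPt n j) ω - R (gridPt n (j + 1)) ω)) := by
      simp only [hM, Finset.sum_range_succ, hx, hu]
      by_cases h1 : ↑(gridPt n j : Time T) < ρ ω
      · have h2 := hRρ _ (gridPt_mem n j) ω h1
        have h3 : R (gridPt n j) ω ≠ 0 := by linarith
        rw [(stopAt_map_gridCeil_of_lt h1).1, (stopAt_map_gridCeil_of_lt h1).2, if_pos h1]
        field_simp
        ring
      · rw [stopAt_map_gridCeil_of_le (not_lt.mp h1) (Nat.le_succ j), if_neg h1]
        ring
    rw [e1, abs_mul, abs_of_nonneg (hu02 j ω).1]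
    have h4 := abs_add_le ((R (gridPt n (j + 1)) ω * Z (gridPt n (j + 1)) ω -
      N (gridPt n (j + 1)) ω) - (R (gridPt n j) ω * Z (gridPt n j) ω - N (gridPt n j) ω))
      (Z (gridPt n (j + 1)) ω * (R (gridPt n j) ω - R (gridPt n (j + 1)) ω))
    have h5 := mul_le_mul_of_nonneg_right (hu02 j ω).2 (abs_nonneg
      (((R (gridPt n (j + 1)) ω * Z (gridPt n (j + 1)) ω - N (gridPt n (j + 1)) ω) -
          (R (gridPt n j) ω * Z (gridPt n j) ω - N (gridPt n j) ω)) +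
          Z (gridPt n (j + 1)) ω * (R (gridPt n j) ω - R (gridPt n (j + 1)) ω)))
    simp only [hV]
    linarith
  have hV0 : ∀ j ω, 0 ≤ V j ω := fun j ω => mul_nonneg zero_le_two (add_nonneg
    (h.nonneg _ (gridPt_mem n j) ω) (mul_nonneg hK (sub_nonneg.mpr (hR01 _ _))))
  have hVC : ∀ j ω, V j ω ≤ 2 * C + 2 * K := fun j ω => by
    have h1 := h.le _ (gridPt_mem n j) ω
    have h2 := mul_le_mul_of_nonneg_left (show 1 - R (gridPt n j) ω ≤ 1 by
      linarith [hR0 (gridPt n j) ω]) hK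
    simp only [hV]
    linarith
  have hMC : ∀ j ω, |M j ω| ≤ 2 * C + 4 * K := by
    intro j ω
    have key : |(x j ω - M j ω) - x 0 ω| ≤ V j ω - V 0 ω := by
      induction j with
      | zero => simp [hM]
      | succ j ih =>
        have := abs_add_le ((x (j + 1) ω - M (j + 1) ω) - (x j ω - M j ω)) ((x j ω - M j ω) - x 0 ω)
        rw [sub_add_sub_cancel] at this
        linarith [hB j ω]
    have h1 := _root_.abs_le.mp key
    have h2 : |x j ω| ≤ K := hZK _ _
    have h3 : |x 0 ω| ≤ K := hZK _ _
    have h2 := _root_.abs_le.mp h2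
    have h3 := _root_.abs_le.mp h3
    exact _root_.abs_le.mpr ⟨by linarith [hVC j ω, hV0 0 ω], by linarith [hVC j ω, hV0 0 ω]⟩
  refine ⟨_, _, isGridSemimartingale_of_nat (x := x) (N := M) (v := V) (fun t ht ω => ?_)
    (fun j => ?_) hMC (fun j g c hg hgc => ?_) hV0 (fun j ω => by linarith [hVC j ω]) hB⟩
  · simp only [hx, gridPt_gridIdx ht]
  · refine Finset.measurable_sum _ fun i hi => ?_
    have hi' := Finset.mem_range.mp hi
    have hN := fun k => h.measurable _ (gridPt_mem n k)
    exact ((hum i).mono (𝓕.mono (gridPt_mono n hi'.le)) le_rfl).mul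
      (((hN (i + 1)).mono (𝓕.mono (gridPt_mono n hi')) le_rfl).sub
        ((hN i).mono (𝓕.mono (gridPt_mono n hi'.le)) le_rfl))
  · have h1 : ∀ ω, g ω * (M (j + 1) ω - M j ω) =
        (g ω * u j ω) * (N (gridPt n (j + 1)) ω - N (gridPt n j) ω) := fun ω => by
      simp only [hM, Finset.sum_range_succ]
      ring
    simp_rw [h1]
    refine h.integral_mul_sub _ (gridPt_mem n j) _ (gridPt_mem n (j + 1))
      (gridPt_mono n (Nat.le_succ j)) _ (c * 2) (hg.mul (hum j)) fun ω => ?_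
    rw [abs_mul, abs_of_nonneg (hu02 j ω).1]
    exact mul_le_mul (hgc ω) (hu02 j ω).2 (hu02 j ω).1 ((abs_nonneg _).trans (hgc ω))

/-- The first time that one of the processes falls below `1/2` on its grid. -/
lemma exists_isStoppingTime_lt_half (h𝓕 : 𝓕.IsRightContinuous) {R : ℕ → Time T → Ω → ℝ}
    (hRm : ∀ n, ∀ t ∈ gridSet T n, Measurable[𝓕 t] (R n t)) (n₀ : ℕ) :
    ∃ ρ : Ω → WithTop (Time T), IsStoppingTime 𝓕 ρ ∧
      (∀ n, n₀ ≤ n → ∀ t ∈ gridSet T n, ∀ ω, ↑t < ρ ω → 1 / 2 ≤ R n t ω) ∧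
      ∀ ω, (∀ n, n₀ ≤ n → ∀ t ∈ gridSet T n, 1 / 2 ≤ R n t ω) → ρ ω = ⊤ := by
  classical
  set τ : ℕ × ℕ → Ω → WithTop (Time T) := fun k ω =>
    if R (n₀ + k.1) (gridPt (n₀ + k.1) k.2) ω < 1 / 2 then ↑(gridPt (n₀ + k.1) k.2 : Time T) else ⊤
    with hτ
  have hτs : ∀ k, IsStoppingTime 𝓕 (τ k) := by
    intro k t
    by_cases h : (gridPt (n₀ + k.1) k.2 : Time T) ≤ t
    · have : {ω | τ k ω ≤ t} = {ω | R (n₀ + k.1) (gridPt (n₀ + k.1) k.2) ω < 1 / 2} := by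
        ext ω
        by_cases h1 : R (n₀ + k.1) (gridPt (n₀ + k.1) k.2) ω < 1 / 2
        · simp only [hτ, Set.mem_ofPred_eq, h1, iff_true, if_true]
          exact WithTop.coe_le_coe.mpr h
        · simp only [hτ, Set.mem_ofPred_eq, h1, iff_false, if_false]
          exact not_le.mpr (WithTop.coe_lt_top t)
      rw [this]
      exact 𝓕.mono h _ (measurableSet_lt (hRm _ _ (gridPt_mem _ _)) measurable_const)
    · have : {ω | τ k ω ≤ t} = ∅ := by
        ext ω
        by_cases h1 : R (n₀ + k.1) (gridPt (n₀ + k.1) k.2) ω < 1 / 2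
        · simp only [hτ, Set.mem_ofPred_eq, h1, if_true, Set.mem_empty_iff_false, iff_false]
          exact mt WithTop.coe_le_coe.mp h
        · simp only [hτ, Set.mem_ofPred_eq, h1, if_false, Set.mem_empty_iff_false, iff_false]
          exact not_le.mpr (WithTop.coe_lt_top t)
      rw [this]
      exact @MeasurableSet.empty _ (𝓕 t)
  obtain ⟨ρ, hρ, hglb⟩ := exists_isStoppingTime_iInf h𝓕 hτs
  refine ⟨ρ, hρ, ?_, fun ω h => ?_⟩
  · rintro n hn _ ⟨j, rfl⟩ ω h
    by_contra h1
    obtain ⟨m, rfl⟩ := Nat.exists_eq_add_of_le hn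
    have h2 : ρ ω ≤ τ (m, j) ω := (hglb ω).1 ⟨(m, j), rfl⟩
    simp only [hτ] at h2
    rw [if_pos (not_le.mp h1)] at h2
    exact absurd h (not_lt.mpr h2)
  · refine top_le_iff.mp ((hglb ω).2 ?_)
    rintro _ ⟨k, rfl⟩
    simp only [hτ]
    rw [if_neg (not_lt.mpr (h _ (Nat.le_add_right _ _) _ (gridPt_mem _ _)))]

/-- If the gains from trading at grid times are bounded in probability, then there is a late stopping
time such that the process stopped shortly after it has uniformly bounded decompositions on all fine
grids. -/
theorem exists_isGridSemimartingale_stop (h𝓕 : 𝓕.IsRightContinuous)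
    (hZ : ∀ t, Measurable[𝓕 t] (Z t)) (hK : 0 ≤ K) (hZK : ∀ t ω, |Z t ω| ≤ K)
    (hb : BoundedGridGains 𝓕 P Z) {ε : ℝ} (hε : 0 < ε) :
    ∃ ρ : Ω → WithTop (Time T), IsStoppingTime 𝓕 ρ ∧ P.real {ω | ρ ω ≠ ⊤} ≤ ε ∧
      ∃ (C : ℝ) (n₀ : ℕ), ∀ n, n₀ ≤ n → ∃ N v, IsGridSemimartingale 𝓕 P (gridSet T n) C
        (fun t ω => Z (stopAt t ((ρ ω).map (gridCeil n))) ω) N v := by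
  -- This gives `E(1 - Y) ≤ ε / 6`, hence probability at most `ε / 2` for `1 - Y ≥ 1 / 3`; the other
  -- half is for `E n₀`.
  have hε' : 0 < ε / 12 := by positivity
  obtain ⟨C, hC, hdec⟩ := exists_isGridSemimartingale hZ hK hZK hb hε'
  choose α N v hαm hα01 hαanti hαP hαN using hdec
  have hαtop : ∀ n, Measurable (α n ⊤) := fun n =>
    (hαm n ⊤ (top_mem_gridSet n)).mono (𝓕.le _) le_rfl
  have hα1 : ∀ n ω, |α n ⊤ ω| ≤ 1 := fun n ω => by
    rw [abs_of_nonneg (hα01 n ⊤ ω).1]; exact (hα01 n ⊤ ω).2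
  obtain ⟨w, Y, hw0, hwn, hw1, hYm, hYi, hY⟩ :=
    exists_convexCombination_integral_le (P := P) hαtop hα1
  set R : ℕ → Time T → Ω → ℝ := fun n t ω => ∑ i ∈ (w n).support, w n i * α i t ω with hR
  have hsupp : ∀ {n i}, i ∈ (w n).support → n ≤ i := fun {n i} hi => by
    by_contra h
    exact (Finsupp.mem_support_iff.mp hi) (hwn n i (not_le.mp h))
  have hRm : ∀ n, ∀ t ∈ gridSet T n, Measurable[𝓕 t] (R n t) := fun n t ht =>
    Finset.measurable_sum _ fun i hi => (hαm i t (gridSet_mono (hsupp hi) ht)).const_mul _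
  have hR0 : ∀ n t ω, 0 ≤ R n t ω := fun n t ω =>
    Finset.sum_nonneg fun i _ => mul_nonneg (hw0 n i) (hα01 i t ω).1
  have hR1 : ∀ n t ω, R n t ω ≤ 1 := fun n t ω => by
    rw [← hw1 n]
    exact Finset.sum_le_sum fun i _ => mul_le_of_le_one_right (hw0 n i) (hα01 i t ω).2
  have hRanti : ∀ n ω, Antitone fun t => R n t ω := fun n ω s t hst =>
    Finset.sum_le_sum fun i _ => mul_le_mul_of_nonneg_left (hαanti i ω hst) (hw0 n i)
  have hRtop : ∀ n, Measurable (R n ⊤) := fun n =>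
    (hRm n ⊤ (top_mem_gridSet n)).mono (𝓕.le _) le_rfl
  have hRi : ∀ n, Integrable (R n ⊤) P := fun n =>
    integrable_of_abs_le (C := 1) (hRtop n) fun ω => by
      rw [abs_of_nonneg (hR0 n ⊤ ω)]; exact hR1 n ⊤ ω
  have hlim : ∀ᵐ ω ∂P, Tendsto (fun n => R n ⊤ ω) atTop (𝓝 (Y ω)) := by
    filter_upwards [ae_tendsto_zero_of_integral_abs_le (fun n => (hRi n).sub hYi) hY] with ω hω
    simpa using hω.add_const (Y ω)
  have hY1 : ∀ᵐ ω ∂P, 0 ≤ 1 - Y ω := by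
    filter_upwards [hlim] with ω hω
    exact sub_nonneg.mpr (le_of_tendsto' hω fun n => hR1 n ⊤ ω)
  have hαint : ∀ n, 1 - ε / 12 ≤ ∫ ω, α n ⊤ ω ∂P := fun n => by
    have hm : MeasurableSet {ω | α n ⊤ ω ≠ 1} := (measurableSet_eq_fun (hαtop n) measurable_const).compl
    have hi : Integrable (α n ⊤) P := integrable_of_abs_le (hαtop n) (hα1 n)
    have h1 : ∫ ω, (1 - α n ⊤ ω) ∂P ≤ ∫ ω, {ω | α n ⊤ ω ≠ 1}.indicator 1 ω ∂P := by
      refine integral_mono ((integrable_const 1).sub hi)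
        ((integrable_const (1 : ℝ)).indicator hm) fun ω => ?_
      by_cases h : α n ⊤ ω = 1
      · simp [h]
      · rw [Set.indicator_of_mem (show ω ∈ {ω | α n ⊤ ω ≠ 1} from h), Pi.one_apply]
        linarith [(hα01 n ⊤ ω).1]
    rw [integral_indicator_one hm, integral_sub (integrable_const 1) hi] at h1
    simp only [integral_const, probReal_univ, one_smul] at h1
    linarith [hαP n]
  have hRint : ∀ n, 1 - ε / 12 ≤ ∫ ω, R n ⊤ ω ∂P := fun n => by
    simp only [hR]
    rw [integral_finsetSum _ fun i _ =>
      (integrable_of_abs_le (hαtop i) (hα1 i)).const_mul _]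
    simp_rw [integral_const_mul]
    calc 1 - ε / 12 = ∑ i ∈ (w n).support, w n i * (1 - ε / 12) := by
          rw [← Finset.sum_mul, hw1, one_mul]
      _ ≤ _ := Finset.sum_le_sum fun i _ => mul_le_mul_of_nonneg_left (hαint i) (hw0 n i)
  have hYint : ∫ ω, (1 - Y ω) ∂P ≤ 2 * (ε / 12) := by
    obtain ⟨n, hn⟩ := exists_pow_lt_of_lt_one hε' (show (1 / 2 : ℝ) < 1 by norm_num)
    have h1 := (integral_mono ((hRi n).sub hYi) ((hRi n).sub hYi).abs fun ω =>
      le_abs_self _).trans ((hY n).trans hn.le)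
    have h2 : ∫ ω, (R n ⊤ - Y) ω ∂P = ∫ ω, R n ⊤ ω ∂P - ∫ ω, Y ω ∂P := integral_sub (hRi n) hYi
    rw [h2] at h1
    rw [integral_sub (integrable_const 1) hYi]
    simp only [integral_const, probReal_univ, one_smul]
    linarith [hRint n]
  have hYP : P.real {ω | 1 / 3 ≤ 1 - Y ω} ≤ ε / 2 := by
    have := mul_meas_ge_le_integral_of_nonneg hY1 ((integrable_const 1).sub hYi) (1 / 3)
    have h2 : ∫ ω, ((fun _ : Ω => (1 : ℝ)) - Y) ω ∂P = ∫ ω, (1 - Y ω) ∂P := rfl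
    linarith
  -- Where `Y > 2 / 3`, almost surely `R k ⊤ < 1 / 2` occurs only finitely often. As `R k` decreases
  -- in time, its value at `T` controls all times.
  set E : ℕ → Set Ω := fun n => (⋃ k, {ω | n ≤ k ∧ R k ⊤ ω < 1 / 2}) ∩ {ω | 1 - Y ω < 1 / 3} with hE
  have hEm : ∀ n, MeasurableSet (E n) := fun n =>
    (MeasurableSet.iUnion fun k => (MeasurableSet.const _).inter
      (measurableSet_lt (hRtop k) measurable_const)).inter
        (measurableSet_lt (measurable_const.sub hYm) measurable_const)
  have hElim := tendsto_measureReal_of_ae_eventually_notMem (P := P) hEm (by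
    filter_upwards [hlim] with ω hω
    by_cases h : 1 - Y ω < 1 / 3
    · obtain ⟨m, hm⟩ := eventually_atTop.mp
        (hω.eventually_const_lt (show 1 / 2 < Y ω by linarith))
      filter_upwards [eventually_ge_atTop m] with n hn
      rintro ⟨h1, -⟩
      obtain ⟨k, hk1, hk2⟩ := Set.mem_iUnion.mp h1
      exact absurd hk2 (not_lt.mpr (hm k (hn.trans hk1)).le)
    · exact Eventually.of_forall fun n hn => h hn.2)
  obtain ⟨n₀, hn₀⟩ := (hElim.eventually_lt_const (half_pos hε)).exists
  obtain ⟨ρ, hρ, hρ1, hρ2⟩ := exists_isStoppingTime_lt_half h𝓕 hRm n₀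
  refine ⟨ρ, hρ, ?_, 2 * C + 4 * K, n₀, fun n hn => ?_⟩
  · refine (measureReal_mono (?_ : _ ⊆ E n₀ ∪ {ω | 1 / 3 ≤ 1 - Y ω})).trans
      ((measureReal_union_le _ _).trans (by linarith))
    intro ω hω
    by_cases h : 1 - Y ω < 1 / 3
    · refine Or.inl ⟨?_, h⟩
      by_contra h1
      refine hω (hρ2 ω fun n hn t ht => ?_)
      by_contra h2
      exact h1 (Set.mem_iUnion.mpr ⟨n, hn, (hRanti n ω le_top).trans_lt (not_le.mp h2)⟩)
    · exact Or.inr (not_lt.mp h)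
  · have hsum := IsGridSemimartingale.sum (P := P) (s := (w n).support) (w := w n)
      (fun i _ => hw0 n i) (hw1 n) fun i hi => (hαN i).mono (gridSet_mono (hsupp hi))
    have he : (fun t ω => ∑ i ∈ (w n).support, w n i * (α i t ω * Z t ω)) =
        fun t ω => R n t ω * Z t ω := by
      ext t ω
      rw [hR, Finset.sum_mul]
      exact Finset.sum_congr rfl fun i _ => (mul_assoc _ _ _).symm
    rw [he] at hsum
    exact hsum.div_of_half_le hK hZK (hRm n) (hR1 n) (hRanti n) hρ (hρ1 n hn) (hR0 n)

end StoppedGridSemimartingale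

/-! ### Passage from grids to continuous time. -/

section Limit

lemma tendsto_convexCombination {w : ℕ → ℕ →₀ ℝ} (hw0 : ∀ n i, 0 ≤ w n i)
    (hwn : ∀ n, ∀ i < n, w n i = 0) (hw1 : ∀ n, ∑ i ∈ (w n).support, w n i = 1) {a : ℕ → ℝ} {l : ℝ}
    (ha : Tendsto a atTop (𝓝 l)) :
    Tendsto (fun n => ∑ i ∈ (w n).support, w n i * a i) atTop (𝓝 l) := by
  refine Metric.tendsto_atTop'.mpr fun ε hε => ?_
  obtain ⟨m, hm⟩ := Metric.tendsto_atTop.mp ha (ε / 2) (half_pos hε)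
  refine ⟨m, fun n hn => ?_⟩
  have h1 : ∑ i ∈ (w n).support, w n i * a i - l = ∑ i ∈ (w n).support, w n i * (a i - l) := by
    simp only [mul_sub, Finset.sum_sub_distrib]
    rw [← Finset.sum_mul, hw1, one_mul]
  rw [Real.dist_eq, h1]
  refine ((Finset.abs_sum_le_sum_abs _ _).trans
    (Finset.sum_le_sum (g := fun i => w n i * (ε / 2)) fun i hi => ?_)).trans_lt ?_
  · rw [abs_mul, abs_of_nonneg (hw0 n i)]
    refine mul_le_mul_of_nonneg_left ?_ (hw0 n i)
    have hni : n ≤ i := by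
      by_contra h
      exact (Finsupp.mem_support_iff.mp hi) (hwn n i (not_le.mp h))
    exact (hm i (hn.le.trans hni)).le
  · rw [← Finset.sum_mul, hw1, one_mul]
    exact half_lt_self hε

variable {T : ℝ≥0} {Ω : Type*} {mΩ : MeasurableSpace Ω} {𝓕 : Filtration (Time T) mΩ}
  {P : Measure Ω} [IsProbabilityMeasure P]

lemma tendsto_stopAt_map_gridCeil {z : Time T → ℝ} (hz : IsCadlagPath z) (t : Time T)
    (a : WithTop (Time T)) :
    Tendsto (fun n => z (stopAt t (a.map (gridCeil n)))) atTop (𝓝 (z (stopAt t a))) := by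
  cases a with
  | top => simp
  | coe r =>
    simp only [WithTop.map_coe, stopAt_coe]
    exact (hz (min t r)).1.tendsto.comp (tendsto_nhdsWithin_iff.mpr
      ⟨tendsto_const_nhds.min (tendsto_gridCeil r),
        Eventually.of_forall fun n => min_le_min_left _ (le_gridCeil n r)⟩)

lemma IsGridSemimartingale.condExp_eq {D : Set (Time T)} {C : ℝ} {Y N v : Time T → Ω → ℝ}
    (h : IsGridSemimartingale 𝓕 P D C Y N v) {s t : Time T} (hs : s ∈ D) (ht : t ∈ D)
    (hst : s ≤ t) : P[N t | 𝓕 s] =ᵐ[P] N s := by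
  have hi : ∀ r ∈ D, Integrable (N r) P := fun r hr =>
    integrable_of_abs_le ((h.measurable r hr).mono (𝓕.le r) le_rfl) (h.abs_le r hr)
  refine (ae_eq_condExp_of_forall_setIntegral_eq (𝓕.le s) (hi t ht)
    (fun A _ _ => (hi s hs).integrableOn) (fun A hA _ => ?_)
    (h.measurable s hs).stronglyMeasurable.aestronglyMeasurable).symm
  have h1 := h.integral_mul_sub s hs t ht hst (A.indicator 1) 1
    ((@measurable_const ℝ Ω _ (𝓕 s) 1).indicator hA) fun ω => by
      by_cases hω : ω ∈ A <;> simp [hω]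
  have h2 : ∀ ω, A.indicator 1 ω * (N t ω - N s ω) = A.indicator (fun ω => N t ω - N s ω) ω := fun ω => by
    by_cases hω : ω ∈ A <;> simp [hω]
  simp_rw [h2] at h1
  rw [integral_indicator (𝓕.le s A hA), integral_sub (hi t ht).integrableOn (hi s hs).integrableOn,
    sub_eq_zero] at h1
  exact h1.symm

/-- A process which is almost surely the right limit of the conditional expectations of a bounded
random variable is a martingale. -/
lemma martingale_of_tendsto_condExp (h𝓕 : UsualConditions 𝓕 P) {Y : Ω → ℝ} {C : ℝ}
    (hY : ∀ᵐ ω ∂P, |Y ω| ≤ C) {G : Set Ω} (hG : MeasurableSet[𝓕 ⊥] G) (hGP : ∀ᵐ ω ∂P, ω ∈ G)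
    {N : Time T → Ω → ℝ} (hN0 : ∀ t, ∀ ω ∉ G, N t ω = 0)
    (hN : ∀ t, ∀ ω ∈ G, Tendsto (fun n => (P[Y | 𝓕 (gridSucc n t)]) ω) atTop (𝓝 (N t ω))) :
    Martingale N 𝓕 P := by
  -- `N t` is a limit of variables known arbitrarily soon after `t`; right-continuity of the
  -- filtration makes it known at `t`.
  have hmeas : ∀ t u, (∀ᶠ n in atTop, gridSucc n t ≤ u) → Measurable[𝓕 u] (N t) := by
    intro t u hu
    refine @measurable_of_tendsto_metrizable Ω ℝ (𝓕 u) _ _ _ _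
      (fun n => G.indicator (P[Y | 𝓕 (min u (gridSucc n t))])) _ (fun n => ?_) ?_
    · exact ((stronglyMeasurable_condExp.mono (𝓕.mono (min_le_left _ _))).measurable).indicator
        (𝓕.mono bot_le _ hG)
    · rw [tendsto_pi_nhds]
      intro ω
      by_cases hω : ω ∈ G
      · refine (hN t ω hω).congr' ?_
        filter_upwards [hu] with n hn
        rw [Set.indicator_of_mem hω, min_eq_right hn]
      · simp only [Set.indicator_of_notMem hω, hN0 t ω hω]
        exact tendsto_const_nhds
  have hNm : ∀ t, Measurable[𝓕 t] (N t) := by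
    intro t
    rcases eq_or_lt_of_le (le_top : t ≤ ⊤) with rfl | ht
    · exact hmeas ⊤ ⊤ (Eventually.of_forall fun _ => le_top)
    · intro B hB
      exact measurableSet_of_forall_gt h𝓕.rightCont ht fun u hu =>
        hmeas t u ((tendsto_gridSucc t).eventually_le_const hu) hB
  have hcond : ∀ s, ∀ᵐ ω ∂P, |(P[Y | 𝓕 s]) ω| ≤ C := fun s => ae_bdd_abs_condExp_of_ae_bdd_abs hY
  -- Without integrability the conditional expectations are zero by convention, and so is `N`.
  by_cases hYi : Integrable Y P
  swap
  · have h0 : ∀ t, N t = fun _ => 0 := fun t => by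
      ext ω
      by_cases hω : ω ∈ G
      · refine tendsto_nhds_unique (hN t ω hω) ?_
        simp only [condExp_of_not_integrable hYi, Pi.zero_apply]
        exact tendsto_const_nhds
      · exact hN0 t ω hω
    have : N = 0 := by ext t ω; rw [h0 t]; rfl
    rw [this]
    exact martingale_zero _ _ _
  have hNC : ∀ t, ∀ᵐ ω ∂P, ‖N t ω‖ ≤ C := fun t => by
    filter_upwards [hGP, ae_all_iff.mpr fun n => hcond (gridSucc n t)] with ω h1 h2
    exact le_of_tendsto' (hN t ω h1).abs h2
  have hNi : ∀ t, Integrable (N t) P := fun t =>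
    Integrable.of_bound ((hNm t).mono (𝓕.le t) le_rfl).aestronglyMeasurable C (hNC t)
  have hNY : ∀ t, N t =ᵐ[P] P[Y | 𝓕 t] := by
    intro t
    refine ae_eq_condExp_of_forall_setIntegral_eq (𝓕.le t) hYi (fun A _ _ => (hNi t).integrableOn)
      (fun A hA _ => ?_) (hNm t).stronglyMeasurable.aestronglyMeasurable
    have h1 : Tendsto (fun n => ∫ ω in A, (P[Y | 𝓕 (gridSucc n t)]) ω ∂P) atTop
        (𝓝 (∫ ω in A, N t ω ∂P)) :=
      tendsto_integral_of_dominated_convergence (fun _ => C)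
        (fun n => integrable_condExp.integrableOn.1) (integrable_const C)
        (fun n => ae_restrict_of_ae (hcond _))
        (ae_restrict_of_ae (by filter_upwards [hGP] with ω hω using hN t ω hω))
    have h2 : ∀ n, ∫ ω in A, (P[Y | 𝓕 (gridSucc n t)]) ω ∂P = ∫ ω in A, Y ω ∂P := fun n =>
      setIntegral_condExp (𝓕.le _) hYi (𝓕.mono ((le_gridCeil n t).trans (gridCeil_le_gridSucc n t)) _ hA)
    simp_rw [h2] at h1
    exact tendsto_nhds_unique h1 tendsto_const_nhds
  refine ⟨fun t => (hNm t).stronglyMeasurable, fun s t hst => ?_⟩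
  exact (condExp_congr_ae (hNY t)).trans
    ((condExp_condExp_of_le (𝓕.mono hst) (𝓕.le t)).trans (hNY s).symm)

/-- Uniformly bounded decompositions on all fine grids give a decomposition in continuous time. -/
theorem exists_martingale_of_isGridSemimartingale (h𝓕 : UsualConditions 𝓕 P) {Z : Time T → Ω → ℝ}
    (hZc : ∀ ω, IsCadlagPath fun t => Z t ω) {ρ : Ω → WithTop (Time T)} {C : ℝ} {n₀ : ℕ}
    (h : ∀ n, n₀ ≤ n → ∃ N v, IsGridSemimartingale 𝓕 P (gridSet T n) C
        (fun t ω => Z (stopAt t ((ρ ω).map (gridCeil n))) ω) N v) :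
    ∃ N : Time T → Ω → ℝ, Martingale N 𝓕 P ∧ (∀ ω, IsCadlagPath fun t => N t ω) ∧
      ∀ᵐ ω ∂P, BoundedVariationOn (fun t => Z (stopAt t (ρ ω)) ω - N t ω) Set.univ := by
  choose N v hNv using fun n => h (n₀ + n) (Nat.le_add_right _ _)
  have hNtop : ∀ n, Measurable (N n ⊤) := fun n =>
    ((hNv n).measurable ⊤ (top_mem_gridSet _)).mono (𝓕.le _) le_rfl
  obtain ⟨w, Y, hw0, hwn, hw1, -, hYi, hY⟩ := exists_convexCombination_integral_le (P := P) hNtop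
    fun n => (hNv n).abs_le ⊤ (top_mem_gridSet _)
  have hsupp : ∀ {n i}, i ∈ (w n).support → n ≤ i := fun {n i} hi => by
    by_contra h
    exact (Finsupp.mem_support_iff.mp hi) (hwn n i (not_le.mp h))
  set M : ℕ → Time T → Ω → ℝ := fun n t ω => ∑ i ∈ (w n).support, w n i * N i t ω with hM
  set X : ℕ → Time T → Ω → ℝ := fun n t ω => ∑ i ∈ (w n).support,
    w n i * Z (stopAt t ((ρ ω).map (gridCeil (n₀ + i)))) ω with hX
  set V : ℕ → Time T → Ω → ℝ := fun n t ω => ∑ i ∈ (w n).support, w n i * v i t ω with hV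
  have hcomb : ∀ n, IsGridSemimartingale 𝓕 P (gridSet T n) C (X n) (M n) (V n) := fun n =>
    IsGridSemimartingale.sum (fun i _ => hw0 n i) (hw1 n) fun i hi =>
      (hNv i).mono (gridSet_mono ((hsupp hi).trans (Nat.le_add_left _ _)))
  have hMi : ∀ n, ∀ t ∈ gridSet T n, Integrable (M n t) P := fun n t ht =>
    integrable_of_abs_le (((hcomb n).measurable t ht).mono (𝓕.le t) le_rfl) ((hcomb n).abs_le t ht)
  have htop := fun n => top_mem_gridSet (T := T) n
  have hYC : ∀ᵐ ω ∂P, |Y ω| ≤ C := by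
    filter_upwards [ae_tendsto_zero_of_integral_abs_le (fun n => (hMi n ⊤ (htop n)).sub hYi) hY]
      with ω hω
    have h1 : Tendsto (fun n => M n ⊤ ω) atTop (𝓝 (Y ω)) := by simpa using hω.add_const (Y ω)
    exact le_of_tendsto' h1.abs fun n => (hcomb n).abs_le ⊤ (htop n) ω
  -- Conditioning contracts `L¹`, so the summable rate at `T` holds at every grid time.
  have hMlim : ∀ t ∈ gridUnion T, ∀ᵐ ω ∂P,
      Tendsto (fun n => M n t ω) atTop (𝓝 ((P[Y | 𝓕 t]) ω)) := by
    intro t ht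
    obtain ⟨m, hm⟩ := Set.mem_iUnion.mp ht
    have h1 : ∀ᵐ ω ∂P, Tendsto (fun n => (P[M n ⊤ - Y | 𝓕 t]) ω) atTop (𝓝 0) :=
      ae_tendsto_zero_of_integral_abs_le (fun n => integrable_condExp) fun n =>
        (integral_abs_condExp_le _).trans (hY n)
    have h2 : ∀ n, ∀ᵐ ω ∂P, m ≤ n → (P[M n ⊤ - Y | 𝓕 t]) ω = M n t ω - (P[Y | 𝓕 t]) ω := by
      intro n
      by_cases hn : m ≤ n
      · filter_upwards [condExp_sub (hMi n ⊤ (htop n)) hYi (𝓕 t),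
          (hcomb n).condExp_eq (gridSet_mono hn hm) (htop n) le_top] with ω h3 h4 _
        rw [h3, Pi.sub_apply, h4]
      · exact ae_of_all _ fun ω h => absurd h hn
    filter_upwards [h1, ae_all_iff.mpr h2] with ω h3 h4
    have h5 : Tendsto (fun n => M n t ω - (P[Y | 𝓕 t]) ω) atTop (𝓝 0) :=
      h3.congr' (by filter_upwards [eventually_ge_atTop m] with n hn using h4 n hn)
    simpa using h5.add_const ((P[Y | 𝓕 t]) ω)
  set good : Set Ω := {ω | ∀ t ∈ gridUnion T,
    Tendsto (fun n => M n t ω) atTop (𝓝 ((P[Y | 𝓕 t]) ω))} with hgood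
  have hgoodP : ∀ᵐ ω ∂P, ω ∈ good := (ae_ball_iff countable_gridUnion).mpr hMlim
  have hXlim : ∀ t ω, Tendsto (fun n => X n t ω) atTop (𝓝 (Z (stopAt t (ρ ω)) ω)) := fun t ω =>
    tendsto_convexCombination hw0 hwn hw1
      ((tendsto_stopAt_map_gridCeil (hZc ω) t (ρ ω)).comp (tendsto_add_atTop_nat n₀ |>.congr
        fun n => Nat.add_comm _ _))
  set b : Ω → Time T → ℝ := fun ω t => Z (stopAt t (ρ ω)) ω - (P[Y | 𝓕 t]) ω with hb
  -- The variation of `X n - M n` over a fixed grid is at most `C` for large `n`, and this survives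
  -- the pointwise limit.
  have hbv : ∀ ω ∈ good, BoundedVariationOn (b ω) (gridUnion T) := by
    intro ω hω
    refine ne_top_of_le_ne_top (b := ENNReal.ofReal C) ENNReal.ofReal_ne_top
      (eVariationOn_gridUnion_le fun m => ?_)
    rw [gridSet_eq_image, eVariationOn.image_range_of_monotone _ (gridPt_mono m)]
    have h1 : ∀ j, edist (b ω (gridPt m j)) (b ω (gridPt m (j + 1))) =
        ENNReal.ofReal |b ω (gridPt m (j + 1)) - b ω (gridPt m j)| := fun j => by
      rw [edist_comm, edist_dist, Real.dist_eq]
    simp_rw [h1]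
    rw [← ENNReal.ofReal_sum_of_nonneg fun _ _ => abs_nonneg _]
    refine ENNReal.ofReal_le_ofReal ?_
    have hblim : ∀ t ∈ gridUnion T, Tendsto (fun n => X n t ω - M n t ω) atTop (𝓝 (b ω t)) :=
      fun t ht => (hXlim t ω).sub (hω t ht)
    refine le_of_tendsto (tendsto_finsetSum (Finset.range (2 ^ m)) fun j _ =>
      ((hblim _ (gridPt_mem_union m (j + 1))).sub (hblim _ (gridPt_mem_union m j))).abs) ?_
    filter_upwards [eventually_ge_atTop m] with n hn
    have hmem : ∀ j, gridPt m j ∈ gridSet T n := fun j => gridSet_mono hn (gridPt_mem m j)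
    refine (Finset.sum_le_sum fun j _ => (hcomb n).abs_sub_le _ (hmem j) _ (hmem (j + 1))
      (gridPt_mono m (Nat.le_succ j)) ω).trans ?_
    rw [Finset.sum_range_sub fun j => V n (gridPt m j) ω]
    linarith [(hcomb n).le _ (hmem (2 ^ m)) ω, (hcomb n).nonneg _ (hmem 0) ω]
  choose! b' hb'1 hb'2 hb'3 using fun ω (hω : ω ∈ good) => exists_cadlag_regularization (hbv ω hω)
  classical
  -- Subtracting the regularized remainder from the stopped process gives a càdlàg path that is the
  -- right limit of the conditional expectations of `Y`.
  refine ⟨fun t ω => if ω ∈ good then Z (stopAt t (ρ ω)) ω - b' ω t else 0, ?_, fun ω => ?_, ?_⟩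
  · refine martingale_of_tendsto_condExp h𝓕 hYC (G := good) (h𝓕.measurableSet_of_ae hgoodP ⊥) hgoodP
      (fun t ω hω => if_neg hω) fun t ω hω => ?_
    simp only [if_pos hω]
    have h1 : Tendsto (fun n => Z (stopAt (gridSucc n t) (ρ ω)) ω) atTop
        (𝓝 (Z (stopAt t (ρ ω)) ω)) :=
      ((hZc ω).comp_stopAt (ρ ω) t).1.tendsto.comp (tendsto_nhdsWithin_iff.mpr ⟨tendsto_gridSucc t,
        Eventually.of_forall fun n => (le_gridCeil n t).trans (gridCeil_le_gridSucc n t)⟩)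
    refine (h1.sub (hb'3 ω hω t)).congr fun n => ?_
    simp only [hb]
    ring
  · by_cases hω : ω ∈ good
    · simp only [if_pos hω]
      exact ((hZc ω).comp_stopAt (ρ ω)).sub (hb'2 ω hω)
    · simp only [if_neg hω]
      exact isCadlagPath_const 0
  · filter_upwards [hgoodP] with ω hω
    simp only [if_pos hω, sub_sub_cancel]
    exact hb'1 ω hω

end Limit

/-! ### Pasting local decompositions together. -/

section Gluing

lemma boundedVariationOn_sub {ι : Type*} [LinearOrder ι] {f g : ι → ℝ} {s : Set ι}
    (hf : BoundedVariationOn f s) (hg : BoundedVariationOn g s) :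
    BoundedVariationOn (fun t => f t - g t) s := by
  refine ne_top_of_le_ne_top (ENNReal.add_ne_top.mpr ⟨hf, hg⟩) ?_
  refine iSup_le fun p => ?_
  calc ∑ i ∈ Finset.range p.1, edist (f (p.2.1 (i + 1)) - g (p.2.1 (i + 1)))
        (f (p.2.1 i) - g (p.2.1 i))
      ≤ ∑ i ∈ Finset.range p.1, (edist (f (p.2.1 (i + 1))) (f (p.2.1 i)) +
        edist (g (p.2.1 (i + 1))) (g (p.2.1 i))) := Finset.sum_le_sum fun i _ => by
        simp only [edist_dist, Real.dist_eq]
        rw [← ENNReal.ofReal_add (abs_nonneg _) (abs_nonneg _)]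
        refine ENNReal.ofReal_le_ofReal ?_
        rw [sub_sub_sub_comm]
        exact abs_sub _ _
    _ ≤ _ := by
        rw [Finset.sum_add_distrib]
        exact add_le_add (eVariationOn.sum_le p.2.2.1 p.2.2.2)
          (eVariationOn.sum_le p.2.2.1 p.2.2.2)

lemma boundedVariationOn_const {ι : Type*} [LinearOrder ι] (c : ℝ) (s : Set ι) :
    BoundedVariationOn (fun _ : ι => c) s := by
  have h0 : eVariationOn (fun _ : ι => c) s = 0 :=
    eVariationOn.constant_on (by rintro _ ⟨_, _, rfl⟩ _ ⟨_, _, rfl⟩; rfl)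
  exact ne_top_of_le_ne_top ENNReal.zero_ne_top h0.le

variable {T : ℝ≥0}

lemma boundedVariationOn_stop {x : Time T → ℝ} (hx : BoundedVariationOn x Set.univ)
    (a : WithTop (Time T)) : BoundedVariationOn (fun t => x (stopAt t a)) Set.univ :=
  ne_top_of_le_ne_top hx (eVariationOn.comp_le_of_monotoneOn x (fun t => stopAt t a)
    ((stopAt_mono a).monotoneOn _) fun _ _ => Set.mem_univ _)

variable {Ω : Type*} {mΩ : MeasurableSpace Ω} {𝓕 : Filtration (Time T) mΩ} {P : Measure Ω}

/-- Pasting processes together along an increasing sequence of random times. -/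
noncomputable def paste (r : ℕ → Ω → WithTop (Time T)) (N : ℕ → Time T → Ω → ℝ) (m : ℕ) (t : Time T)
    (ω : Ω) : ℝ :=
  ∑ k ∈ Finset.range m, (N k (stopAt t (r (k + 1) ω)) ω - N k (stopAt t (r k ω)) ω)

lemma paste_stopAt {r : ℕ → Ω → WithTop (Time T)} (hr : ∀ ω, Monotone fun m => r m ω)
    (N : ℕ → Time T → Ω → ℝ) {n m : ℕ} (h : n ≤ m) (t : Time T) (ω : Ω) :
    paste r N m (stopAt t (r n ω)) ω = paste r N n t ω := by
  obtain ⟨l, rfl⟩ := Nat.exists_eq_add_of_le h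
  rw [paste, Finset.sum_range_add, Finset.sum_eq_zero (s := Finset.range l), add_zero, paste]
  · refine Finset.sum_congr rfl fun k hk => ?_
    have hk' := Finset.mem_range.mp hk
    rw [stopAt_stopAt, stopAt_stopAt, min_eq_right (hr ω hk'), min_eq_right (hr ω hk'.le)]
  · intro k _
    rw [stopAt_stopAt, stopAt_stopAt, min_eq_left (hr ω (show n ≤ n + k + 1 by omega)),
      min_eq_left (hr ω (show n ≤ n + k by omega)), sub_self]

lemma paste_of_eq_top {r : ℕ → Ω → WithTop (Time T)} (hr : ∀ ω, Monotone fun m => r m ω)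
    (N : ℕ → Time T → Ω → ℝ) {n m : ℕ} {ω : Ω} (hn : r n ω = ⊤) (hm : r m ω = ⊤) (t : Time T) :
    paste r N m t ω = paste r N n t ω := by
  rcases le_total n m with h | h
  · rw [← paste_stopAt hr N h, hn, stopAt_top]
  · rw [← paste_stopAt hr N h, hm, stopAt_top]

lemma martingale_paste [IsProbabilityMeasure P] {r : ℕ → Ω → WithTop (Time T)}
    (hr : ∀ m, IsStoppingTime 𝓕 (r m)) {N : ℕ → Time T → Ω → ℝ} (hN : ∀ k, Martingale (N k) 𝓕 P)
    (hNc : ∀ k ω, IsCadlagPath fun t => N k t ω) (m : ℕ) : Martingale (paste r N m) 𝓕 P := by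
  induction m with
  | zero =>
    have : paste r N 0 = 0 := by ext t ω; simp [paste]
    rw [this]
    exact martingale_zero _ _ _
  | succ m ih =>
    have : paste r N (m + 1) = paste r N m + ((fun t ω => N m (stopAt t (r (m + 1) ω)) ω) -
        fun t ω => N m (stopAt t (r m ω)) ω) := by
      ext t ω
      simp only [paste, Finset.sum_range_succ, Pi.add_apply, Pi.sub_apply]
    rw [this]
    exact ih.add ((martingale_stop (hN m) (hNc m) (hr _)).sub
      (martingale_stop (hN m) (hNc m) (hr _)))

lemma isCadlagPath_paste {r : ℕ → Ω → WithTop (Time T)} {N : ℕ → Time T → Ω → ℝ}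
    (hNc : ∀ k ω, IsCadlagPath fun t => N k t ω) (m : ℕ) (ω : Ω) :
    IsCadlagPath fun t => paste r N m t ω :=
  IsCadlagPath.sum _ fun k _ => ((hNc k ω).comp_stopAt _).sub ((hNc k ω).comp_stopAt _)

/-- Induction by `S^{r (m+1)} - paste (m+1) = (S - N m)^{r (m+1)} - ((S - N m)^{r m} - (S^{r m} -
paste m))`. -/
lemma boundedVariationOn_sub_paste {r : ℕ → Ω → WithTop (Time T)} {N : ℕ → Time T → Ω → ℝ}
    {S : Time T → Ω → ℝ} {ω : Ω} (hr0 : r 0 ω = ⊥) (hr : Monotone fun m => r m ω)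
    (h : ∀ k, BoundedVariationOn (fun t => S (stopAt t (r (k + 1) ω)) ω -
      N k (stopAt t (r (k + 1) ω)) ω) Set.univ) (m : ℕ) :
    BoundedVariationOn (fun t => S (stopAt t (r m ω)) ω - paste r N m t ω) Set.univ := by
  induction m with
  | zero =>
    simp only [hr0, stopAt_bot, paste, Finset.range_zero, Finset.sum_empty, sub_zero]
    exact boundedVariationOn_const _ _
  | succ m ih =>
    have h1 := boundedVariationOn_stop (h m) (r m ω)
    simp only [stopAt_stopAt, min_eq_left (hr (Nat.le_succ m))] at h1
    have h2 := boundedVariationOn_sub (h m) (boundedVariationOn_sub h1 ih)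
    refine (congrArg (fun f => BoundedVariationOn f Set.univ) (funext fun t => ?_)).mp h2
    simp only [paste, Finset.sum_range_succ]
    ring

/-- A càdlàg adapted process which is a semimartingale up to arbitrarily late stopping times is a
semimartingale. -/
theorem isSemimartingale_of_forall_exists [IsProbabilityMeasure P] (h𝓕 : UsualConditions 𝓕 P)
    {S : Time T → Ω → ℝ} (hS : StronglyAdapted 𝓕 S)
    (h : ∀ ε : ℝ, 0 < ε → ∃ ρ : Ω → WithTop (Time T), IsStoppingTime 𝓕 ρ ∧ P.real {ω | ρ ω ≠ ⊤} ≤ ε ∧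
      ∃ N : Time T → Ω → ℝ, Martingale N 𝓕 P ∧ (∀ ω, IsCadlagPath fun t => N t ω) ∧
        ∀ᵐ ω ∂P, BoundedVariationOn (fun t => S (stopAt t (ρ ω)) ω - N t ω) Set.univ) :
    IsSemimartingale 𝓕 P S := by
  classical
  choose ρ hρ hρP N hN hNc hNv using fun k : ℕ => h ((1 / 2) ^ k) (by positivity)
  -- The infima over `k ≥ m` increase in `m`, and by Borel–Cantelli they are almost surely `⊤`
  -- eventually.
  choose σ hσ hσglb using fun m => exists_isStoppingTime_iInf h𝓕.rightCont fun k => hρ (m + k)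
  set r : ℕ → Ω → WithTop (Time T) := fun m => Nat.casesOn m (fun _ => ⊥) σ with hr
  have hr0 : ∀ ω, r 0 ω = ⊥ := fun ω => rfl
  have hrs : ∀ m, IsStoppingTime 𝓕 (r m) := fun m => by
    cases m with
    | zero => exact isStoppingTime_const 𝓕 ⊥
    | succ m => exact hσ m
  have hrm : ∀ ω, Monotone fun m => r m ω := fun ω => monotone_nat_of_le_succ fun m => by
    cases m with
    | zero => exact bot_le
    | succ m =>
      refine (hσglb (m + 1) ω).2 ?_
      rintro _ ⟨k, rfl⟩
      exact (hσglb m ω).1 ⟨k + 1, by simp only [show m + (k + 1) = m + 1 + k by omega]⟩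
  have hrρ : ∀ m ω, r (m + 1) ω ≤ ρ m ω := fun m ω => (hσglb m ω).1 ⟨0, rfl⟩
  set E : Set Ω := {ω | ∃ m, r m ω = ⊤} with hE
  have hEP : ∀ᵐ ω ∂P, ω ∈ E := by
    have hsum : ∑' k, P {ω | ρ k ω ≠ ⊤} ≠ ∞ := by
      refine ne_top_of_le_ne_top (b := ∑' k : ℕ, ENNReal.ofReal ((1 / 2) ^ k)) ?_
        (ENNReal.tsum_le_tsum fun k => ?_)
      · exact (ENNReal.ofReal_tsum_of_nonneg (fun n => by positivity)
          summable_geometric_two) ▸ ENNReal.ofReal_ne_top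
      · rw [← ofReal_measureReal]
        exact ENNReal.ofReal_le_ofReal (hρP k)
    filter_upwards [ae_eventually_notMem hsum] with ω hω
    obtain ⟨m, hm⟩ := eventually_atTop.mp hω
    refine ⟨m + 1, top_le_iff.mp ((hσglb m ω).2 ?_)⟩
    rintro _ ⟨k, rfl⟩
    exact (not_not.mp (hm (m + k) (Nat.le_add_right _ _))).ge
  have hEm : MeasurableSet[𝓕 ⊥] E := h𝓕.measurableSet_of_ae hEP ⊥
  set M : Time T → Ω → ℝ := fun t ω =>
    if hω : ∃ m, r m ω = ⊤ then paste r N (Nat.find hω) t ω else 0 with hM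
  have hMeq : ∀ {m ω}, r m ω = ⊤ → ∀ t, M t ω = paste r N m t ω := fun {m ω} hm t => by
    have hω : ∃ m, r m ω = ⊤ := ⟨m, hm⟩
    simp only [hM, dif_pos hω]
    exact paste_of_eq_top hrm N hm (Nat.find_spec hω) t
  have hM0 : ∀ {ω}, ω ∉ E → ∀ t, M t ω = 0 := fun {ω} hω t => dif_neg hω
  have hMstop : ∀ n t, ∀ ω ∈ E, M (stopAt t (r n ω)) ω = paste r N n t ω := by
    rintro n t ω ⟨m, hm⟩
    have hmax : r (max n m) ω = ⊤ := top_le_iff.mp (hm.ge.trans (hrm ω (le_max_right n m)))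
    rw [hMeq hmax, paste_stopAt hrm N (le_max_left n m)]
  have hmart := martingale_paste (P := P) hrs hN hNc
  have hMa : StronglyAdapted 𝓕 M := fun t => by
    refine @stronglyMeasurable_of_tendsto Ω ℝ ℕ (𝓕 t) _ _ atTop _ _
      (fun n => E.indicator (paste r N n t)) _
      (fun n => ((hmart n).1 t).indicator (𝓕.mono bot_le _ hEm)) ?_
    rw [tendsto_pi_nhds]
    intro ω
    by_cases hω : ω ∈ E
    · obtain ⟨m, hm⟩ := hω
      refine tendsto_const_nhds.congr' ?_
      filter_upwards [eventually_ge_atTop m] with n hn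
      rw [Set.indicator_of_mem (show ω ∈ E from ⟨m, hm⟩)]
      exact hMeq (top_le_iff.mp (hm.ge.trans (hrm ω hn))) t
    · simp only [Set.indicator_of_notMem hω, hM0 hω]
      exact tendsto_const_nhds
  refine ⟨M, fun t ω => S t ω - M t ω, ⟨hMa, ae_of_all _ fun ω => ?_, r, ⟨⟨hrs, ?_⟩, ?_⟩, fun n => ?_⟩,
    ⟨fun t => (hS t).sub (hMa t), ?_⟩, fun t ω => (add_sub_cancel _ _).symm⟩
  · by_cases hω : ω ∈ E
    · obtain ⟨m, hm⟩ := hω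
      simp only [hMeq hm]
      exact isCadlagPath_paste hNc m ω
    · simp only [hM0 hω]
      exact isCadlagPath_const 0
  · filter_upwards [hEP] with ω hω
    obtain ⟨m, hm⟩ := hω
    refine tendsto_const_nhds.congr' ?_
    filter_upwards [eventually_ge_atTop m] with n hn
    exact (top_le_iff.mp (hm.ge.trans (hrm ω hn))).symm
  · exact ae_of_all _ hrm
  · refine (congrArg (fun X => Martingale X 𝓕 P) (?_ : _ = cut {ω | ⊥ < r n ω} (r n) M)).mpr ?_
    · rfl
    -- The pasted process vanishes where `r n = 0`, so the factor `1_{r n > 0}` in the localization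
    -- changes nothing.
    have he : cut {ω | ⊥ < r n ω} (r n) M = fun t => E.indicator (paste r N n t) := by
      ext t ω
      have hbot : ¬ ⊥ < r n ω → paste r N n t ω = 0 := fun h1 => by
        refine Finset.sum_eq_zero fun k hk => ?_
        have hn : r n ω = ⊥ := le_bot_iff.mp (not_lt.mp h1)
        have hk' := Finset.mem_range.mp hk
        have h2 : r (k + 1) ω = ⊥ := le_bot_iff.mp ((hrm ω hk').trans hn.le)
        have h3 : r k ω = ⊥ := le_bot_iff.mp ((hrm ω hk'.le).trans hn.le)
        rw [h2, h3, sub_self]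
      by_cases hω : ω ∈ E
      · rw [Set.indicator_of_mem hω, ← hMstop n t ω hω]
        by_cases h1 : ⊥ < r n ω
        · rw [cut_of_mem (show ω ∈ {ω | ⊥ < r n ω} from h1)]
        · rw [cut_of_notMem (show ω ∉ {ω | ⊥ < r n ω} from h1), hMstop n t ω hω, hbot h1]
      · rw [Set.indicator_of_notMem hω]
        by_cases h1 : ⊥ < r n ω
        · rw [cut_of_mem (show ω ∈ {ω | ⊥ < r n ω} from h1), hM0 hω]
        · rw [cut_of_notMem (show ω ∉ {ω | ⊥ < r n ω} from h1)]
    rw [he]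
    exact martingale_indicator (hmart n) hEm
  · filter_upwards [hEP, ae_all_iff.mpr hNv] with ω hω hv
    obtain ⟨m, hm⟩ := hω
    have h1 := boundedVariationOn_sub_paste (S := S) (N := N) (hr0 ω) (hrm ω) (fun k => by
      have h2 := boundedVariationOn_stop (hv k) (r (k + 1) ω)
      simpa only [stopAt_stopAt, min_eq_left (hrρ k ω)] using h2) m
    simp only [hm, stopAt_top] at h1
    simpa only [hMeq hm] using h1

end Gluing

/-- The bounded localization of `S` is decomposed up to `ρ`. On `G` it agrees with `S` up to `ρ ∧ π
m`. Off `G`, almost surely `π m` is `0`, so the stopped `S` is constant and `N` itself has bounded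
variation. -/
theorem isSemimartingale_of_noFreeLunch {T : ℝ≥0} {Ω : Type*} {mΩ : MeasurableSpace Ω}
    {𝓕 : Filtration (Time T) mΩ} {P : Measure Ω} [IsProbabilityMeasure P]
    (h𝓕 : UsualConditions 𝓕 P) {S : Time T → Ω → ℝ} (hS : StronglyAdapted 𝓕 S)
    (hSc : IsCadlag P S) (hSb : IsLocallyBounded 𝓕 P S)
    (hNFL : NoFreeLunchVanishingRiskLittleInvestment 𝓕 P S) : IsSemimartingale 𝓕 P S := by
  refine isSemimartingale_of_forall_exists h𝓕 hS fun ε hε => ?_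
  obtain ⟨π, hπ, hπS⟩ := hSb
  obtain ⟨m, hm⟩ := ((tendsto_measureReal_ne_top hπ.toIsPreLocalizingSequence).eventually_lt_const
    (half_pos hε)).exists
  obtain ⟨K, hK⟩ := hπS m
  set good : Ω → Prop := fun ω => IsCadlagPath (fun t => S t ω) ∧
    ∀ t, |cut {ω | ⊥ < π m ω} (π m) S t ω| ≤ K with hgood
  have hgood_ae : ∀ᵐ ω ∂P, good ω := by
    filter_upwards [hSc, hK] with ω h1 h2 using ⟨h1, h2⟩
  set G : Set Ω := {ω | good ω} ∩ {ω | ⊥ < π m ω} with hGdef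
  have hG : MeasurableSet[𝓕 ⊥] G := (h𝓕.measurableSet_of_ae hgood_ae ⊥).inter
    ((hπ.isStoppingTime m).measurableSet_gt ⊥)
  have hGπ : ∀ᵐ ω ∂P, ω ∉ G → π m ω = ⊥ := by
    filter_upwards [hgood_ae] with ω hω h1
    exact le_bot_iff.mp (not_lt.mp fun h2 => h1 ⟨hω, h2⟩)
  have hZa := stronglyAdapted_cut hG hS (fun ω hω => hω.1.1) (hπ.isStoppingTime m)
  have hZc := isCadlagPath_cut (F := G) (X := S) (fun ω hω => hω.1.1) (π m)
  have hZK : ∀ t ω, |cut G (π m) S t ω| ≤ max K 0 := fun t ω => by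
    by_cases h : ω ∈ G
    · have := h.1.2 t
      rw [cut_of_mem h.2] at this
      rw [cut_of_mem h]
      exact le_max_of_le_left this
    · rw [cut_of_notMem h, abs_zero]
      exact le_max_right _ _
  obtain ⟨ρ, hρ, hρP, C, n₀, hdec⟩ := exists_isGridSemimartingale_stop h𝓕.rightCont
    (fun t => (hZa t).measurable) (le_max_right K 0) hZK
    (boundedGridGains_cut hNFL (hπ.isStoppingTime m) hGπ) (half_pos hε)
  obtain ⟨N, hN, hNc, hNv⟩ := exists_martingale_of_isGridSemimartingale h𝓕 hZc hdec
  refine ⟨fun ω => min (ρ ω) (π m ω), hρ.min (hπ.isStoppingTime m), ?_, N, hN, hNc, ?_⟩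
  · refine (measureReal_mono (?_ : _ ⊆ {ω | ρ ω ≠ ⊤} ∪ {ω | π m ω ≠ ⊤})).trans
      ((measureReal_union_le _ _).trans (by linarith))
    intro ω hω
    by_contra h
    rw [Set.mem_union, not_or] at h
    refine hω ?_
    simp only [show ρ ω = ⊤ from not_not.mp h.1, show π m ω = ⊤ from not_not.mp h.2, min_self]
  · filter_upwards [hNv, hGπ] with ω h1 h2
    by_cases h : ω ∈ G
    · simpa only [cut_of_mem h, stopAt_stopAt] using h1
    · simp only [cut_of_notMem h] at h1
      simp only [h2 h, min_bot_right, stopAt_bot]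
      have h3 := boundedVariationOn_sub (boundedVariationOn_const (S ⊥ ω) Set.univ)
        (boundedVariationOn_sub (boundedVariationOn_const 0 Set.univ) h1)
      simpa only [zero_sub, neg_neg] using h3

end StochProc

theorem theorem1p5 {T : ℝ≥0} {Ω : Type*} {mΩ : MeasurableSpace Ω}
    (P : Measure Ω) [IsProbabilityMeasure P]
    (𝓕 : Filtration (StochProc.Time T) mΩ) (h𝓕 : StochProc.UsualConditions 𝓕 P)
    (S : StochProc.Time T → Ω → ℝ)
    (hS_adapted : StronglyAdapted 𝓕 S)
    (hS_cadlag : StochProc.IsCadlag P S)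
    (hS_bdd : StochProc.IsLocallyBounded 𝓕 P S) :
    StochProc.NoFreeLunchVanishingRiskLittleInvestment 𝓕 P S ↔
      StochProc.IsSemimartingale 𝓕 P S :=
  ⟨StochProc.isSemimartingale_of_noFreeLunch h𝓕 hS_adapted hS_cadlag hS_bdd,
    StochProc.noFreeLunch_of_isSemimartingale h𝓕 hS_adapted hS_cadlag hS_bdd⟩
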